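/- **Setting.** Let $Q=[0,1)^3$, $Q'=[-\pi,\pi)^3$, and let $\mu$ be a $Q$-periodic Borel measure on $\mathbb R^3$ with $\mu(Q)=1$ such that $\int_Q\partial_j\phi\,d\mu=0$ for all smooth $Q$-periodic $\phi:\mathbb R^3\to\mathbb C$ and $j=1,2,3$. For $\varepsilon>0$ put $\mu^\varepsilon(B)=\varepsilon^3\mu(\varepsilon^{-1}B)$. Let $A$ be a real, differentiable, $Q$-periodic, symmetric and positive definite $3\times3$ matrix function. Write $e_\kappa(x)=e^{i\kappa\cdot x}$. **Maxwell system.** For $g\in L^2(\mathbb R^3,d\mu^\varepsilon)^3$ that is divergence free, i.e. $\int g\cdot\overline{\nabla\phi}\,d\mu^\varepsilon=0$ for all $\phi\in C_0^\infty(\mathbb R^3)$, let $(\mathcal D_\varepsilon,\mathcal B_\varepsilon)$ solve $$\operatorname{curl}(A(\cdot/\varepsilon)\mathcal D_\varepsilon)+\mathcal B_\varepsilon=0,\qquad \operatorname{curl}\mathcal B_\varepsilon-\mathcal D_\varepsilon=g .$$ Here, with $A^{1/2}=A^{1/2}(\cdot/\varepsilon)$, this means that $D_\varepsilon=A^{1/2}\mathcal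 D_\varepsilon$ and $\operatorname{curl}(A^{1/2}D_\varepsilon)=-\mathcal B_\varepsilon$ form a pair in $H$, the closure in $L^2(d\mu^\varepsilon)\oplus L^2(d\mu^\varepsilon)$ of the pairs $(\phi,\operatorname{curl}(A^{1/2}\phi))$ with $A^{1/2}\phi\in C_0^\infty(\mathbb R^3)$, and that $$\int \operatorname{curl}(A^{1/2}D_\varepsilon)\cdot\overline{\operatorname{curl}(A^{1/2}\phi)}\,d\mu^\varepsilon+\int D_\varepsilon\cdot\overline\phi\,d\mu^\varepsilon=-\int A^{1/2}g\cdot\overline\phi\,d\mu^\varepsilon\quad\text{for all }(\phi,\operatorname{curl}(A^{1/2}\phi))\in H .$$ **Cell problem.** Let $C^\infty_{\#,0}(Q)$ be the smooth $Q$-periodic functions with zero $\mu$-mean on $Q$. For $\kappa\in\mathbb R^3$ and $c\in\mathbb C^3$, a solution of the cell problem is a pair $(\psi,\nabla(e_\kappa\psi))$ in the $L^2(Q,d\mu)$-closure of $\{(\phi,\nabla(e_\kappa\phi)):\phi\in C^\infty_{\#,0}(Q)\}$ with $$\int_Q A^{-1}\bigl(\nabla(e_\kappa\psi)+e_\kappa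 c\bigr)\cdot\overline{\nabla(e_\kappa\phi)}\,d\mu=0\qquad\text{for all }\phi\in C^\infty_{\#,0}(Q).$$ Let $\Psi_\kappa=(\Psi_{\kappa,1},\Psi_{\kappa,2},\Psi_{\kappa,3})$ solve it for the three coordinate vectors $c$, and put $$\widehat A^{\rm hom}_\kappa=\int_Q A^{-1}\bigl(\overline{e_\kappa}\nabla(e_\kappa\Psi_\kappa)+I\bigr)d\mu,\qquad \mathfrak A^{\rm hom}_\theta=i\theta\times i\theta\times\bigl(\widehat A^{\rm hom}_{\varepsilon\theta}\bigr)^{-1},$$ where the $j$-th column of $\nabla(e_\kappa\Psi_\kappa)$ is $\nabla(e_\kappa\Psi_{\kappa,j})$. **Claim.** The cell problem is solvable for all $\kappa\in\mathbb R^3$, $c\in\mathbb C^3$, and there is a constant $C>0$, independent of $\varepsilon$ and $g$, such that the following holds for every $\varepsilon>0$ and every divergence-free $g\in L^2(\mathbb R^3,d\mu^\varepsilon)^3$. The Fourier transform $\widehat g(\theta)=(2\pi)^{-3/2}\int g\,\overline{e_\theta}\,d\mu^\varepsilon$ exists as the limit in $L^2_{\rm loc}(\mathbb R^3,d\theta)$,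 as $R\to\infty$, of the transforms of $g\mathbf 1_{|x|<R}$. The function $$g^\varepsilon_\theta(y)=\Bigl(\frac{\varepsilon^2}{2\pi}\Bigr)^{3/2}\sum_{n\in\mathbb Z^3}g(\varepsilon y+\varepsilon n)\,\overline{e_\theta(\varepsilon y+\varepsilon n)},$$ defined by the same truncation as a limit in $L^2(\varepsilon^{-1}Q'\times Q,d\theta\times d\mu)$, satisfies $\int_Q g^\varepsilon_\theta\,d\mu=\widehat g(\theta)$ for a.e. $\theta\in\varepsilon^{-1}Q'$. Moreover, for every solution $(\mathcal D_\varepsilon,\mathcal B_\varepsilon)$ of the Maxwell system, $$\Bigl\|\mathcal B_\varepsilon-\operatorname{curl}\Bigl((2\pi)^{-3/2}\int_{\mathbb R^3}\bigl(\widehat A^{\rm hom}_{\varepsilon\theta}\bigr)^{-1}\bigl(\mathfrak A^{\rm hom}_\theta+I\bigr)^{-1}\widehat g(\theta)\,e_\theta\,d\theta\Bigr)\Bigr\|_{L^2(\mathbb R^3,d\mu^\varepsilon)}\le C\varepsilon\|g\|_{L^2(\mathbb R^3,d\mu^\varepsilon)},$$ where the integral and its curl are the limits in $L^2(\mathbb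 R^3,d\mu^\varepsilon)$, as $R\to\infty$, of the integrals over $|\theta|<R$ and of their classical curls. -/

import Mathlib

open MeasureTheory Filter Topology
open scoped ENNReal ContDiff

namespace MaxwellHom

/-- Physical (and dual) space `ℝ³`. -/
abbrev R3 := EuclideanSpace ℝ (Fin 3)

/-- Complex vectors. -/
abbrev C3 := EuclideanSpace ℂ (Fin 3)

/-- The `j`-th coordinate vector of `ℝ³`. -/
noncomputable def basisVec (j : Fin 3) : R3 := EuclideanSpace.single j 1

/-- The unit cell `Q = [0,1)³`. -/
def unitCell : Set R3 := {x | ∀ i, x i ∈ Set.Ico (0 : ℝ) 1}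

/-- The rescaled dual cell `ε⁻¹ Q'`, where `Q' = [-π,π)³`. -/
def dualCell (ε : ℝ) : Set R3 := {θ | ∀ i, ε * θ i ∈ Set.Ico (-Real.pi) Real.pi}

/-- `Q`-periodicity of a function. -/
def IsPeriodic {β : Type*} (f : R3 → β) : Prop := ∀ (j : Fin 3) (x : R3), f (x + basisVec j) = f x

/-- `Q`-periodicity of a measure. -/
def IsPeriodicMeasure (μ : Measure R3) : Prop :=
  ∀ j : Fin 3, μ.map (fun x => x + basisVec j) = μ

/-- The `ε`-periodic measure `μ^ε(B) = ε³ μ(ε⁻¹ B)`. -/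
noncomputable def scaledMeasure (μ : Measure R3) (ε : ℝ) : Measure R3 :=
  ENNReal.ofReal (ε ^ 3) • μ.map (fun x => ε • x)

/-- The plane wave `e_κ(x) = exp(i κ · x)`. -/
noncomputable def planeWave (κ x : R3) : ℂ := Complex.exp (Complex.I * ((inner ℝ κ x : ℝ) : ℂ))

/-- The classical partial derivative `∂_j f`. -/
noncomputable def pderiv (j : Fin 3) (f : R3 → ℂ) (x : R3) : ℂ := fderiv ℝ f x (basisVec j)

/-- The classical gradient. -/
noncomputable def grad (f : R3 → ℂ) (x : R3) : C3 := WithLp.toLp 2 fun j => pderiv j f x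

/-- The classical curl. -/
noncomputable def curl (v : R3 → C3) (x : R3) : C3 :=
  !₂[pderiv 1 (fun y => v y 2) x - pderiv 2 (fun y => v y 1) x,
     pderiv 2 (fun y => v y 0) x - pderiv 0 (fun y => v y 2) x,
     pderiv 0 (fun y => v y 1) x - pderiv 1 (fun y => v y 0) x]

/-- A complex matrix acting on a complex vector. -/
noncomputable def cmul (M : Matrix (Fin 3) (Fin 3) ℂ) (v : C3) : C3 :=
  WithLp.toLp 2 (M.mulVec v.ofLp)

/-- A real matrix acting on a complex vector. -/
noncomputable def rmul (M : Matrix (Fin 3) (Fin 3) ℝ) (v : C3) : C3 :=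
  cmul (M.map (fun t : ℝ => (t : ℂ))) v

open scoped MatrixOrder in
/-- The positive square root of a positive matrix. -/
noncomputable def msqrt (M : Matrix (Fin 3) (Fin 3) ℝ) : Matrix (Fin 3) (Fin 3) ℝ := CFC.sqrt M

/-- The coefficient `A` is differentiable, `Q`-periodic, symmetric and positive definite
(boundedness and uniform positivity follow by continuity and periodicity). -/
structure IsCoefficient (A : R3 → Matrix (Fin 3) (Fin 3) ℝ) : Prop where
  differentiable : ∀ i j, Differentiable ℝ fun x => A x i j
  periodic : IsPeriodic A
  posDef : ∀ x, (A x).PosDef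

/-! ### The Maxwell system in the whole space -/

/-- `div g = 0` in `ℝ³` with respect to the measure `ν`. -/
def IsDivFree (ν : Measure R3) (g : R3 → C3) : Prop :=
  ∀ φ : R3 → ℂ, ContDiff ℝ ∞ φ → HasCompactSupport φ → ∫ x, inner ℂ (grad φ x) (g x) ∂ν = 0

/-- `(u, w) ∈ H¹_{curl S}(ℝ³, dν)`: the pair `(u, w)`, with `w` a `curl (S u)`, belongs to the
closure in `L²(dν) ⊕ L²(dν)` of the pairs `(φ, curl (S φ))` with `S φ` smooth and compactly
supported. -/
structure MemHcurl (S : R3 → Matrix (Fin 3) (Fin 3) ℝ) (ν : Measure R3) (u w : R3 → C3) :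
    Prop where
  left_mem : MemLp u 2 ν
  right_mem : MemLp w 2 ν
  closure : ∀ δ : ℝ≥0∞, 0 < δ → ∃ φ : R3 → C3,
    ContDiff ℝ ∞ (fun x => rmul (S x) (φ x)) ∧ HasCompactSupport (fun x => rmul (S x) (φ x)) ∧
    eLpNorm (fun x => u x - φ x) 2 ν < δ ∧
    eLpNorm (fun x => w x - curl (fun y => rmul (S y) (φ y)) x) 2 ν < δ

/-- Weak solution `(D, curl (S D)) = (D, w)` of `S curl curl S D + D = - S g`. -/
structure IsWeakSolution (S : R3 → Matrix (Fin 3) (Fin 3) ℝ) (ν : Measure R3) (g D w : R3 → C3) :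
    Prop where
  mem : MemHcurl S ν D w
  weak : ∀ φ v : R3 → C3, MemHcurl S ν φ v →
    ∫ x, inner ℂ (v x) (w x) ∂ν + ∫ x, inner ℂ (φ x) (D x) ∂ν =
      -∫ x, inner ℂ (φ x) (rmul (S x) (g x)) ∂ν

/-- The square root `A^{1/2}(· / ε)`. -/
noncomputable def sqrtCoeff (A : R3 → Matrix (Fin 3) (Fin 3) ℝ) (ε : ℝ) (x : R3) :
    Matrix (Fin 3) (Fin 3) ℝ := msqrt (A (ε⁻¹ • x))

/-- `(𝓓, 𝓑)` solves `curl (A(·/ε) 𝓓) + 𝓑 = 0`, `curl 𝓑 - 𝓓 = g` in `L²(ℝ³, dμ^ε)`: the function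
`D = A^{1/2}(·/ε) 𝓓`, with `curl (A^{1/2}(·/ε) D) = -𝓑`, is the weak solution of
`A^{1/2} curl curl A^{1/2} D + D = -A^{1/2} g`. -/
def IsMaxwellSolution (A : R3 → Matrix (Fin 3) (Fin 3) ℝ) (μ : Measure R3) (ε : ℝ)
    (g 𝓓 𝓑 : R3 → C3) : Prop :=
  IsWeakSolution (sqrtCoeff A ε) (scaledMeasure μ ε) g
    (fun x => rmul (sqrtCoeff A ε x) (𝓓 x)) (fun x => -𝓑 x)

/-! ### The cell problem and the homogenised symbol -/

/-- Zero-mean smooth periodic functions, `C^∞_{#,0}(Q)`. -/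
structure IsPeriodicTest (μ : Measure R3) (φ : R3 → ℂ) : Prop where
  smooth : ContDiff ℝ ∞ φ
  periodic : IsPeriodic φ
  mean_zero : ∫ y in unitCell, φ y ∂μ = 0

/-- `ψ ∈ H¹_{#,0}(Q, dμ)` with `p = ∇(e_κ ψ)` solves
`∫_Q A⁻¹ (∇(e_κ ψ) + e_κ c) · conj (∇(e_κ φ)) dμ = 0` for all `φ ∈ C^∞_{#,0}(Q)`. -/
structure IsCellSolution (A : R3 → Matrix (Fin 3) (Fin 3) ℝ) (μ : Measure R3) (κ : R3) (c : C3)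
    (ψ : R3 → ℂ) (p : R3 → C3) : Prop where
  left_mem : MemLp ψ 2 (μ.restrict unitCell)
  right_mem : MemLp p 2 (μ.restrict unitCell)
  closure : ∀ δ : ℝ≥0∞, 0 < δ → ∃ φ : R3 → ℂ, IsPeriodicTest μ φ ∧
    eLpNorm (fun y => ψ y - φ y) 2 (μ.restrict unitCell) < δ ∧
    eLpNorm (fun y => p y - grad (fun z => planeWave κ z * φ z) y) 2 (μ.restrict unitCell) < δ
  weak : ∀ φ : R3 → ℂ, IsPeriodicTest μ φ →
    ∫ y in unitCell, inner ℂ (grad (fun z => planeWave κ z * φ z) y)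
      (rmul (A y)⁻¹ (p y + planeWave κ y • c)) ∂μ = 0

/-- `Ψ_κ`, with `P κ j = ∇(e_κ (Ψ_κ)_j)`, solves the cell problem for the `j`-th coordinate
vector, for all `κ ∈ ℝ³`. -/
def IsCellFamily (A : R3 → Matrix (Fin 3) (Fin 3) ℝ) (μ : Measure R3)
    (Ψ : R3 → Fin 3 → R3 → ℂ) (P : R3 → Fin 3 → R3 → C3) : Prop :=
  ∀ (κ : R3) (j : Fin 3), IsCellSolution A μ κ (EuclideanSpace.single j 1) (Ψ κ j) (P κ j)

/-- The matrix `Â^hom_κ = ∫_Q A⁻¹ (conj(e_κ) ∇(e_κ Ψ_κ) + I) dμ`, as a function of the gradients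
`p j = ∇(e_κ (Ψ_κ)_j)`. -/
noncomputable def homMatrix (A : R3 → Matrix (Fin 3) (Fin 3) ℝ) (μ : Measure R3) (κ : R3)
    (p : Fin 3 → R3 → C3) : Matrix (Fin 3) (Fin 3) ℂ :=
  Matrix.of fun i j => ∫ y in unitCell, (rmul (A y)⁻¹
    ((starRingEnd ℂ) (planeWave κ y) • p j y + EuclideanSpace.single j 1)) i ∂μ

/-- The matrix of `v ↦ iθ × v`. -/
noncomputable def crossMatrix (θ : R3) : Matrix (Fin 3) (Fin 3) ℂ :=
  Complex.I • LinearMap.toMatrix' (crossProduct (fun i => ((θ i : ℝ) : ℂ)))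

/-- The matrix `(Â)⁻¹ (𝔄_θ + I)⁻¹`, where `𝔄_θ = iθ × iθ × (Â)⁻¹`. -/
noncomputable def homSymbol (H : Matrix (Fin 3) (Fin 3) ℂ) (θ : R3) : Matrix (Fin 3) (Fin 3) ℂ :=
  H⁻¹ * (crossMatrix θ * crossMatrix θ * H⁻¹ + 1)⁻¹

/-! ### Fourier and Floquet transforms on `L²(ℝ³, dμ^ε)` -/

/-- The truncation of `g` to the ball of radius `R`. -/
noncomputable def trunc (R : ℝ) (g : R3 → C3) : R3 → C3 := (Metric.ball 0 R).indicator g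

/-- The constant `(2π)^{-3/2}`. -/
noncomputable def fourierConst : ℝ := (2 * Real.pi) ^ (-(3 / 2) : ℝ)

/-- `(2π)^{-3/2} ∫ g conj(e_θ) dν`. -/
noncomputable def fourierIntegral (ν : Measure R3) (g : R3 → C3) (θ : R3) : C3 :=
  fourierConst • ∫ x, (starRingEnd ℂ) (planeWave θ x) • g x ∂ν

/-- `ĝ` is the Fourier transform of `g ∈ L²(dν)`: the limit in `L²_loc(dθ)` of the transforms of
the truncations of `g`. It is determined almost everywhere by `g`. -/
structure IsFourierTransform (ν : Measure R3) (g ghat : R3 → C3) : Prop where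
  meas : AEStronglyMeasurable ghat volume
  lim : ∀ r : ℝ, Tendsto
    (fun R : ℝ => eLpNorm (fun θ => fourierIntegral ν (trunc R g) θ - ghat θ) 2
      (volume.restrict (Metric.ball 0 r))) atTop (𝓝 0)

/-- `conj(e_κ) 𝒯_ε ℱ_ε g` (with `κ = εθ`) as a series; for compactly supported `g` the sum is
finite. -/
noncomputable def floquetSeries (ε : ℝ) (g : R3 → C3) (θ y : R3) : C3 :=
  ((ε ^ 2 / (2 * Real.pi)) ^ (3 / 2 : ℝ) : ℝ) •
    ∑' n : Fin 3 → ℤ,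
      (starRingEnd ℂ) (planeWave θ (ε • (y + WithLp.toLp 2 fun i => (n i : ℝ)))) •
        g (ε • (y + WithLp.toLp 2 fun i => (n i : ℝ)))

/-- `G(θ, ·) = g^ε_θ = conj(e_κ) 𝒯_ε ℱ_ε g` for `g ∈ L²(dμ^ε)`: the limit of the transforms of the
truncations of `g` in `L²(ε⁻¹ Q' × Q, dθ × dμ)`. -/
structure IsFloquetTransform (μ : Measure R3) (ε : ℝ) (g : R3 → C3) (G : R3 → R3 → C3) : Prop where
  mem : MemLp (fun z : R3 × R3 => G z.1 z.2) 2
    ((volume.restrict (dualCell ε)).prod (μ.restrict unitCell))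
  lim : Tendsto
    (fun R : ℝ => eLpNorm (fun z : R3 × R3 => floquetSeries ε (trunc R g) z.1 z.2 - G z.1 z.2) 2
      ((volume.restrict (dualCell ε)).prod (μ.restrict unitCell))) atTop (𝓝 0)

/-- `(2π)^{-3/2} ∫_{|θ| < R} h(θ) e_θ(x) dθ`. -/
noncomputable def partialInverse (h : R3 → C3) (R : ℝ) (x : R3) : C3 :=
  fourierConst • ∫ θ in Metric.ball 0 R, planeWave θ x • h θ

/-- `U = (2π)^{-3/2} ∫_{ℝ³} h(θ) e_θ dθ` and `W = curl U` in `L²(dν)`: the smooth partial integrals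
converge to `U` and their classical curls converge to `W`, in `L²(dν)`. -/
structure IsInverseWithCurl (ν : Measure R3) (h U W : R3 → C3) : Prop where
  left_mem : MemLp U 2 ν
  right_mem : MemLp W 2 ν
  lim : Tendsto (fun R : ℝ => eLpNorm (fun x => partialInverse h R x - U x) 2 ν) atTop (𝓝 0)
  lim_curl : Tendsto (fun R : ℝ => eLpNorm (fun x => curl (partialInverse h R) x - W x) 2 ν)
    atTop (𝓝 0)

end MaxwellHom

namespace MaxwellHom

/-! The condition on gradients, tested with `e^{2πi n·y}`, reads `2πi n_j ∫_Q e^{2πi n·y} dμ = 0`.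
Hence every nonconstant Fourier mode of `μ` vanishes and `μ` is Lebesgue measure
(`eq_volume_of_integral_pderiv_eq_zero`). So is `μ^ε`. The transform `ĝ` is then the unitary Fourier
transform `ft`, and the Floquet transform only regroups its values: the `m`-th Fourier coefficient
of the fibre at `θ` is `ĝ(ξ_m)`, with `ξ_m = θ + 2πm/ε` (`IsFloquetTransform.ae_cellCoeff`). In
particular the mean over the cell is `ĝ(θ)`.

Put `E = A^{1/2} D`, so that `𝓑 = -curl E` and `curl curl E + A⁻¹ E + g = 0`. Curls become
multiplications by the Hermitian matrices `X_ξ = iξ×` (`MemHcurl.ft_eq`, `IsWeakSolution.ft_eq`),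
and the Floquet transform commutes with the periodic matrix `A⁻¹(·/ε)` (`IsFloquetTransform.rmul`).
On almost every fibre this leaves, for fields `F`, `G` on the cell, the equations `X_m X_m F_m +
(A⁻¹F)_m + G_m = 0` for all modes `m`.

The homogenised symbol is `(X_θ X_θ + Â)⁻¹`. Let `c = -(X_θ X_θ + Â)⁻¹ G_0`, let `q` be the
corrector for `c` at `κ = εθ`, let `σ = A⁻¹(q + c)` be its flux, whose mean is `Â c`, and let `z = F
- (q + c)`. Since `q` is a limit of twisted gradients, `X_m q_m = 0`: the corrector does not
contribute to the curl. Pairing the equation for the error with `z_m` gives `|X_m z_m|² = -Re⟨z_m,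
(A⁻¹z)_m⟩ - Re⟨z_m, r_m⟩`. Here `r_0 = 0` by the choice of `c`, and `r_m = G_m + σ_m` for `m ≠ 0`.
This `r_m` is orthogonal to `ξ_m`, because `g` is divergence free and by the cell problem. Therefore
`|ξ_m| |⟨z_m, r_m⟩| ≤ |X_m z_m| |r_m|`, and `|ξ_m| ≥ π/ε` produces the factor `ε`. Summing over `m`,
Parseval turns the first terms into `-∫ ⟨z, A⁻¹z⟩ ≤ 0`, so only `O(ε²) ∫ |G|²` remains
(`norm_cross_sub_sq_le`, `tsum_fibre_le`). At modes `m ≠ 0` the homogenised field itself is `O(ε)`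
by the same orthogonality (`norm_mul_norm_cross_homSymbol_le`). Integration over `θ` and Plancherel
give the claim (`eLpNorm_sub_ift_le`).

Only the curl of the error is estimated, so no Poincaré inequality uniform in `θ` and no regularity
of correctors is needed. Correctors come from an orthogonal projection in `L²`
(`exists_isCorrector`). A Poincaré inequality at fixed `κ` serves only to recover the potential `ψ`
(`IsCorrector.exists_isCellSolution`). The measurability of the symbol in `θ`, for arbitrary
families of cell solutions, comes from the variational characterisation of `Â`
(`IsCellFamily.measurable_inner_self`). -/

/-! ### Matrices acting on complex vectors -/

/-- The integer vector `n` as a point of `ℝ³`. -/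
noncomputable def ivec (n : Fin 3 → ℤ) : R3 := WithLp.toLp 2 fun i => (n i : ℝ)

/-- A real vector as a complex vector. -/
noncomputable def cvec (θ : R3) : C3 := WithLp.toLp 2 fun i => ((θ i : ℝ) : ℂ)

/-- The continuous linear map `v ↦ cmul M v`. -/
noncomputable def cmulL (M : Matrix (Fin 3) (Fin 3) ℂ) : C3 →L[ℂ] C3 := Matrix.toEuclideanCLM (𝕜 := ℂ) M

lemma cmul_add (M : Matrix (Fin 3) (Fin 3) ℂ) (u v : C3) : cmul M (u + v) = cmul M u + cmul M v :=
  (cmulL M).map_add u v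

lemma cmul_sub (M : Matrix (Fin 3) (Fin 3) ℂ) (u v : C3) : cmul M (u - v) = cmul M u - cmul M v :=
  (cmulL M).map_sub u v

lemma cmul_neg (M : Matrix (Fin 3) (Fin 3) ℂ) (u : C3) : cmul M (-u) = -cmul M u :=
  (cmulL M).map_neg u

lemma cmul_zero (M : Matrix (Fin 3) (Fin 3) ℂ) : cmul M 0 = 0 := (cmulL M).map_zero

lemma cmul_smul (M : Matrix (Fin 3) (Fin 3) ℂ) (t : ℂ) (u : C3) : cmul M (t • u) = t • cmul M u :=
  (cmulL M).map_smul t u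

lemma cmul_mul (M N : Matrix (Fin 3) (Fin 3) ℂ) (u : C3) : cmul (M * N) u = cmul M (cmul N u) := by
  simp [cmul, Matrix.mulVec_mulVec]

lemma cmul_one (u : C3) : cmul 1 u = u := by simp [cmul]

lemma add_cmul (M N : Matrix (Fin 3) (Fin 3) ℂ) (u : C3) : cmul (M + N) u = cmul M u + cmul N u := by
  simp [cmul, Matrix.add_mulVec]

lemma inner_C3 (u v : C3) : inner ℂ u v = ∑ i, (starRingEnd ℂ) (u i) * v i := by
  simp [PiLp.inner_apply, mul_comm]

lemma inner_cmul_left (M : Matrix (Fin 3) (Fin 3) ℂ) (u v : C3) :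
    inner ℂ (cmul M u) v = inner ℂ u (cmul M.conjTranspose v) := by
  simp only [inner_C3, cmul, Matrix.mulVec, dotProduct, Fin.sum_univ_three, map_add, map_mul,
    Matrix.conjTranspose_apply, RCLike.star_def]
  ring

lemma rmul_add (M : Matrix (Fin 3) (Fin 3) ℝ) (u v : C3) : rmul M (u + v) = rmul M u + rmul M v :=
  cmul_add _ u v

lemma rmul_sub (M : Matrix (Fin 3) (Fin 3) ℝ) (u v : C3) : rmul M (u - v) = rmul M u - rmul M v :=
  cmul_sub _ u v

lemma rmul_smul (M : Matrix (Fin 3) (Fin 3) ℝ) (t : ℂ) (u : C3) : rmul M (t • u) = t • rmul M u :=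
  cmul_smul _ t u

lemma rmul_zero (M : Matrix (Fin 3) (Fin 3) ℝ) : rmul M 0 = 0 := cmul_zero _

lemma rmul_mul (M N : Matrix (Fin 3) (Fin 3) ℝ) (u : C3) : rmul (M * N) u = rmul M (rmul N u) := by
  rw [rmul, rmul, rmul, ← cmul_mul]
  congr 1
  exact Matrix.map_mul (f := Complex.ofRealHom)

lemma rmul_one (u : C3) : rmul 1 u = u := by
  rw [rmul, Matrix.map_one _ (by simp) (by simp), cmul_one]

lemma inner_rmul_left {M : Matrix (Fin 3) (Fin 3) ℝ} (hM : M.IsHermitian) (u v : C3) :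
    inner ℂ (rmul M u) v = inner ℂ u (rmul M v) := by
  rw [rmul, inner_cmul_left]
  congr 2
  ext i j
  have := hM.apply i j
  simp only [star_trivial] at this
  simp [Matrix.conjTranspose_apply, this]

/-! ### The cross product symbol -/

lemma cmul_cross (θ : R3) (v : C3) : cmul (crossMatrix θ) v =
    !₂[Complex.I * (θ 1 * v 2 - θ 2 * v 1), Complex.I * (θ 2 * v 0 - θ 0 * v 2),
      Complex.I * (θ 0 * v 1 - θ 1 * v 0)] := by
  rw [cmul, crossMatrix, Matrix.smul_mulVec, LinearMap.toMatrix'_mulVec, cross_apply]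
  ext i
  fin_cases i <;> simp

lemma crossMatrix_conjTranspose (θ : R3) : (crossMatrix θ).conjTranspose = crossMatrix θ := by
  ext i j
  fin_cases i <;> fin_cases j <;>
    simp [crossMatrix, LinearMap.toMatrix'_apply, cross_apply]

lemma inner_cross_left (θ : R3) (u v : C3) :
    inner ℂ (cmul (crossMatrix θ) u) v = inner ℂ u (cmul (crossMatrix θ) v) := by
  rw [inner_cmul_left, crossMatrix_conjTranspose]

lemma cross_cross (θ : R3) (v : C3) :
    cmul (crossMatrix θ) (cmul (crossMatrix θ) v) =
      ((‖θ‖ ^ 2 : ℝ) : ℂ) • v - inner ℂ (cvec θ) v • cvec θ := by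
  rw [cmul_cross, cmul_cross, EuclideanSpace.norm_sq_eq, inner_C3]
  ext i
  fin_cases i <;> simp [Fin.sum_univ_three, cvec] <;> ring_nf <;> simp only [Complex.I_sq] <;> ring

lemma cross_cvec (θ : R3) (t : ℂ) : cmul (crossMatrix θ) (t • cvec θ) = 0 := by
  rw [cmul_cross]
  ext i
  fin_cases i <;> simp [cvec] <;> ring

lemma norm_cross_sq (θ : R3) (v : C3) :
    ‖cmul (crossMatrix θ) v‖ ^ 2 = ‖θ‖ ^ 2 * ‖v‖ ^ 2 - ‖inner ℂ (cvec θ) v‖ ^ 2 := by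
  have h : inner ℂ (cmul (crossMatrix θ) v) (cmul (crossMatrix θ) v) =
      ((‖θ‖ ^ 2 * ‖v‖ ^ 2 - ‖inner ℂ (cvec θ) v‖ ^ 2 : ℝ) : ℂ) := by
    rw [inner_cross_left, cross_cross, inner_sub_right, inner_smul_right, inner_smul_right,
      inner_self_eq_norm_sq_to_K, ← inner_conj_symm v (cvec θ), RCLike.mul_conj]
    push_cast
    rfl
  rw [inner_self_eq_norm_sq_to_K] at h
  exact Complex.ofReal_injective (by rw [Complex.ofReal_pow]; exact h)

lemma norm_cross_le (θ : R3) (v : C3) : ‖cmul (crossMatrix θ) v‖ ≤ ‖θ‖ * ‖v‖ := by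
  refine le_of_sq_le_sq ?_ (by positivity)
  rw [norm_cross_sq, mul_pow]
  nlinarith [sq_nonneg ‖inner ℂ (cvec θ) v‖]

/-- On the complement of `θ` the square of `iθ×` is `‖θ‖²`, so `‖θ‖² ⟨u, r⟩ = ⟨θ × u, θ × r⟩`. A
divergence-free source is thus controlled by the curl alone, with a gain of `1/‖θ‖`. At frequencies
of size `1/ε` this gain is the rate of convergence. -/
lemma norm_mul_inner_le_of_inner_eq_zero (θ : R3) (u r : C3) (hr : inner ℂ (cvec θ) r = 0) :
    ‖θ‖ * ‖inner ℂ u r‖ ≤ ‖cmul (crossMatrix θ) u‖ * ‖r‖ := by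
  rcases eq_or_ne ‖θ‖ 0 with h0 | h0
  · rw [h0, zero_mul]; positivity
  have h : ((‖θ‖ ^ 2 : ℝ) : ℂ) * inner ℂ u r =
      inner ℂ (cmul (crossMatrix θ) u) (cmul (crossMatrix θ) r) := by
    rw [inner_cross_left, cross_cross, hr, zero_smul, sub_zero, inner_smul_right]
  have h1 : ‖θ‖ ^ 2 * ‖inner ℂ u r‖ ≤ ‖cmul (crossMatrix θ) u‖ * (‖θ‖ * ‖r‖) := by
    have := congrArg norm h
    rw [norm_mul, Complex.norm_real, Real.norm_of_nonneg (by positivity)] at this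
    rw [this]
    exact (norm_inner_le_norm _ _).trans (by gcongr; exact norm_cross_le θ r)
  have hpos : 0 < ‖θ‖ := lt_of_le_of_ne (norm_nonneg _) (Ne.symm h0)
  nlinarith

/-! ### The homogenised symbol -/

lemma re_inner_cross_cross (θ : R3) (u : C3) :
    (inner ℂ u (cmul (crossMatrix θ) (cmul (crossMatrix θ) u))).re = ‖cmul (crossMatrix θ) u‖ ^ 2 := by
  rw [← inner_cross_left, inner_self_eq_norm_sq_to_K]
  norm_cast

lemma det_ne_zero_of_coercive {α : ℝ} (hα : 0 < α) {H : Matrix (Fin 3) (Fin 3) ℂ}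
    (hH : ∀ v, α * ‖v‖ ^ 2 ≤ (inner ℂ v (cmul H v)).re) : H.det ≠ 0 := by
  intro h
  obtain ⟨v, hv, hv0⟩ := Matrix.exists_mulVec_eq_zero_iff.2 h
  have := hH (WithLp.toLp 2 v)
  have h2 : cmul H (WithLp.toLp 2 v) = 0 := by simp [cmul, hv0]
  rw [h2, inner_zero_right, Complex.zero_re] at this
  have h3 : WithLp.toLp 2 v ≠ (0 : C3) := by simpa using hv
  have h4 : 0 < ‖(WithLp.toLp 2 v : C3)‖ := norm_pos_iff.2 h3
  have : 0 < α * ‖(WithLp.toLp 2 v : C3)‖ ^ 2 := by positivity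
  linarith

/-- Coercivity makes `H` invertible, and the product of inverses collapses. In this form the symbol
is the inverse of a coercive matrix. -/
lemma homSymbol_eq {α : ℝ} (hα : 0 < α) {H : Matrix (Fin 3) (Fin 3) ℂ}
    (hH : ∀ v, α * ‖v‖ ^ 2 ≤ (inner ℂ v (cmul H v)).re) (θ : R3) :
    homSymbol H θ = (crossMatrix θ * crossMatrix θ + H)⁻¹ := by
  rw [homSymbol, ← Matrix.mul_inv_rev, add_mul, Matrix.mul_assoc, Matrix.nonsing_inv_mul _
    (isUnit_iff_ne_zero.2 (det_ne_zero_of_coercive hα hH)), Matrix.mul_one, Matrix.one_mul]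

lemma homSymbol_spec {α : ℝ} (hα : 0 < α) {H : Matrix (Fin 3) (Fin 3) ℂ}
    (hH : ∀ v, α * ‖v‖ ^ 2 ≤ (inner ℂ v (cmul H v)).re) (θ : R3) (f : C3) :
    cmul (crossMatrix θ) (cmul (crossMatrix θ) (cmul (homSymbol H θ) f)) +
      cmul H (cmul (homSymbol H θ) f) = f := by
  have hc : ∀ v, α * ‖v‖ ^ 2 ≤ (inner ℂ v (cmul (crossMatrix θ * crossMatrix θ + H) v)).re := by
    intro v
    rw [add_cmul, cmul_mul, inner_add_right, Complex.add_re, re_inner_cross_cross]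
    nlinarith [hH v, sq_nonneg ‖cmul (crossMatrix θ) v‖]
  rw [homSymbol_eq hα hH, ← cmul_mul, ← add_cmul, ← cmul_mul, Matrix.mul_nonsing_inv _
    (isUnit_iff_ne_zero.2 (det_ne_zero_of_coercive hα hc)), cmul_one]

/-- Pair the equation `X X u + H u = f` with its own solution `u`. -/
lemma homSymbol_energy {α : ℝ} (hα : 0 < α) {H : Matrix (Fin 3) (Fin 3) ℂ}
    (hH : ∀ v, α * ‖v‖ ^ 2 ≤ (inner ℂ v (cmul H v)).re) (θ : R3) (f : C3) :
    ‖cmul (crossMatrix θ) (cmul (homSymbol H θ) f)‖ ^ 2 + α * ‖cmul (homSymbol H θ) f‖ ^ 2 ≤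
      ‖inner ℂ (cmul (homSymbol H θ) f) f‖ := by
  have h := homSymbol_spec hα hH θ f
  set u := cmul (homSymbol H θ) f
  have h2 : (inner ℂ u f).re = ‖cmul (crossMatrix θ) u‖ ^ 2 + (inner ℂ u (cmul H u)).re := by
    rw [← re_inner_cross_cross, ← Complex.add_re, ← inner_add_right, h]
  have h3 := Complex.re_le_norm (inner ℂ u f)
  linarith [hH u]

lemma norm_homSymbol_le {α : ℝ} (hα : 0 < α) {H : Matrix (Fin 3) (Fin 3) ℂ}
    (hH : ∀ v, α * ‖v‖ ^ 2 ≤ (inner ℂ v (cmul H v)).re) (θ : R3) (f : C3) :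
    ‖cmul (homSymbol H θ) f‖ ≤ α⁻¹ * ‖f‖ := by
  have h := homSymbol_energy hα hH θ f
  set u := cmul (homSymbol H θ) f
  have h1 := norm_inner_le_norm (𝕜 := ℂ) u f
  rw [← div_eq_inv_mul, le_div_iff₀ hα]
  rcases eq_or_ne ‖u‖ 0 with h0 | h0
  · rw [h0, zero_mul]; positivity
  have hpos : 0 < ‖u‖ := lt_of_le_of_ne (norm_nonneg _) (Ne.symm h0)
  nlinarith [sq_nonneg ‖cmul (crossMatrix θ) u‖]

/-- The energy gives `‖X u‖² ≤ ‖u‖ ‖f‖ ≤ α⁻¹ ‖f‖²`, and `α⁻¹ ≤ (1 + α⁻¹)²` avoids a square root. The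
bound serves only to show that the curl of the homogenised field is square integrable. -/
lemma norm_cross_homSymbol_le {α : ℝ} (hα : 0 < α) {H : Matrix (Fin 3) (Fin 3) ℂ}
    (hH : ∀ v, α * ‖v‖ ^ 2 ≤ (inner ℂ v (cmul H v)).re) (θ : R3) (f : C3) :
    ‖cmul (crossMatrix θ) (cmul (homSymbol H θ) f)‖ ≤ (1 + α⁻¹) * ‖f‖ := by
  have h := homSymbol_energy hα hH θ f
  have h2 := norm_homSymbol_le hα hH θ f
  set u := cmul (homSymbol H θ) f
  have h1 := norm_inner_le_norm (𝕜 := ℂ) u f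
  have hi : 0 < α⁻¹ := by positivity
  refine le_of_sq_le_sq ?_ (by positivity)
  have : ‖u‖ * ‖f‖ ≤ α⁻¹ * ‖f‖ * ‖f‖ := by gcongr
  nlinarith [sq_nonneg ‖u‖, mul_nonneg hα.le (sq_nonneg ‖u‖), sq_nonneg ‖f‖,
    mul_nonneg hi.le (sq_nonneg ‖f‖), mul_nonneg (sq_nonneg α⁻¹) (sq_nonneg ‖f‖)]

/-- The energy inequality, with its right side estimated by `norm_mul_inner_le_of_inner_eq_zero`. It
makes the part of the homogenised curl outside the dual cell of order `ε`. -/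
lemma norm_mul_norm_cross_homSymbol_le {α : ℝ} (hα : 0 < α) {H : Matrix (Fin 3) (Fin 3) ℂ}
    (hH : ∀ v, α * ‖v‖ ^ 2 ≤ (inner ℂ v (cmul H v)).re) (θ : R3) (f : C3)
    (hf : inner ℂ (cvec θ) f = 0) :
    ‖θ‖ * ‖cmul (crossMatrix θ) (cmul (homSymbol H θ) f)‖ ≤ ‖f‖ := by
  have h := homSymbol_energy hα hH θ f
  set u := cmul (homSymbol H θ) f
  have h1 := norm_mul_inner_le_of_inner_eq_zero θ u f hf
  rcases eq_or_ne ‖cmul (crossMatrix θ) u‖ 0 with h0 | h0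
  · rw [h0, mul_zero]; positivity
  have hpos : 0 < ‖cmul (crossMatrix θ) u‖ := lt_of_le_of_ne (norm_nonneg _) (Ne.symm h0)
  have h2 : ‖θ‖ * ‖cmul (crossMatrix θ) u‖ ^ 2 ≤ ‖cmul (crossMatrix θ) u‖ * ‖f‖ := by
    refine le_trans ?_ h1
    gcongr
    nlinarith [mul_nonneg hα.le (sq_nonneg ‖u‖)]
  nlinarith

/-! ### Periodic functions -/

lemma IsPeriodic.add_ivec {β : Type*} {f : R3 → β} (hf : IsPeriodic f) (x : R3) (n : Fin 3 → ℤ) :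
    f (x + ivec n) = f x := by
  have key : ∀ (j : Fin 3) (k : ℤ) (x : R3), f (x + (k : ℝ) • basisVec j) = f x := by
    intro j k
    induction k using Int.induction_on with
    | zero => simp
    | succ i ih =>
      intro x
      have := hf j (x + ((i : ℤ) : ℝ) • basisVec j)
      rw [ih] at this
      rw [← this]
      congr 1
      push_cast
      module
    | pred i ih =>
      intro x
      have := hf j (x + ((-(i : ℤ) - 1 : ℤ) : ℝ) • basisVec j)
      rw [← this, ← ih x]
      congr 1
      push_cast
      module
  have hn : ivec n = (n 0 : ℝ) • basisVec 0 + (n 1 : ℝ) • basisVec 1 + (n 2 : ℝ) • basisVec 2 := by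
    ext i
    fin_cases i <;> simp [ivec, basisVec]
  rw [hn, ← add_assoc, ← add_assoc, key, key, key]

/-- The integer part of a vector. -/
noncomputable def floorVec (x : R3) : Fin 3 → ℤ := fun i => ⌊x i⌋

lemma sub_ivec_mem_unitCell_iff (x : R3) (n : Fin 3 → ℤ) :
    x - ivec n ∈ unitCell ↔ n = floorVec x := by
  simp only [unitCell, ivec, Set.mem_ofPred_eq, PiLp.sub_apply, Set.mem_Ico, funext_iff, floorVec]
  refine forall_congr' fun i => ?_
  rw [eq_comm, Int.floor_eq_iff]
  constructor <;> rintro ⟨h1, h2⟩ <;> constructor <;> linarith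

lemma IsPeriodic.bddAbove {f : R3 → ℝ} (hf : IsPeriodic f) (hc : Continuous f) :
    ∃ C, ∀ x, f x ≤ C := by
  have hK : IsCompact (WithLp.ofLp ⁻¹' (Set.Icc (0 : Fin 3 → ℝ) 1) : Set R3) :=
    (PiLp.homeomorph 2 (fun _ : Fin 3 => ℝ)).isCompact_preimage.2 isCompact_Icc
  obtain ⟨C, hC⟩ := hK.bddAbove_image hc.continuousOn
  refine ⟨C, fun x => ?_⟩
  have h1 := (sub_ivec_mem_unitCell_iff x (floorVec x)).2 rfl
  have h2 : f x = f (x - ivec (floorVec x)) := by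
    rw [← hf.add_ivec (x - ivec (floorVec x)) (floorVec x), sub_add_cancel]
  rw [h2]
  exact hC ⟨_, ⟨fun i => (h1 i).1, fun i => (h1 i).2.le⟩, rfl⟩

/-! ### The coefficient and its square root -/

lemma posDef_inv_isHermitian {M : Matrix (Fin 3) (Fin 3) ℝ} (hM : M.PosDef) : M⁻¹.IsHermitian :=
  hM.inv.isHermitian

lemma rmul_inv_mul_cancel {M : Matrix (Fin 3) (Fin 3) ℝ} (hM : IsUnit M.det) (v : C3) :
    rmul M⁻¹ (rmul M v) = v := by
  rw [← rmul_mul, Matrix.nonsing_inv_mul _ hM, rmul_one]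

lemma rmul_mul_inv_cancel {M : Matrix (Fin 3) (Fin 3) ℝ} (hM : IsUnit M.det) (v : C3) :
    rmul M (rmul M⁻¹ v) = v := by
  rw [← rmul_mul, Matrix.mul_nonsing_inv _ hM, rmul_one]

open scoped MatrixOrder in
lemma msqrt_isHermitian (M : Matrix (Fin 3) (Fin 3) ℝ) : (msqrt M).IsHermitian :=
  (Matrix.nonneg_iff_posSemidef.1 (CFC.sqrt_nonneg M)).isHermitian

open scoped MatrixOrder in
lemma msqrt_mul_self {M : Matrix (Fin 3) (Fin 3) ℝ} (hM : M.PosDef) : msqrt M * msqrt M = M :=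
  CFC.sqrt_mul_sqrt_self M (Matrix.nonneg_iff_posSemidef.2 hM.posSemidef)

lemma isUnit_det_msqrt {M : Matrix (Fin 3) (Fin 3) ℝ} (hM : M.PosDef) : IsUnit (msqrt M).det := by
  have h := hM.det_pos
  rw [← msqrt_mul_self hM, Matrix.det_mul] at h
  exact isUnit_iff_ne_zero.2 fun h0 => by simp [h0] at h

lemma rmul_msqrt_msqrt {M : Matrix (Fin 3) (Fin 3) ℝ} (hM : M.PosDef) (v : C3) :
    rmul (msqrt M) (rmul (msqrt M) v) = rmul M v := by
  rw [← rmul_mul, msqrt_mul_self hM]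

/-- With `E = A^{1/2} D` this is `A⁻¹ E = A^{-1/2} D`: the zeroth order term of the weak equation is
expressed through the field whose curl is taken. -/
lemma rmul_inv_msqrt {M : Matrix (Fin 3) (Fin 3) ℝ} (hM : M.PosDef) (v : C3) :
    rmul M⁻¹ (rmul (msqrt M) v) = rmul (msqrt M)⁻¹ v := by
  conv_lhs => rw [← rmul_mul_inv_cancel (isUnit_det_msqrt hM) v, rmul_msqrt_msqrt hM,
    rmul_inv_mul_cancel (isUnit_iff_ne_zero.2 hM.det_pos.ne')]

-- Continuity is all the regularity of the square root that is used: the test fields have the form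
-- `A^{-1/2} η` with `η` smooth.
open scoped MatrixOrder Matrix.Norms.L2Operator in
lemma continuous_msqrt {X : Type*} [TopologicalSpace X] {M : X → Matrix (Fin 3) (Fin 3) ℝ}
    (hc : Continuous M) (hM : ∀ x, (M x).PosDef) : Continuous fun x => msqrt (M x) :=
  CFC.continuousOn_sqrt.comp_continuous hc
    fun x => Matrix.nonneg_iff_posSemidef.2 (hM x).posSemidef

lemma continuous_rmul {X : Type*} [TopologicalSpace X] {M : X → Matrix (Fin 3) (Fin 3) ℝ}
    (hc : Continuous M) : Continuous fun z : X × C3 => rmul (M z.1) z.2 := by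
  unfold rmul cmul
  fun_prop

lemma IsCoefficient.continuous {A : R3 → Matrix (Fin 3) (Fin 3) ℝ} (hA : IsCoefficient A) :
    Continuous A :=
  continuous_matrix fun i j => (hA.differentiable i j).continuous

lemma IsCoefficient.continuous_inv {A : R3 → Matrix (Fin 3) (Fin 3) ℝ} (hA : IsCoefficient A) :
    Continuous fun x => (A x)⁻¹ := by
  have : (fun x => (A x)⁻¹) = fun x => (A x).det⁻¹ • (A x).adjugate := by
    ext1 x
    rw [Matrix.inv_def, Ring.inverse_eq_inv']
  rw [this]
  exact (hA.continuous.matrix_det.inv₀ fun x => (hA.posDef x).det_pos.ne').smul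
    hA.continuous.matrix_adjugate

lemma exists_norm_rmul_le {M : R3 → Matrix (Fin 3) (Fin 3) ℝ} (hc : Continuous M)
    (hp : IsPeriodic M) : ∃ C, ∀ x v, ‖rmul (M x) v‖ ≤ C * ‖v‖ := by
  have h : Continuous fun x => ‖cmulL ((M x).map (fun t : ℝ => (t : ℂ)))‖ := by
    refine Continuous.norm ?_
    refine (LinearMap.continuous_of_finiteDimensional
      (Matrix.toEuclideanCLM (n := Fin 3) (𝕜 := ℂ)).toAlgEquiv.toLinearMap).comp ?_
    fun_prop
  obtain ⟨C, hC⟩ := IsPeriodic.bddAbove (f := fun x => ‖cmulL ((M x).map (fun t : ℝ => (t : ℂ)))‖)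
    (fun j x => by simp only [hp j x]) h
  exact ⟨C, fun x v => ((cmulL _).le_opNorm v).trans (by gcongr; exact hC x)⟩

/-- Two-sided bounds for a coefficient and for its square root. -/
structure CoeffBounds (A : R3 → Matrix (Fin 3) (Fin 3) ℝ) (α β : ℝ) : Prop where
  pos : 0 < α
  pos' : 0 < β
  lower : ∀ x v, α * ‖v‖ ^ 2 ≤ (inner ℂ v (rmul (A x)⁻¹ v)).re
  inv_le : ∀ x v, ‖rmul (A x)⁻¹ v‖ ≤ β * ‖v‖
  sqrt_le : ∀ x v, ‖rmul (msqrt (A x)) v‖ ≤ β * ‖v‖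
  sqrt_inv_le : ∀ x v, ‖rmul (msqrt (A x))⁻¹ v‖ ≤ β * ‖v‖

lemma norm_rmul_msqrt_sq {M : Matrix (Fin 3) (Fin 3) ℝ} (hM : M.PosDef) (v : C3) :
    ‖rmul (msqrt M) v‖ ^ 2 = (inner ℂ v (rmul M v)).re := by
  rw [← rmul_msqrt_msqrt hM, ← inner_rmul_left (msqrt_isHermitian M), inner_self_eq_norm_sq_to_K]
  norm_cast

lemma norm_rmul_msqrt_inv_sq {M : Matrix (Fin 3) (Fin 3) ℝ} (hM : M.PosDef) (v : C3) :
    ‖rmul (msqrt M)⁻¹ v‖ ^ 2 = (inner ℂ v (rmul M⁻¹ v)).re := by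
  have h : rmul M⁻¹ v = rmul (msqrt M)⁻¹ (rmul (msqrt M)⁻¹ v) := by
    rw [← rmul_inv_msqrt hM, rmul_mul_inv_cancel (isUnit_det_msqrt hM)]
  rw [h, ← inner_rmul_left (msqrt_isHermitian M).inv, inner_self_eq_norm_sq_to_K]
  norm_cast

lemma IsCoefficient.exists_bounds {A : R3 → Matrix (Fin 3) (Fin 3) ℝ} (hA : IsCoefficient A) :
    ∃ α β, CoeffBounds A α β := by
  obtain ⟨C₁, h₁⟩ := exists_norm_rmul_le hA.continuous hA.periodic
  obtain ⟨C₂, h₂⟩ := exists_norm_rmul_le hA.continuous_inv (fun j x => by simp only [hA.periodic j x])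
  -- The square roots have norm at most `√β`. The lower bound `1` gives `√β ≤ β`, so one constant
  -- serves for everything.
  set β := max (max C₁ C₂) 1
  have hβ1 : 1 ≤ β := le_max_right _ _
  have hβ : 0 < β := by linarith
  have hb₁ : ∀ x v, ‖rmul (A x) v‖ ≤ β * ‖v‖ := fun x v => (h₁ x v).trans
    (by gcongr; exact (le_max_left _ _).trans (le_max_left _ _))
  have hb₂ : ∀ x v, ‖rmul (A x)⁻¹ v‖ ≤ β * ‖v‖ := fun x v => (h₂ x v).trans
    (by gcongr; exact (le_max_right _ _).trans (le_max_left _ _))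
  have hre : ∀ u v : C3, (inner ℂ u v).re ≤ ‖u‖ * ‖v‖ := fun u v => re_inner_le_norm (𝕜 := ℂ) u v
  have hs : ∀ x v, ‖rmul (msqrt (A x)) v‖ ^ 2 ≤ β * ‖v‖ ^ 2 := fun x v => by
    rw [norm_rmul_msqrt_sq (hA.posDef x)]
    refine (hre _ _).trans ?_
    nlinarith [hb₁ x v, norm_nonneg v]
  have hsi : ∀ x v, ‖rmul (msqrt (A x))⁻¹ v‖ ^ 2 ≤ β * ‖v‖ ^ 2 := fun x v => by
    rw [norm_rmul_msqrt_inv_sq (hA.posDef x)]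
    refine (hre _ _).trans ?_
    nlinarith [hb₂ x v, norm_nonneg v]
  have hsq : ∀ (r : ℝ) (v : C3), 0 ≤ r → r ^ 2 ≤ β * ‖v‖ ^ 2 → r ≤ β * ‖v‖ := fun r v _ h => by
    refine le_of_sq_le_sq (h.trans ?_) (by positivity)
    rw [mul_pow]
    gcongr
    nlinarith
  refine ⟨β⁻¹, β, by positivity, hβ, fun x v => ?_, hb₂,
    fun x v => hsq _ _ (norm_nonneg _) (hs x v), fun x v => hsq _ _ (norm_nonneg _) (hsi x v)⟩
  -- With `u = A^{-1/2} v`, `‖v‖² = ‖A^{1/2} u‖² ≤ β ‖u‖² = β ⟨v, A⁻¹ v⟩`: an upper bound for `A` is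
  -- a lower bound for `A⁻¹`.
  rw [← norm_rmul_msqrt_inv_sq (hA.posDef x), inv_mul_le_iff₀ hβ]
  have := hs x (rmul (msqrt (A x))⁻¹ v)
  rwa [rmul_mul_inv_cancel (isUnit_det_msqrt (hA.posDef x))] at this

lemma IsCoefficient.continuous_sqrtCoeff {A : R3 → Matrix (Fin 3) (Fin 3) ℝ} (hA : IsCoefficient A)
    (ε : ℝ) : Continuous (sqrtCoeff A ε) :=
  (continuous_msqrt hA.continuous hA.posDef).comp (continuous_const_smul ε⁻¹)

lemma IsCoefficient.continuous_msqrt_inv {A : R3 → Matrix (Fin 3) (Fin 3) ℝ} (hA : IsCoefficient A) :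
    Continuous fun x => (msqrt (A x))⁻¹ := by
  have : (fun x => (msqrt (A x))⁻¹) = fun x => (A x)⁻¹ * msqrt (A x) := by
    ext1 x
    have h := isUnit_det_msqrt (hA.posDef x)
    conv_rhs => rw [← msqrt_mul_self (hA.posDef x), Matrix.mul_inv_rev]
    rw [msqrt_mul_self (hA.posDef x), Matrix.mul_assoc, Matrix.nonsing_inv_mul _ h, Matrix.mul_one]
  rw [this]
  exact hA.continuous_inv.matrix_mul (continuous_msqrt hA.continuous hA.posDef)

/-! ### Tilings -/

section Tiling

variable {ν : Measure R3} {s : Set R3} {v : (Fin 3 → ℤ) → R3}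

lemma iUnion_tiling (ht : ∀ x, ∃! n, x - v n ∈ s) : ⋃ n, (fun x => x - v n) ⁻¹' s = Set.univ := by
  ext x
  simpa using (ht x).exists

lemma pairwise_disjoint_tiling (ht : ∀ x, ∃! n, x - v n ∈ s) :
    Pairwise (Function.onFun Disjoint fun n => (fun x => x - v n) ⁻¹' s) := fun _ _ hmn =>
  Set.disjoint_left.2 fun x hm hn => hmn ((ht x).unique hm hn)

lemma measurePreserving_sub (hinv : ∀ n, ν.map (fun x => x + v n) = ν) (n : Fin 3 → ℤ) :
    MeasurePreserving (fun x => x - v n) ν ν :=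
  ⟨measurable_sub_const _, by
    conv_lhs => rw [← hinv n]
    rw [Measure.map_map (measurable_sub_const _) (measurable_add_const _)]
    convert Measure.map_id using 2
    ext1 x
    simp⟩

lemma measurableEmbedding_sub (a : R3) : MeasurableEmbedding fun x : R3 => x - a := by
  simpa [sub_eq_add_neg] using (MeasurableEquiv.addRight (-a)).measurableEmbedding

/-- The integral of a function is the sum of its integrals over the tiles. -/
lemma lintegral_tiling (hs : MeasurableSet s) (hinv : ∀ n, ν.map (fun x => x + v n) = ν)
    (ht : ∀ x, ∃! n, x - v n ∈ s) (F : R3 → ℝ≥0∞) :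
    ∫⁻ x, F x ∂ν = ∑' n, ∫⁻ x in s, F (x + v n) ∂ν := by
  rw [← setLIntegral_univ, ← iUnion_tiling ht, lintegral_iUnion
    (fun n => measurable_sub_const _ hs) (pairwise_disjoint_tiling ht)]
  congr 1
  ext1 n
  have := (measurePreserving_sub hinv n).setLIntegral_comp_preimage_emb (measurableEmbedding_sub _)
    (fun x => F (x + v n)) s
  simpa using this

lemma hasSum_integral_tiling {E : Type*} [NormedAddCommGroup E] [NormedSpace ℝ E]
    (hs : MeasurableSet s) (hinv : ∀ n, ν.map (fun x => x + v n) = ν)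
    (ht : ∀ x, ∃! n, x - v n ∈ s) {F : R3 → E} (hF : Integrable F ν) :
    HasSum (fun n => ∫ x in s, F (x + v n) ∂ν) (∫ x, F x ∂ν) := by
  have := hasSum_integral_iUnion (μ := ν) (f := F) (fun n => measurable_sub_const (v n) hs)
    (pairwise_disjoint_tiling ht) hF.integrableOn
  rw [iUnion_tiling ht, setIntegral_univ] at this
  convert this using 2 with n
  have := (measurePreserving_sub hinv n).setIntegral_preimage_emb (measurableEmbedding_sub _)
    (fun x => F (x + v n)) s
  simpa using this.symm

end Tiling

lemma IsPeriodicMeasure.map_add_ivec {μ : Measure R3} (hμ : IsPeriodicMeasure μ) (n : Fin 3 → ℤ) :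
    μ.map (fun x => x + ivec n) = μ := by
  -- The translates of `μ` form a periodic function of the shift, so the statement for functions
  -- applies to them.
  have h : IsPeriodic fun a : R3 => μ.map (fun x => x + a) := fun j a => by
    simp only
    conv_rhs => rw [← hμ j]
    rw [Measure.map_map (measurable_add_const _) (measurable_add_const _)]
    congr 1
    ext1 x
    simp only [Function.comp]
    abel
  have := h.add_ivec 0 n
  simpa using this

lemma measurableSet_unitCell : MeasurableSet unitCell := by
  have : unitCell = ⋂ i, (fun x : R3 => x i) ⁻¹' Set.Ico (0 : ℝ) 1 := by
    ext x; simp [unitCell]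
  rw [this]
  exact MeasurableSet.iInter fun i => (by fun_prop : Measurable fun x : R3 => x i) measurableSet_Ico

lemma existsUnique_sub_ivec_mem_unitCell (x : R3) : ∃! n, x - ivec n ∈ unitCell :=
  ⟨floorVec x, (sub_ivec_mem_unitCell_iff x _).2 rfl, fun n hn => (sub_ivec_mem_unitCell_iff x n).1 hn⟩

lemma isPeriodicMeasure_volume : IsPeriodicMeasure (volume : Measure R3) := fun j =>
  (measurePreserving_add_right volume (basisVec j)).map_eq

lemma eq_of_restrict_unitCell_eq {μ ν : Measure R3} (hμ : IsPeriodicMeasure μ)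
    (hν : IsPeriodicMeasure ν) (h : μ.restrict unitCell = ν.restrict unitCell) : μ = ν := by
  ext B hB
  rw [← lintegral_indicator_one hB, ← lintegral_indicator_one hB,
    lintegral_tiling measurableSet_unitCell hμ.map_add_ivec existsUnique_sub_ivec_mem_unitCell,
    lintegral_tiling measurableSet_unitCell hν.map_add_ivec existsUnique_sub_ivec_mem_unitCell, h]

/-! ### The unit cell and the torus -/

/-- The frequency `2πn`. -/
noncomputable def mode (n : Fin 3 → ℤ) : R3 := (2 * Real.pi) • ivec n

/-- The Haar probability measure of the torus. -/
noncomputable abbrev torusMeasure : Measure (UnitAddTorus (Fin 3)) :=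
  Measure.pi fun _ : Fin 3 => (AddCircle.haarAddCircle : Measure UnitAddCircle)

/-- The quotient map onto the torus. -/
noncomputable def toTorus (x : R3) : UnitAddTorus (Fin 3) := fun i => (x i : UnitAddCircle)

/-- The section of the quotient map with values in the unit cell. -/
noncomputable def ofTorus (y : UnitAddTorus (Fin 3)) : R3 :=
  WithLp.toLp 2 fun i => (AddCircle.equivIco 1 0 (y i) : ℝ)

lemma measurable_toTorus : Measurable toTorus :=
  measurable_pi_lambda _ fun i =>
    AddCircle.measurable_mk'.comp (by fun_prop : Measurable fun x : R3 => x i)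

lemma measurable_ofTorus : Measurable ofTorus := by
  refine (WithLp.measurable_toLp 2 _).comp (measurable_pi_lambda _ fun i => ?_)
  exact measurable_subtype_coe.comp
    ((AddCircle.measurableEquivIco 1 0).measurable.comp (measurable_pi_apply i))

lemma ofTorus_toTorus {x : R3} (hx : x ∈ unitCell) : ofTorus (toTorus x) = x := by
  ext i
  simpa [ofTorus, toTorus] using hx i

lemma mFourier_toTorus (n : Fin 3 → ℤ) (x : R3) :
    UnitAddTorus.mFourier n (toTorus x) = planeWave (mode n) x := by
  simp only [UnitAddTorus.mFourier, ContinuousMap.coe_mk, toTorus, fourier_coe_apply, planeWave,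
    mode, ivec, ← Complex.exp_sum]
  congr 1
  rw [PiLp.inner_apply, Fin.sum_univ_three, Fin.sum_univ_three]
  simp
  ring

lemma map_toTorus_volume : (volume.restrict unitCell).map toTorus = torusMeasure := by
  -- The cell is a product of intervals `[0,1)`, whereas the integration formula on the torus uses
  -- `(0,1]`; the two boxes differ by a null set.
  have hae : (unitCell : Set R3) =ᵐ[volume]
      (WithLp.ofLp ⁻¹' {x : Fin 3 → ℝ | ∀ i, x i ∈ Set.Ioc ((0 : Fin 3 → ℝ) i) ((0 : Fin 3 → ℝ) i + 1)} : Set R3) := by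
    have h1 : (Set.univ.pi fun _ : Fin 3 => Set.Ico (0 : ℝ) 1) =ᵐ[volume]
        (Set.univ.pi fun _ : Fin 3 => Set.Ioc (0 : ℝ) 1) :=
      Measure.univ_pi_Ico_ae_eq_Icc.trans Measure.univ_pi_Ioc_ae_eq_Icc.symm
    have h2 := (PiLp.volume_preserving_ofLp (Fin 3)).quasiMeasurePreserving.preimage_ae_eq h1
    have e1 : (unitCell : Set R3) = WithLp.ofLp ⁻¹' (Set.univ.pi fun _ : Fin 3 => Set.Ico (0 : ℝ) 1) := by
      ext x; simp [unitCell]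
    have e2 : {x : Fin 3 → ℝ | ∀ i, x i ∈ Set.Ioc ((0 : Fin 3 → ℝ) i) ((0 : Fin 3 → ℝ) i + 1)} =
        Set.univ.pi fun _ : Fin 3 => Set.Ioc (0 : ℝ) 1 := by
      ext x; simp
    rw [e1, e2]
    exact h2
  ext B hB
  rw [Measure.map_apply measurable_toTorus hB, ← lintegral_indicator_one hB]
  have := UnitAddTorus.lintegral_preimage (B.indicator (1 : UnitAddTorus (Fin 3) → ℝ≥0∞)) 0
  refine Eq.trans ?_ this.symm
  rw [Measure.restrict_congr_set hae, ← lintegral_indicator_one (measurable_toTorus hB)]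
  rw [← (PiLp.volume_preserving_ofLp (Fin 3)).setLIntegral_comp_preimage_emb
    (MeasurableEquiv.toLp 2 (Fin 3 → ℝ)).symm.measurableEmbedding]
  rfl

lemma map_ofTorus_map_toTorus (μ : Measure R3) :
    ((μ.restrict unitCell).map toTorus).map ofTorus = μ.restrict unitCell := by
  rw [Measure.map_map measurable_ofTorus measurable_toTorus]
  conv_rhs => rw [← Measure.map_id (μ := μ.restrict unitCell)]
  refine Measure.map_congr ?_
  filter_upwards [ae_restrict_mem measurableSet_unitCell] with x hx using ofTorus_toTorus hx

lemma measurePreserving_ofTorus :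
    MeasurePreserving ofTorus torusMeasure (volume.restrict unitCell) :=
  ⟨measurable_ofTorus, by rw [← map_toTorus_volume, map_ofTorus_map_toTorus]⟩

lemma toTorus_ofTorus (y : UnitAddTorus (Fin 3)) : toTorus (ofTorus y) = y := by
  ext1 i
  exact AddCircle.coe_equivIco

lemma volume_unitCell : volume unitCell = 1 := by
  have := measurePreserving_ofTorus.measure_preimage (s := Set.univ) MeasurableSet.univ.nullMeasurableSet
  simpa using this.symm

/-! ### Plane waves -/

lemma contDiff_planeWave (κ : R3) : ContDiff ℝ ∞ (planeWave κ) := by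
  unfold planeWave
  exact (contDiff_const.mul (Complex.ofRealCLM.contDiff.comp
    (contDiff_const.inner ℝ contDiff_id))).cexp

lemma continuous_planeWave : Continuous fun z : R3 × R3 => planeWave z.1 z.2 := by
  unfold planeWave; fun_prop

@[fun_prop]
lemma Continuous.planeWave {X : Type*} [TopologicalSpace X] {f g : X → R3} (hf : Continuous f)
    (hg : Continuous g) : Continuous fun x => planeWave (f x) (g x) :=
  continuous_planeWave.comp (hf.prodMk hg)

lemma norm_planeWave (κ x : R3) : ‖planeWave κ x‖ = 1 := by
  rw [planeWave, mul_comm, Complex.norm_exp_ofReal_mul_I]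

lemma conj_planeWave (κ x : R3) : (starRingEnd ℂ) (planeWave κ x) = planeWave (-κ) x := by
  rw [planeWave, planeWave, ← Complex.exp_conj]
  simp

lemma planeWave_add_left (κ κ' x : R3) : planeWave (κ + κ') x = planeWave κ x * planeWave κ' x := by
  rw [planeWave, planeWave, planeWave, ← Complex.exp_add, inner_add_left]
  push_cast
  ring_nf

lemma planeWave_add_right (κ x y : R3) : planeWave κ (x + y) = planeWave κ x * planeWave κ y := by
  rw [planeWave, planeWave, planeWave, ← Complex.exp_add, inner_add_right]
  push_cast
  ring_nf

lemma planeWave_zero_left (x : R3) : planeWave 0 x = 1 := by simp [planeWave]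

lemma planeWave_smul_left (t : ℝ) (κ x : R3) : planeWave (t • κ) x = planeWave κ (t • x) := by
  simp [planeWave, inner_smul_left, inner_smul_right]

lemma conj_planeWave_mul (κ x : R3) : (starRingEnd ℂ) (planeWave κ x) * planeWave κ x = 1 := by
  rw [conj_planeWave, ← planeWave_add_left, neg_add_cancel, planeWave_zero_left]

lemma inner_basisVec (κ : R3) (j : Fin 3) : inner ℝ κ (basisVec j) = κ j := by
  simp [basisVec, EuclideanSpace.inner_single_right]

lemma planeWave_mode_ivec (m n : Fin 3 → ℤ) : planeWave (mode m) (ivec n) = 1 := by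
  rw [planeWave, Complex.exp_eq_one_iff]
  refine ⟨m 0 * n 0 + m 1 * n 1 + m 2 * n 2, ?_⟩
  rw [mode, ivec, ivec, inner_smul_left, PiLp.inner_apply, Fin.sum_univ_three]
  simp
  ring

lemma isPeriodic_planeWave_mode (m : Fin 3 → ℤ) : IsPeriodic (planeWave (mode m)) := fun j x => by
  have : basisVec j = ivec (Pi.single j 1) := by
    ext i
    simp [basisVec, ivec, Pi.single_apply]
  rw [planeWave_add_right, this, planeWave_mode_ivec, mul_one]

lemma hasFDerivAt_planeWave (κ x : R3) :
    HasFDerivAt (planeWave κ) ((Complex.I * planeWave κ x) •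
      (Complex.ofRealCLM.comp (innerSL ℝ κ))) x := by
  have h : HasFDerivAt (fun x : R3 => Complex.I * ((inner ℝ κ x : ℝ) : ℂ))
      (Complex.I • (Complex.ofRealCLM.comp (innerSL ℝ κ))) x :=
    ((Complex.ofRealCLM.comp (innerSL ℝ κ)).hasFDerivAt).const_mul Complex.I
  refine h.cexp.congr_fderiv ?_
  rw [planeWave, smul_smul, mul_comm]

lemma pderiv_planeWave (κ : R3) (j : Fin 3) (x : R3) :
    pderiv j (planeWave κ) x = Complex.I * κ j * planeWave κ x := by
  rw [pderiv, (hasFDerivAt_planeWave κ x).fderiv]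
  have := inner_basisVec κ j
  simp [this]
  ring

lemma pderiv_mul {f g : R3 → ℂ} {x : R3} (hf : DifferentiableAt ℝ f x) (hg : DifferentiableAt ℝ g x)
    (j : Fin 3) : pderiv j (fun y => f y * g y) x = f x * pderiv j g x + g x * pderiv j f x := by
  rw [pderiv, fderiv_fun_mul hf hg]
  simp [pderiv]

/-! ### Uniqueness of measures with vanishing Fourier coefficients -/

/-- Trigonometric polynomials are dense in the continuous functions on the torus, and integration
against a finite measure is continuous in the supremum norm. -/
lemma torus_measure_ext {ν ν' : Measure (UnitAddTorus (Fin 3))} [IsFiniteMeasure ν]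
    [IsFiniteMeasure ν'] (h : ∀ n, ∫ y, UnitAddTorus.mFourier n y ∂ν = ∫ y, UnitAddTorus.mFourier n y ∂ν') :
    ν = ν' := by
  have hint : ∀ (ρ : Measure (UnitAddTorus (Fin 3))) [IsFiniteMeasure ρ]
      (f : C(UnitAddTorus (Fin 3), ℂ)), Integrable f ρ := fun ρ _ f =>
    f.continuous.integrable_of_hasCompactSupport (HasCompactSupport.of_compactSpace f)
  let I : ∀ (ρ : Measure (UnitAddTorus (Fin 3))) [IsFiniteMeasure ρ],
      C(UnitAddTorus (Fin 3), ℂ) →L[ℂ] ℂ := fun ρ _ =>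
    LinearMap.mkContinuous
      { toFun := fun f => ∫ y, f y ∂ρ
        map_add' := fun f g => integral_add (hint ρ f) (hint ρ g)
        map_smul' := fun c f => integral_const_mul c _ } (ρ.real Set.univ) fun f => by
      rw [mul_comm]
      exact norm_integral_le_of_norm_le_const (Eventually.of_forall f.norm_coe_le_norm)
  have hI : I ν = I ν' := by
    refine ContinuousLinearMap.ext_on (s := Set.range UnitAddTorus.mFourier) ?_ ?_
    · rw [Submodule.dense_iff_topologicalClosure_eq_top]
      exact UnitAddTorus.span_mFourier_closure_eq_top
    · rintro _ ⟨n, rfl⟩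
      exact h n
  refine ext_of_forall_integral_eq_of_IsFiniteMeasure fun f => ?_
  let F : C(UnitAddTorus (Fin 3), ℂ) := ⟨fun y => (f y : ℂ), by fun_prop⟩
  have h1 : ∫ y, ((f y : ℝ) : ℂ) ∂ν = ∫ y, ((f y : ℝ) : ℂ) ∂ν' :=
    congrArg (fun T : C(UnitAddTorus (Fin 3), ℂ) →L[ℂ] ℂ => T F) hI
  rw [integral_complex_ofReal, integral_complex_ofReal] at h1
  exact_mod_cast h1

/-- The plane wave is periodic and smooth, and differentiating it in a direction with `n j ≠ 0`
multiplies it by the nonzero constant `2πi n j`. -/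
lemma integral_planeWave_mode_eq_zero {μ : Measure R3}
    (hgrad : ∀ (j : Fin 3) (φ : R3 → ℂ), ContDiff ℝ ∞ φ → IsPeriodic φ →
      ∫ y in unitCell, pderiv j φ y ∂μ = 0) {n : Fin 3 → ℤ} (hn : n ≠ 0) :
    ∫ y in unitCell, planeWave (mode n) y ∂μ = 0 := by
  obtain ⟨j, hj⟩ := Function.ne_iff.1 hn
  have h := hgrad j _ (contDiff_planeWave (mode n)) (isPeriodic_planeWave_mode n)
  simp only [pderiv_planeWave] at h
  rw [integral_const_mul] at h
  refine (mul_eq_zero.1 h).resolve_left ?_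
  have : (n j : ℂ) ≠ 0 := by exact_mod_cast hj
  simp [mode, ivec, Real.pi_ne_zero, this]

lemma integral_mFourier_map_toTorus (μ : Measure R3) (n : Fin 3 → ℤ) :
    ∫ y, UnitAddTorus.mFourier n y ∂((μ.restrict unitCell).map toTorus) =
      ∫ y in unitCell, planeWave (mode n) y ∂μ := by
  rw [integral_map measurable_toTorus.aemeasurable
    (UnitAddTorus.mFourier n).continuous.aestronglyMeasurable]
  simp only [mFourier_toTorus]

/-- A periodic probability measure that annihilates gradients is the Lebesgue measure. -/
theorem eq_volume_of_integral_pderiv_eq_zero {μ : Measure R3} (hper : IsPeriodicMeasure μ)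
    (hmass : μ unitCell = 1)
    (hgrad : ∀ (j : Fin 3) (φ : R3 → ℂ), ContDiff ℝ ∞ φ → IsPeriodic φ →
      ∫ y in unitCell, pderiv j φ y ∂μ = 0) : μ = volume := by
  have hfin : IsFiniteMeasure (μ.restrict unitCell) := ⟨by simp [hmass]⟩
  have hfin' : IsFiniteMeasure ((volume : Measure R3).restrict unitCell) := ⟨by simp [volume_unitCell]⟩
  refine eq_of_restrict_unitCell_eq hper isPeriodicMeasure_volume ?_
  rw [← map_ofTorus_map_toTorus, ← map_ofTorus_map_toTorus volume]
  congr 1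
  refine torus_measure_ext fun n => ?_
  rcases eq_or_ne n 0 with rfl | hn
  · have h0 : mode 0 = 0 := by ext i; simp [mode, ivec]
    rw [integral_mFourier_map_toTorus, integral_mFourier_map_toTorus]
    simp [h0, planeWave_zero_left, Measure.real, hmass, volume_unitCell]
  · rw [integral_mFourier_map_toTorus, integral_planeWave_mode_eq_zero hgrad hn,
      map_toTorus_volume]
    have h1 := UnitAddTorus.orthonormal_mFourier (d := Fin 3).2 hn.symm
    simp only at h1
    rw [ContinuousMap.inner_toLp] at h1
    refine (Eq.trans ?_ h1).symm
    refine integral_congr_ae (Eventually.of_forall fun y => ?_)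
    simp [UnitAddTorus.mFourier_zero]

/-! ### Fourier coefficients on the unit cell -/

/-- The Fourier coefficient of index `n` on the unit cell. -/
noncomputable def cellCoeff {E : Type*} [NormedAddCommGroup E] [NormedSpace ℂ E] (n : Fin 3 → ℤ)
    (f : R3 → E) : E := ∫ y in unitCell, (starRingEnd ℂ) (planeWave (mode n) y) • f y

/-- The Lebesgue measure on the unit cell. -/
noncomputable abbrev cellMeasure : Measure R3 := volume.restrict unitCell

instance : IsProbabilityMeasure cellMeasure := ⟨by simp [volume_unitCell]⟩

/-- Parseval's identity on the torus, carried to the cell by the measure-preserving section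
`ofTorus`. -/
lemma hasSum_conj_cellCoeff_mul {f h' : R3 → ℂ} (hf : MemLp f 2 cellMeasure)
    (hh : MemLp h' 2 cellMeasure) :
    HasSum (fun n => (starRingEnd ℂ) (cellCoeff n f) * cellCoeff n h')
      (∫ y in unitCell, (starRingEnd ℂ) (f y) * h' y) := by
  have hF := hf.comp_measurePreserving measurePreserving_ofTorus
  have hH := hh.comp_measurePreserving measurePreserving_ofTorus
  have key : ∀ {k : R3 → ℂ}, AEStronglyMeasurable k cellMeasure →
      ∫ y, k (ofTorus y) ∂torusMeasure = ∫ y in unitCell, k y := fun {k} hk => by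
    have h1 := integral_map (μ := torusMeasure) (φ := ofTorus) (f := k)
      measurable_ofTorus.aemeasurable (by rwa [measurePreserving_ofTorus.map_eq])
    rw [measurePreserving_ofTorus.map_eq] at h1
    exact h1.symm
  have hcoef : ∀ {k : R3 → ℂ} (hk : MemLp k 2 cellMeasure) (n : Fin 3 → ℤ),
      UnitAddTorus.mFourierCoeff (hk.comp_measurePreserving measurePreserving_ofTorus).toLp n
        = cellCoeff n k := fun {k} hk n => by
    have hm : AEStronglyMeasurable (fun y => (starRingEnd ℂ) (planeWave (mode n) y) • k y) cellMeasure :=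
      AEStronglyMeasurable.smul (f := fun y => (starRingEnd ℂ) (planeWave (mode n) y))
        (by fun_prop : Continuous _).aestronglyMeasurable hk.1
    rw [cellCoeff, ← key hm]
    refine integral_congr_ae ?_
    filter_upwards [(hk.comp_measurePreserving measurePreserving_ofTorus).coeFn_toLp] with y hy
    rw [hy, UnitAddTorus.mFourier_neg, ← mFourier_toTorus, toTorus_ofTorus]
    rfl
  have h := UnitAddTorus.hasSum_prod_mFourierCoeff hF.toLp hH.toLp
  simp only [hcoef hf, hcoef hh] at h
  have hm : AEStronglyMeasurable (fun y => (starRingEnd ℂ) (f y) * h' y) cellMeasure :=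
    hf.1.star.mul hh.1
  rw [← key hm]
  convert h using 1
  refine integral_congr_ae ?_
  filter_upwards [hF.coeFn_toLp, hH.coeFn_toLp] with y h1 h2
  rw [h1, h2]
  rfl

/-! ### The Fourier transform on `L²(ℝ³)` -/

section

open FourierTransform

lemma eLpNorm_two_sq {X E : Type*} [MeasurableSpace X] [NormedAddCommGroup E] (f : X → E)
    (ν : Measure X) : eLpNorm f 2 ν ^ 2 = ∫⁻ x, ‖f x‖ₑ ^ 2 ∂ν := by
  have := eLpNorm_nnreal_pow_eq_lintegral (f := f) (μ := ν) (p := 2) two_ne_zero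
  simpa using this

lemma fourierConst_pos : 0 < fourierConst := by unfold fourierConst; positivity

lemma fourierConst_sq : fourierConst ^ 2 = ((2 * Real.pi) ^ 3)⁻¹ := by
  rw [fourierConst, ← Real.rpow_natCast, ← Real.rpow_mul (by positivity)]
  rw [show (-(3 / 2) : ℝ) * ((2 : ℕ) : ℝ) = -(3 : ℕ) by norm_num, Real.rpow_neg (by positivity),
    Real.rpow_natCast]

lemma lintegral_comp_const_smul (F : R3 → ℝ≥0∞) {c : ℝ} (hc : 0 < c) :
    ∫⁻ x, F (c • x) = ENNReal.ofReal (c ^ 3)⁻¹ * ∫⁻ x, F x := by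
  have he : MeasurableEmbedding fun x : R3 => c • x :=
    (Homeomorph.smulOfNeZero c hc.ne').measurableEmbedding
  rw [← he.lintegral_map, Measure.map_addHaar_smul volume hc.ne', lintegral_smul_measure]
  simp [abs_of_pos hc]

lemma eLpNorm_comp_const_smul {E : Type*} [NormedAddCommGroup E] (F : R3 → E) {c : ℝ} (hc : 0 < c) :
    eLpNorm (fun x => F (c • x)) 2 volume ^ 2 =
      ENNReal.ofReal (c ^ 3)⁻¹ * eLpNorm F 2 volume ^ 2 := by
  rw [eLpNorm_two_sq, eLpNorm_two_sq, lintegral_comp_const_smul (fun x => ‖F x‖ₑ ^ 2) hc]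

lemma quasiMeasurePreserving_const_smul {c : ℝ} (hc : 0 < c) :
    Measure.QuasiMeasurePreserving (fun x : R3 => c • x) volume volume := by
  refine ⟨measurable_const_smul c, ?_⟩
  rw [Measure.map_addHaar_smul volume hc.ne']
  exact Measure.smul_absolutelyContinuous

lemma memLp_comp_const_smul {E : Type*} [NormedAddCommGroup E] {F : R3 → E}
    (hF : MemLp F 2 volume) {c : ℝ} (hc : 0 < c) : MemLp (fun x => F (c • x)) 2 volume := by
  refine ⟨hF.1.comp_quasiMeasurePreserving (quasiMeasurePreserving_const_smul hc), ?_⟩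
  refine (ENNReal.pow_lt_top_iff (n := 2)).1 ?_ |>.resolve_right two_ne_zero
  rw [eLpNorm_comp_const_smul F hc]
  exact ENNReal.mul_lt_top ENNReal.ofReal_lt_top (ENNReal.pow_lt_top hF.2)

/-- The square of the constant cancels the Jacobian of `θ ↦ θ/(2π)`. This is the passage from the
normalisation `e^{-2πi x·ξ}` to the unitary one with `e^{-iθ·x}`. -/
lemma eLpNorm_fourierConst_smul_comp {E : Type*} [NormedAddCommGroup E] [NormedSpace ℝ E] (F : R3 → E) :
    eLpNorm (fun θ => fourierConst • F ((2 * Real.pi)⁻¹ • θ)) 2 volume = eLpNorm F 2 volume := by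
  have h : eLpNorm (fun θ => fourierConst • F ((2 * Real.pi)⁻¹ • θ)) 2 volume ^ 2 =
      eLpNorm F 2 volume ^ 2 := by
    have h1 := eLpNorm_const_smul (μ := (volume : Measure R3)) (p := 2) fourierConst
      (fun θ : R3 => F ((2 * Real.pi)⁻¹ • θ))
    have h2 : (fun θ => fourierConst • F ((2 * Real.pi)⁻¹ • θ)) =
      fourierConst • fun θ : R3 => F ((2 * Real.pi)⁻¹ • θ) := rfl
    rw [h2, h1, mul_pow, eLpNorm_comp_const_smul F (by positivity), ← mul_assoc,
      Real.enorm_of_nonneg fourierConst_pos.le, ← ENNReal.ofReal_pow fourierConst_pos.le,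
      fourierConst_sq, ← ENNReal.ofReal_mul (by positivity)]
    have : ((2 * Real.pi) ^ 3)⁻¹ * ((2 * Real.pi)⁻¹ ^ 3)⁻¹ = 1 := by
      have := Real.pi_ne_zero
      field_simp
    rw [this, ENNReal.ofReal_one, one_mul]
  exact (ENNReal.pow_right_strictMono two_ne_zero).injective h

/-- The Fourier transform of a function in `L¹ ∩ L²`. -/
lemma fourier_toLp_ae_eq {f : R3 → C3} (hf : MemLp f 2 volume) (hi : Integrable f) :
    (𝓕 hf.toLp : Lp C3 2 (volume : Measure R3)) =ᵐ[volume] 𝓕 f := by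
  refine ae_eq_of_integral_contDiff_smul_eq
    ((Lp.memLp _).locallyIntegrable one_le_two)
    (VectorFourier.fourierIntegral_continuous Real.continuous_fourierChar
      continuous_inner hi).locallyIntegrable fun g hg hgc => ?_
  -- The `L²` transform is compared with the integral through tempered distributions: it moves onto
  -- the Schwartz function `G`, and Fubini moves it back onto `f`.
  let G : SchwartzMap R3 ℂ := HasCompactSupport.toSchwartzMap (f := fun x => (g x : ℂ))
    (hgc.comp_left (g := Complex.ofReal) rfl) (Complex.ofRealCLM.contDiff.comp hg)
  have hG : ∀ x, G x = g x := fun x => rfl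
  have h1 := congrArg (fun T => T G) (Lp.fourier_toTemperedDistribution_eq hf.toLp)
  simp only [TemperedDistribution.fourier_apply, Lp.toTemperedDistribution_apply] at h1
  have h2 : ∫ x, (𝓕 G : SchwartzMap R3 ℂ) x • f x = ∫ x, G x • 𝓕 f x :=
    VectorFourier.integral_fourierIntegral_smul_eq_flip (L := innerₗ R3)
      Real.continuous_fourierChar continuous_inner G.integrable hi |>.trans (by
        congr 1; ext1 x; congr 1; simp [VectorFourier.fourierIntegral, Real.fourier_eq, real_inner_comm])
  have h3 : ∫ x, (𝓕 G : SchwartzMap R3 ℂ) x • (hf.toLp : R3 → C3) x =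
      ∫ x, (𝓕 G : SchwartzMap R3 ℂ) x • f x := by
    refine integral_congr_ae ?_
    filter_upwards [hf.coeFn_toLp] with x hx
    rw [hx]
  rw [h3, h2] at h1
  simpa [hG] using h1.symm

/-- The inverse Fourier transform of a function in `L¹ ∩ L²`. -/
lemma fourierInv_toLp_ae_eq {f : R3 → C3} (hf : MemLp f 2 volume) (hi : Integrable f) :
    (𝓕⁻ hf.toLp : Lp C3 2 (volume : Measure R3)) =ᵐ[volume] 𝓕⁻ f := by
  have hcont : Continuous (𝓕⁻ f) := by
    rw [Real.fourierInv_eq_fourier_comp_neg]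
    exact VectorFourier.fourierIntegral_continuous Real.continuous_fourierChar
      continuous_inner hi.comp_neg
  refine ae_eq_of_integral_contDiff_smul_eq
    ((Lp.memLp _).locallyIntegrable one_le_two) hcont.locallyIntegrable fun g hg hgc => ?_
  let G : SchwartzMap R3 ℂ := HasCompactSupport.toSchwartzMap (f := fun x => (g x : ℂ))
    (hgc.comp_left (g := Complex.ofReal) rfl) (Complex.ofRealCLM.contDiff.comp hg)
  have hG : ∀ x, G x = g x := fun x => rfl
  have h1 := congrArg (fun T => T G) (Lp.fourierInv_toTemperedDistribution_eq hf.toLp)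
  simp only [TemperedDistribution.fourierInv_apply, Lp.toTemperedDistribution_apply] at h1
  have h2 : ∫ x, (𝓕⁻ G : SchwartzMap R3 ℂ) x • f x = ∫ x, G x • 𝓕⁻ f x := by
    rw [Real.fourierInv_eq_fourier_comp_neg]
    -- The inverse transform of `f` is the direct transform of `x ↦ f (-x)`, to which the exchange
    -- formula applies.
    have := VectorFourier.integral_fourierIntegral_smul_eq_flip (L := innerₗ R3) (μ := volume)
      (ν := volume) (f := (G : R3 → ℂ)) (g := fun x => f (-x))
      Real.continuous_fourierChar continuous_inner G.integrable hi.comp_neg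
    rw [← integral_neg_eq_self]
    refine Eq.trans ?_ (this.trans ?_)
    · congr 1; ext1 x
      rw [SchwartzMap.fourierInv_coe, Real.fourierInv_eq_fourier_neg, neg_neg]
      rfl
    · congr 1; ext1 x; congr 1; simp [VectorFourier.fourierIntegral, Real.fourier_eq, real_inner_comm]
  have h3 : ∫ x, (𝓕⁻ G : SchwartzMap R3 ℂ) x • (hf.toLp : R3 → C3) x =
      ∫ x, (𝓕⁻ G : SchwartzMap R3 ℂ) x • f x := by
    refine integral_congr_ae ?_
    filter_upwards [hf.coeFn_toLp] with x hx
    rw [hx]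
  rw [h3, h2] at h1
  simpa [hG] using h1.symm

open Classical in
/-- The unitary Fourier transform on `L²(ℝ³)`. -/
noncomputable def ft (f : R3 → C3) : R3 → C3 :=
  if hf : MemLp f 2 volume then
    fun θ => fourierConst • (𝓕 hf.toLp : Lp C3 2 (volume : Measure R3)) ((2 * Real.pi)⁻¹ • θ)
  else 0

lemma ft_def {f : R3 → C3} (hf : MemLp f 2 volume) : ft f =
    fun θ => fourierConst • (𝓕 hf.toLp : Lp C3 2 (volume : Measure R3)) ((2 * Real.pi)⁻¹ • θ) :=
  dif_pos hf

lemma memLp_ft {f : R3 → C3} (hf : MemLp f 2 volume) : MemLp (ft f) 2 volume := by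
  rw [ft_def hf]
  exact (memLp_comp_const_smul (Lp.memLp _) (by positivity)).const_smul fourierConst

lemma eLpNorm_ft {f : R3 → C3} (hf : MemLp f 2 volume) :
    eLpNorm (ft f) 2 volume = eLpNorm f 2 volume := by
  rw [ft_def hf, eLpNorm_fourierConst_smul_comp]
  have h := Lp.norm_fourier_eq hf.toLp
  rw [Lp.norm_def, Lp.norm_def, ENNReal.toReal_eq_toReal_iff' (Lp.eLpNorm_ne_top _)
    (Lp.eLpNorm_ne_top _)] at h
  rw [h, eLpNorm_congr_ae hf.coeFn_toLp]

/-- Dilations preserve null sets, so almost everywhere relations between `L²` transforms pass to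
`ft`. Three function slots cover sums; simpler relations leave a slot idle. -/
lemma ft_ae_of_ae {P : R3 → C3 → C3 → C3 → Prop} {F G H : R3 → C3}
    (h : ∀ᵐ ξ : R3, P ((2 * Real.pi) • ξ) (fourierConst • F ξ) (fourierConst • G ξ) (fourierConst • H ξ)) :
    ∀ᵐ θ : R3, P θ (fourierConst • F ((2 * Real.pi)⁻¹ • θ)) (fourierConst • G ((2 * Real.pi)⁻¹ • θ))
      (fourierConst • H ((2 * Real.pi)⁻¹ • θ)) := by
  have := (quasiMeasurePreserving_const_smul (c := (2 * Real.pi)⁻¹) (by positivity)).ae h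
  filter_upwards [this] with θ hθ
  rwa [smul_inv_smul₀ (by positivity)] at hθ

lemma ft_add {f g : R3 → C3} (hf : MemLp f 2 volume) (hg : MemLp g 2 volume) :
    ft (fun x => f x + g x) =ᵐ[volume] fun θ => ft f θ + ft g θ := by
  have hadd : MemLp (fun x => f x + g x) 2 volume := hf.add hg
  rw [ft_def hf, ft_def hg, ft_def hadd]
  refine ft_ae_of_ae (P := fun _ a b c => a = b + c) ?_
  have h : (hf.add hg).toLp (f + g) = hf.toLp + hg.toLp := MemLp.toLp_add hf hg
  have h2 : (𝓕 ((hf.add hg).toLp (f + g)) : Lp C3 2 (volume : Measure R3)) = 𝓕 hf.toLp + 𝓕 hg.toLp := by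
    rw [h, FourierTransform.fourier_add]
  rw [show hadd.toLp = (hf.add hg).toLp (f + g) from rfl, h2]
  filter_upwards [Lp.coeFn_add (𝓕 hf.toLp : Lp C3 2 (volume : Measure R3)) (𝓕 hg.toLp)] with ξ h3
  rw [h3, Pi.add_apply, smul_add]

lemma ft_const_smul {f : R3 → C3} (hf : MemLp f 2 volume) (c : ℂ) :
    ft (fun x => c • f x) =ᵐ[volume] fun θ => c • ft f θ := by
  have hc : MemLp (fun x => c • f x) 2 volume := hf.const_smul c
  rw [ft_def hf, ft_def hc]
  refine ft_ae_of_ae (P := fun _ a b _ => a = c • b) (H := f) ?_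
  have h : (hf.const_smul c).toLp (c • f) = c • hf.toLp := MemLp.toLp_const_smul c hf
  have h2 : (𝓕 ((hf.const_smul c).toLp (c • f)) : Lp C3 2 (volume : Measure R3)) = c • 𝓕 hf.toLp := by
    rw [h, FourierTransform.fourier_smul]
  rw [show hc.toLp = (hf.const_smul c).toLp (c • f) from rfl, h2]
  filter_upwards [Lp.coeFn_smul c (𝓕 hf.toLp : Lp C3 2 (volume : Measure R3))] with ξ h3
  rw [h3, Pi.smul_apply, smul_comm]

lemma ft_sub {f g : R3 → C3} (hf : MemLp f 2 volume) (hg : MemLp g 2 volume) :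
    ft (fun x => f x - g x) =ᵐ[volume] fun θ => ft f θ - ft g θ := by
  have h1 := ft_add hf (hg.const_smul (-1 : ℂ))
  have h2 := ft_const_smul hg (-1)
  have h3 : (fun x => f x - g x) = fun x => f x + ((-1 : ℂ) • g) x := by
    ext1 x; simp [sub_eq_add_neg]
  rw [h3]
  filter_upwards [h1, h2] with θ h1 h2
  rw [h1, show ((-1 : ℂ) • g) = fun x => (-1 : ℂ) • g x from rfl, h2]
  simp [sub_eq_add_neg]

lemma fourierIntegral_eq_fourier (f : R3 → C3) (θ : R3) :
    fourierIntegral volume f θ = fourierConst • 𝓕 f ((2 * Real.pi)⁻¹ • θ) := by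
  rw [fourierIntegral, Real.fourier_eq']
  congr 2
  ext1 x
  congr 1
  rw [conj_planeWave, planeWave, inner_smul_right, inner_neg_left, real_inner_comm]
  congr 1
  have := Real.pi_ne_zero
  push_cast
  field_simp

lemma ft_eq_fourierIntegral {f : R3 → C3} (hf : MemLp f 2 volume) (hi : Integrable f) :
    ft f =ᵐ[volume] fourierIntegral volume f := by
  rw [ft_def hf]
  have : fourierIntegral volume f = fun θ => fourierConst • 𝓕 f ((2 * Real.pi)⁻¹ • θ) :=
    funext fun θ => fourierIntegral_eq_fourier f θ
  rw [this]
  refine ft_ae_of_ae (P := fun _ a b _ => a = b) (H := f) ?_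
  filter_upwards [fourier_toLp_ae_eq hf hi] with ξ h
  rw [h]

lemma integral_inner_ft {f g : R3 → C3} (hf : MemLp f 2 volume) (hg : MemLp g 2 volume) :
    ∫ θ, inner ℂ (ft f θ) (ft g θ) = ∫ x, inner ℂ (f x) (g x) := by
  rw [ft_def hf, ft_def hg]
  have h := Lp.inner_fourier_eq hf.toLp hg.toLp
  rw [L2.inner_def, L2.inner_def] at h
  have h1 := Measure.integral_comp_smul (volume : Measure R3) (fun ξ => inner ℂ (fourierConst •
    (𝓕 hf.toLp : Lp C3 2 (volume : Measure R3)) ξ)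
      (fourierConst • (𝓕 hg.toLp : Lp C3 2 (volume : Measure R3)) ξ)) (2 * Real.pi)⁻¹
  rw [h1]
  have h2 : ∀ ξ, inner ℂ (fourierConst • (𝓕 hf.toLp : Lp C3 2 (volume : Measure R3)) ξ)
      (fourierConst • (𝓕 hg.toLp : Lp C3 2 (volume : Measure R3)) ξ) =
      ((fourierConst ^ 2 : ℝ) : ℂ) * inner ℂ ((𝓕 hf.toLp : Lp C3 2 (volume : Measure R3)) ξ)
        ((𝓕 hg.toLp : Lp C3 2 (volume : Measure R3)) ξ) := fun ξ => by
    rw [← Complex.coe_smul, ← Complex.coe_smul, inner_smul_left, inner_smul_right]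
    simp
    ring
  simp only [h2]
  rw [integral_const_mul, h, fourierConst_sq]
  have h3 : ∫ x, inner ℂ ((hf.toLp : R3 → C3) x) ((hg.toLp : R3 → C3) x) = ∫ x, inner ℂ (f x) (g x) := by
    refine integral_congr_ae ?_
    filter_upwards [hf.coeFn_toLp, hg.coeFn_toLp] with x h1 h2
    rw [h1, h2]
  rw [h3]
  have := Real.pi_pos
  rw [← Complex.coe_smul, smul_eq_mul, ← mul_assoc, ← Complex.ofReal_mul]
  simp only [finrank_euclideanSpace, Fintype.card_fin]
  rw [abs_of_pos (by positivity)]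
  have : ((2 * Real.pi)⁻¹ ^ 3)⁻¹ * ((2 * Real.pi) ^ 3)⁻¹ = 1 := by
    field_simp
  rw [this, Complex.ofReal_one, one_mul]

open Classical in
/-- The inverse of the unitary Fourier transform on `L²(ℝ³)`. -/
noncomputable def ift (h : R3 → C3) : R3 → C3 :=
  if hh : MemLp (fun ξ => fourierConst⁻¹ • h ((2 * Real.pi) • ξ)) 2 volume then
    (𝓕⁻ hh.toLp : Lp C3 2 (volume : Measure R3)) else 0

lemma memLp_rescale {h : R3 → C3} (hh : MemLp h 2 volume) :
    MemLp (fun ξ => fourierConst⁻¹ • h ((2 * Real.pi) • ξ)) 2 volume :=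
  (memLp_comp_const_smul hh (by positivity)).const_smul fourierConst⁻¹

lemma ift_def {h : R3 → C3} (hh : MemLp h 2 volume) :
    ift h = (𝓕⁻ (memLp_rescale hh).toLp : Lp C3 2 (volume : Measure R3)) := dif_pos _

lemma memLp_ift {h : R3 → C3} (hh : MemLp h 2 volume) : MemLp (ift h) 2 volume := by
  rw [ift_def hh]
  exact Lp.memLp _

lemma ft_ift {h : R3 → C3} (hh : MemLp h 2 volume) : ft (ift h) =ᵐ[volume] h := by
  rw [ft_def (memLp_ift hh)]
  have h1 : (memLp_ift hh).toLp = (𝓕⁻ (memLp_rescale hh).toLp : Lp C3 2 (volume : Measure R3)) := by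
    refine Lp.ext ((memLp_ift hh).coeFn_toLp.trans ?_)
    rw [ift_def hh]
  rw [h1, FourierTransform.fourier_fourierInv_eq]
  have h2 := (quasiMeasurePreserving_const_smul (c := (2 * Real.pi)⁻¹) (by positivity)).ae
    (memLp_rescale hh).coeFn_toLp
  filter_upwards [h2] with θ h2
  rw [h2, smul_inv_smul₀ fourierConst_pos.ne', smul_inv_smul₀ (by positivity)]

lemma ift_eq_integral {h : R3 → C3} (hh : MemLp h 2 volume) (hi : Integrable h) :
    ift h =ᵐ[volume] fun x => fourierConst • ∫ θ, planeWave θ x • h θ := by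
  rw [ift_def hh]
  have hi' : Integrable (fun ξ => fourierConst⁻¹ • h ((2 * Real.pi) • ξ)) :=
    (hi.comp_smul Real.two_pi_pos.ne').smul (fourierConst⁻¹ : ℝ)
  refine (fourierInv_toLp_ae_eq (memLp_rescale hh) hi').trans (Eventually.of_forall fun x => ?_)
  have h1 := Measure.integral_comp_smul (volume : Measure R3)
    (fun θ => planeWave θ x • h θ) (2 * Real.pi)
  simp only [Real.fourierInv_eq']
  have h2 : ∀ v : R3, Complex.exp (↑(2 * Real.pi * inner ℝ v x) * Complex.I) •
      fourierConst⁻¹ • h ((2 * Real.pi) • v) =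
      fourierConst⁻¹ • (planeWave ((2 * Real.pi) • v) x • h ((2 * Real.pi) • v)) := fun v => by
    rw [smul_comm, planeWave, inner_smul_left, mul_comm]
    rfl
  simp only [h2]
  rw [integral_smul, h1, smul_smul]
  congr 1
  simp only [finrank_euclideanSpace, Fintype.card_fin]
  rw [abs_of_pos (by positivity), ← fourierConst_sq]
  have := fourierConst_pos
  field_simp

end

/-! ### Truncations and limits in `L²` -/

/-- Dominated convergence in `L²`. -/
lemma tendsto_eLpNorm_two_of_dominated {X ι E E' : Type*} [MeasurableSpace X] {ν : Measure X}
    [NormedAddCommGroup E] [NormedAddCommGroup E'] {l : Filter ι} [l.IsCountablyGenerated]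
    {F : ι → X → E} {G : X → E'} (hF : ∀ i, AEStronglyMeasurable (F i) ν) (hG : MemLp G 2 ν)
    (hle : ∀ i, ∀ᵐ x ∂ν, ‖F i x‖ ≤ ‖G x‖)
    (hlim : ∀ᵐ x ∂ν, Tendsto (fun i => F i x) l (𝓝 0)) :
    Tendsto (fun i => eLpNorm (F i) 2 ν) l (𝓝 0) := by
  have h : Tendsto (fun i => eLpNorm (F i) 2 ν ^ 2) l (𝓝 0) := by
    simp only [eLpNorm_two_sq]
    have := tendsto_lintegral_filter_of_dominated_convergence' (μ := ν) (l := l)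
      (F := fun i x => ‖F i x‖ₑ ^ 2) (f := fun _ => 0) (fun x => ‖G x‖ₑ ^ 2)
      (Eventually.of_forall fun i => (hF i).enorm.pow_const 2)
      (Eventually.of_forall fun i => ?_) ?_ ?_
    · simpa using this
    · filter_upwards [hle i] with x hx
      gcongr
      exact enorm_le_iff_norm_le.2 hx
    · rw [← eLpNorm_two_sq]
      exact (ENNReal.pow_lt_top hG.2).ne
    · filter_upwards [hlim] with x hx
      have h0 := hx.enorm
      rw [enorm_zero] at h0
      have := (ENNReal.continuous_pow 2).tendsto 0 |>.comp h0
      simpa [Function.comp_def] using this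
  have h2 := (ENNReal.continuous_rpow_const (y := (1 / 2 : ℝ))).tendsto 0 |>.comp h
  have h3 : ∀ a : ℝ≥0∞, (a ^ 2) ^ (1 / 2 : ℝ) = a := fun a => by
    rw [← ENNReal.rpow_natCast, ← ENNReal.rpow_mul]; norm_num
  simp only [Function.comp_def, h3] at h2
  simpa using h2

section Trunc

variable {ν : Measure R3} {g : R3 → C3}

lemma memLp_trunc (hg : MemLp g 2 ν) (R : ℝ) : MemLp (trunc R g) 2 ν :=
  hg.indicator measurableSet_ball

lemma norm_trunc_le (R : ℝ) (g : R3 → C3) (x : R3) : ‖trunc R g x‖ ≤ ‖g x‖ :=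
  norm_indicator_le_norm_self _ _

lemma tendsto_trunc_apply (g : R3 → C3) (x : R3) :
    Tendsto (fun R => trunc R g x) atTop (𝓝 (g x)) := by
  refine tendsto_const_nhds.congr' ?_
  filter_upwards [eventually_gt_atTop ‖x‖] with R hR
  rw [trunc, Set.indicator_of_mem (by simpa using hR)]

lemma tendsto_eLpNorm_trunc_sub (hg : MemLp g 2 ν) :
    Tendsto (fun R => eLpNorm (fun x => trunc R g x - g x) 2 ν) atTop (𝓝 0) := by
  refine tendsto_eLpNorm_two_of_dominated (G := fun x => 2 * ‖g x‖)
    (fun R => ((memLp_trunc hg R).sub hg).1) (hg.norm.const_mul 2) (fun R => ?_) ?_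
  · refine Eventually.of_forall fun x => ?_
    rw [norm_mul, norm_norm, Real.norm_ofNat, two_mul]
    exact (norm_sub_le _ _).trans (by gcongr; exact norm_trunc_le R g x)
  · refine Eventually.of_forall fun x => ?_
    have := (tendsto_trunc_apply g x).sub_const (g x)
    rwa [sub_self] at this

lemma integrable_trunc {g : R3 → C3} (hg : MemLp g 2 volume) (R : ℝ) : Integrable (trunc R g) := by
  rw [trunc, integrable_indicator_iff measurableSet_ball]
  have : IsFiniteMeasure (volume.restrict (Metric.ball (0 : R3) R)) :=
    ⟨by rw [Measure.restrict_apply_univ]; exact measure_ball_lt_top⟩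
  exact (hg.restrict _).integrable one_le_two

/-- By Plancherel the transforms of the truncations converge in `L²` of the whole frequency space,
hence on every ball. -/
lemma isFourierTransform_ft {g : R3 → C3} (hg : MemLp g 2 volume) :
    IsFourierTransform volume g (ft g) := by
  refine ⟨(memLp_ft hg).1, fun r => ?_⟩
  refine tendsto_of_tendsto_of_tendsto_of_le_of_le tendsto_const_nhds
    (tendsto_eLpNorm_trunc_sub hg) (fun _ => zero_le) fun R => ?_
  have h : eLpNorm (fun θ => fourierIntegral volume (trunc R g) θ - ft g θ) 2 volume =
      eLpNorm (fun x => trunc R g x - g x) 2 volume := by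
    have hs : MemLp (fun x => trunc R g x - g x) 2 volume := (memLp_trunc hg R).sub hg
    rw [← eLpNorm_ft hs]
    refine eLpNorm_congr_ae ?_
    filter_upwards [ft_eq_fourierIntegral (memLp_trunc hg R) (integrable_trunc hg R),
      ft_sub (memLp_trunc hg R) hg] with θ h1 h2
    rw [h2, h1]
  exact (eLpNorm_mono_measure _ Measure.restrict_le_self).trans h.le

end Trunc

/-! ### Partial inverse Fourier integrals -/

lemma ft_ift_sub {h k : R3 → C3} (hh : MemLp h 2 volume) (hk : MemLp k 2 volume) :
    eLpNorm (fun x => ift h x - ift k x) 2 volume = eLpNorm (fun x => h x - k x) 2 volume := by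
  have hs : MemLp (fun x => ift h x - ift k x) 2 volume := (memLp_ift hh).sub (memLp_ift hk)
  rw [← eLpNorm_ft hs]
  refine eLpNorm_congr_ae ?_
  filter_upwards [ft_sub (memLp_ift hh) (memLp_ift hk), ft_ift hh, ft_ift hk] with θ h1 h2 h3
  rw [h1, h2, h3]

lemma partialInverse_ae_eq {h : R3 → C3} (hh : MemLp h 2 volume) (R : ℝ) :
    partialInverse h R =ᵐ[volume] ift (trunc R h) := by
  refine EventuallyEq.trans (Eventually.of_forall fun x => ?_)
    (ift_eq_integral (memLp_trunc hh R) (integrable_trunc hh R)).symm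
  simp only [partialInverse, trunc]
  rw [← integral_indicator measurableSet_ball]
  congr 2
  ext1 θ
  by_cases hθ : θ ∈ Metric.ball (0 : R3) R
  · rw [Set.indicator_of_mem hθ, Set.indicator_of_mem hθ]
  · rw [Set.indicator_of_notMem hθ, Set.indicator_of_notMem hθ, smul_zero]

lemma tendsto_partialInverse {h : R3 → C3} (hh : MemLp h 2 volume) :
    Tendsto (fun R : ℝ => eLpNorm (fun x => partialInverse h R x - ift h x) 2 volume)
      atTop (𝓝 0) := by
  refine (tendsto_eLpNorm_trunc_sub hh).congr fun R => ?_
  rw [← ft_ift_sub (memLp_trunc hh R) hh]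
  refine eLpNorm_congr_ae ?_
  filter_upwards [partialInverse_ae_eq hh R] with x hx
  rw [hx]

/-- On a ball of frequencies the differentiated integrand is dominated by `R ‖k‖`, so no decay of
`k` is required to differentiate under the integral. -/
lemma pderiv_integral_planeWave {k : R3 → ℂ} {R : ℝ}
    (hk : IntegrableOn k (Metric.ball 0 R)) (j : Fin 3) (x : R3) :
    pderiv j (fun y => ∫ θ in Metric.ball 0 R, planeWave θ y * k θ) x =
      ∫ θ in Metric.ball 0 R, Complex.I * θ j * (planeWave θ x * k θ) := by
  have hm : ∀ y : R3, AEStronglyMeasurable (fun θ => planeWave θ y * k θ)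
      (volume.restrict (Metric.ball 0 R)) := fun y =>
    (by fun_prop : Continuous fun θ => planeWave θ y).aestronglyMeasurable.mul hk.1
  let D : R3 → R3 → R3 →L[ℝ] ℂ := fun y θ =>
    (k θ * (Complex.I * planeWave θ y)) • (Complex.ofRealCLM.comp (innerSL ℝ θ))
  have hnorm : ∀ θ : R3, ‖Complex.ofRealCLM.comp (innerSL ℝ θ)‖ ≤ ‖θ‖ := fun θ => by
    refine (ContinuousLinearMap.opNorm_comp_le _ _).trans ?_
    rw [Complex.ofRealCLM_norm, one_mul, innerSL_apply_norm]
  have hD := hasFDerivAt_integral_of_dominated_of_fderiv_le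
    (μ := volume.restrict (Metric.ball 0 R)) (F := fun y θ => planeWave θ y * k θ) (F' := D)
    (x₀ := x) (s := Set.univ) (bound := fun θ => R * ‖k θ‖) Filter.univ_mem
    (Eventually.of_forall hm)
    (hk.bdd_mul (c := 1) (by fun_prop : Continuous fun θ => planeWave θ x).aestronglyMeasurable
      (Eventually.of_forall fun θ => (norm_planeWave θ x).le)) ?_ ?_ (hk.norm.const_mul R) ?_
  · rw [pderiv, hD.fderiv, ContinuousLinearMap.integral_apply]
    · refine integral_congr_ae (Eventually.of_forall fun θ => ?_)
      have := inner_basisVec θ j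
      simp [D, this]
      ring
    · refine Integrable.mono' (hk.norm.const_mul R) ?_ ?_
      · refine AEStronglyMeasurable.smul (f := fun θ => k θ * (Complex.I * planeWave θ x))
          (g := fun θ => Complex.ofRealCLM.comp (innerSL ℝ θ)) (hk.1.mul ?_) ?_
        · exact (by fun_prop : Continuous _).aestronglyMeasurable
        · exact (by fun_prop : Continuous _).aestronglyMeasurable
      · filter_upwards [ae_restrict_mem measurableSet_ball] with θ hθ
        rw [norm_smul, norm_mul, norm_mul, Complex.norm_I, norm_planeWave, one_mul, mul_one, mul_comm]
        gcongr
        exact (hnorm θ).trans (by simpa using (mem_ball_zero_iff.1 hθ).le)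
  · refine AEStronglyMeasurable.smul (f := fun θ => k θ * (Complex.I * planeWave θ x))
      (g := fun θ => Complex.ofRealCLM.comp (innerSL ℝ θ)) (hk.1.mul ?_) ?_
    · exact (by fun_prop : Continuous _).aestronglyMeasurable
    · exact (by fun_prop : Continuous _).aestronglyMeasurable
  · filter_upwards [ae_restrict_mem measurableSet_ball] with θ hθ y _
    rw [norm_smul, norm_mul, norm_mul, Complex.norm_I, norm_planeWave, one_mul, mul_one, mul_comm]
    gcongr
    exact (hnorm θ).trans (by simpa using (mem_ball_zero_iff.1 hθ).le)
  · refine Eventually.of_forall fun θ y _ => ?_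
    refine ((hasFDerivAt_planeWave θ y).mul_const (k θ)).congr_fderiv ?_
    rw [smul_smul]

lemma integrableOn_ball_of_memLp {h : R3 → C3} (hh : MemLp h 2 volume) (R : ℝ) :
    IntegrableOn h (Metric.ball 0 R) := by
  have := integrable_trunc hh R
  rwa [trunc, integrable_indicator_iff measurableSet_ball] at this

lemma integral_apply_C3 {X : Type*} [MeasurableSpace X] {ν : Measure X} {f : X → C3}
    (hf : Integrable f ν) (i : Fin 3) : (∫ x, f x ∂ν) i = ∫ x, f x i ∂ν :=
  ((EuclideanSpace.proj i : C3 →L[ℂ] ℂ).integral_comp_comm hf).symm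

lemma integrable_apply_C3 {X : Type*} [MeasurableSpace X] {ν : Measure X} {f : X → C3}
    (hf : Integrable f ν) (i : Fin 3) : Integrable (fun x => f x i) ν :=
  (EuclideanSpace.proj i : C3 →L[ℂ] ℂ).integrable_comp hf

lemma integrableOn_planeWave_smul {h : R3 → C3} {R : ℝ} (hh : IntegrableOn h (Metric.ball 0 R))
    (x : R3) : IntegrableOn (fun θ => planeWave θ x • h θ) (Metric.ball 0 R) :=
  hh.bdd_smul 1 (by fun_prop : Continuous fun θ => planeWave θ x).aestronglyMeasurable
    (Eventually.of_forall fun θ => (norm_planeWave θ x).le)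

lemma partialInverse_apply {h : R3 → C3} {R : ℝ} (hh : IntegrableOn h (Metric.ball 0 R)) (x : R3)
    (i : Fin 3) : partialInverse h R x i =
      fourierConst * ∫ θ in Metric.ball 0 R, planeWave θ x * h θ i := by
  rw [partialInverse, PiLp.smul_apply, integral_apply_C3 (integrableOn_planeWave_smul hh x),
    Complex.real_smul]
  rfl

lemma pderiv_const_mul_integral_planeWave {k : R3 → ℂ} {R : ℝ}
    (hk : IntegrableOn k (Metric.ball 0 R)) (j : Fin 3) (x : R3) :
    pderiv j (fun y => fourierConst * ∫ θ in Metric.ball 0 R, planeWave θ y * k θ) x =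
      fourierConst * ∫ θ in Metric.ball 0 R, Complex.I * θ j * (planeWave θ x * k θ) := by
  rw [← pderiv_integral_planeWave hk, pderiv, pderiv]
  have := fderiv_const_smul_field (𝕜 := ℝ) (fourierConst : ℂ)
    (f := fun y => ∫ θ in Metric.ball 0 R, planeWave θ y * k θ)
  exact congrArg (fun T : R3 → R3 →L[ℝ] ℂ => T x (basisVec j)) this

lemma curl_partialInverse {h : R3 → C3} (hh : MemLp h 2 volume)
    (hX : MemLp (fun θ => cmul (crossMatrix θ) (h θ)) 2 volume) (R : ℝ) (x : R3) :
    curl (partialInverse h R) x = partialInverse (fun θ => cmul (crossMatrix θ) (h θ)) R x := by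
  have hi := integrableOn_ball_of_memLp hh R
  have hXi := integrableOn_ball_of_memLp hX R
  have hint : ∀ j i : Fin 3, IntegrableOn (fun θ : R3 => Complex.I * θ j * (planeWave θ x * h θ i))
      (Metric.ball 0 R) := fun j i => by
    have h1 : IntegrableOn (fun θ : R3 => planeWave θ x * h θ i) (Metric.ball 0 R) :=
      integrable_apply_C3 (integrableOn_planeWave_smul hi x) i
    refine h1.bdd_mul (c := R) (by fun_prop : Continuous fun θ : R3 => Complex.I * (θ j : ℂ)).aestronglyMeasurable ?_
    filter_upwards [ae_restrict_mem measurableSet_ball] with θ hθ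
    rw [norm_mul, Complex.norm_I, one_mul, Complex.norm_real]
    exact (PiLp.norm_apply_le θ j).trans (mem_ball_zero_iff.1 hθ).le
  have key : ∀ a b c d : Fin 3,
      pderiv a (fun y => partialInverse h R y b) x - pderiv c (fun y => partialInverse h R y d) x =
      fourierConst * ∫ θ in Metric.ball 0 R,
        planeWave θ x * (Complex.I * (θ a * h θ b - θ c * h θ d)) := fun a b c d => by
    simp only [partialInverse_apply hi]
    rw [pderiv_const_mul_integral_planeWave (integrable_apply_C3 hi b),
      pderiv_const_mul_integral_planeWave (integrable_apply_C3 hi d), ← mul_sub,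
      ← integral_sub (hint a b) (hint c d)]
    congr 2
    ext1 θ
    ring
  rw [curl, key, key, key]
  ext i
  rw [partialInverse_apply hXi]
  simp only [cmul_cross]
  fin_cases i <;> rfl

lemma isInverseWithCurl_ift {h : R3 → C3} (hh : MemLp h 2 volume)
    (hX : MemLp (fun θ => cmul (crossMatrix θ) (h θ)) 2 volume) :
    IsInverseWithCurl volume h (ift h) (ift fun θ => cmul (crossMatrix θ) (h θ)) := by
  refine ⟨memLp_ift hh, memLp_ift hX, tendsto_partialInverse hh, ?_⟩
  simp only [curl_partialInverse hh hX]
  exact tendsto_partialInverse hX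

/-! ### Fourier coefficients of vector fields on the unit cell -/

lemma memLp_apply_C3 {X : Type*} [MeasurableSpace X] {ν : Measure X} {f : X → C3}
    (hf : MemLp f 2 ν) (i : Fin 3) : MemLp (fun x => f x i) 2 ν :=
  (EuclideanSpace.proj i : C3 →L[ℂ] ℂ).comp_memLp' hf

lemma memLp_planeWave_smul {E : Type*} [NormedAddCommGroup E] [NormedSpace ℂ E] {ν : Measure R3}
    {f : R3 → E} (hf : MemLp f 2 ν) (κ : R3) : MemLp (fun y => planeWave κ y • f y) 2 ν := by
  refine hf.of_le (AEStronglyMeasurable.smul (f := planeWave κ)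
    (by fun_prop : Continuous fun y => planeWave κ y).aestronglyMeasurable hf.1)
    (Eventually.of_forall fun y => ?_)
  rw [norm_smul, norm_planeWave, one_mul]

lemma memLp_conj_planeWave_smul {E : Type*} [NormedAddCommGroup E] [NormedSpace ℂ E] {ν : Measure R3}
    {f : R3 → E} (hf : MemLp f 2 ν) (κ : R3) :
    MemLp (fun y => (starRingEnd ℂ) (planeWave κ y) • f y) 2 ν := by
  simp only [conj_planeWave]
  exact memLp_planeWave_smul hf _

section

variable {E : Type*} [NormedAddCommGroup E] [NormedSpace ℂ E]

lemma integrable_cellCoeff {f : R3 → E} (hf : MemLp f 2 cellMeasure) (n : Fin 3 → ℤ) :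
    Integrable (fun y => (starRingEnd ℂ) (planeWave (mode n) y) • f y) cellMeasure :=
  (memLp_conj_planeWave_smul hf (mode n)).integrable one_le_two

lemma cellCoeff_add {f g : R3 → E} (hf : MemLp f 2 cellMeasure) (hg : MemLp g 2 cellMeasure)
    (n : Fin 3 → ℤ) : cellCoeff n (fun y => f y + g y) = cellCoeff n f + cellCoeff n g := by
  simp only [cellCoeff, smul_add]
  exact integral_add (integrable_cellCoeff hf n) (integrable_cellCoeff hg n)

lemma cellCoeff_sub {f g : R3 → E} (hf : MemLp f 2 cellMeasure) (hg : MemLp g 2 cellMeasure)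
    (n : Fin 3 → ℤ) : cellCoeff n (fun y => f y - g y) = cellCoeff n f - cellCoeff n g := by
  simp only [cellCoeff, smul_sub]
  exact integral_sub (integrable_cellCoeff hf n) (integrable_cellCoeff hg n)

end

lemma mode_zero : mode 0 = 0 := by ext i; simp [mode, ivec]

lemma cellCoeff_zero (f : R3 → C3) : cellCoeff 0 f = ∫ y in unitCell, f y := by
  simp [cellCoeff, mode_zero, planeWave_zero_left]

lemma mode_neg (n : Fin 3 → ℤ) : mode (-n) = -mode n := by ext i; simp [mode, ivec]

lemma integral_planeWave_mode (n : Fin 3 → ℤ) :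
    ∫ y in unitCell, planeWave (mode n) y = if n = 0 then 1 else 0 := by
  rw [← integral_mFourier_map_toTorus, map_toTorus_volume]
  have h1 := orthonormal_iff_ite.1 (UnitAddTorus.orthonormal_mFourier (d := Fin 3)) 0 n
  rw [ContinuousMap.inner_toLp] at h1
  refine Eq.trans ?_ (h1.trans (by simp only [eq_comm]))
  refine integral_congr_ae (Eventually.of_forall fun y => ?_)
  simp [UnitAddTorus.mFourier_zero]

lemma cellCoeff_const {E : Type*} [NormedAddCommGroup E] [NormedSpace ℂ E] [CompleteSpace E]
    (n : Fin 3 → ℤ) (c : E) : cellCoeff n (fun _ => c) = if n = 0 then c else 0 := by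
  rw [cellCoeff, integral_smul_const]
  simp only [conj_planeWave, ← mode_neg]
  rw [integral_planeWave_mode]
  split_ifs <;> simp_all

lemma cellCoeff_apply {f : R3 → C3} (hf : MemLp f 2 cellMeasure) (n : Fin 3 → ℤ) (i : Fin 3) :
    cellCoeff n f i = cellCoeff n fun y => f y i :=
  integral_apply_C3 (integrable_cellCoeff hf n) i

/-- Parseval's identity on the unit cell. -/
lemma hasSum_inner_cellCoeff {f g : R3 → C3} (hf : MemLp f 2 cellMeasure)
    (hg : MemLp g 2 cellMeasure) :
    HasSum (fun n => inner ℂ (cellCoeff n f) (cellCoeff n g))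
      (∫ y in unitCell, inner ℂ (f y) (g y)) := by
  simp only [inner_C3, cellCoeff_apply hf, cellCoeff_apply hg]
  rw [integral_finsetSum]
  · exact hasSum_sum fun i _ => hasSum_conj_cellCoeff_mul (memLp_apply_C3 hf i) (memLp_apply_C3 hg i)
  · intro i _
    have h1 : MemLp (fun y => (starRingEnd ℂ) (f y i)) 2 cellMeasure := (memLp_apply_C3 hf i).star
    exact MemLp.integrable_mul h1 (memLp_apply_C3 hg i)

lemma integral_norm_sq_eq {X E : Type*} [MeasurableSpace X] [NormedAddCommGroup E] {ν : Measure X}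
    {f : X → E} (hf : MemLp f 2 ν) :
    eLpNorm f 2 ν ^ 2 = ENNReal.ofReal (∫ x, ‖f x‖ ^ 2 ∂ν) := by
  rw [eLpNorm_two_sq, ofReal_integral_eq_lintegral_ofReal (hf.integrable_norm_pow two_ne_zero)
    (Eventually.of_forall fun x => by positivity)]
  refine lintegral_congr fun x => ?_
  rw [ENNReal.ofReal_pow (norm_nonneg _), ofReal_norm]

lemma hasSum_norm_sq_cellCoeff {f : R3 → C3} (hf : MemLp f 2 cellMeasure) :
    HasSum (fun n => ‖cellCoeff n f‖ ^ 2) (∫ y in unitCell, ‖f y‖ ^ 2) := by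
  have h := (hasSum_inner_cellCoeff hf hf).mapL Complex.reCLM
  have h2 : (∫ y in unitCell, inner ℂ (f y) (f y)) = ((∫ y in unitCell, ‖f y‖ ^ 2 : ℝ) : ℂ) := by
    rw [← integral_complex_ofReal]
    congr 1
    ext1 y
    rw [inner_self_eq_norm_sq_to_K]
    norm_cast
  rw [h2] at h
  refine h.congr_fun fun n => ?_
  rw [inner_self_eq_norm_sq_to_K]
  simp only [Complex.reCLM_apply]
  norm_cast

lemma eLpNorm_sq_eq_tsum_cellCoeff {f : R3 → C3} (hf : MemLp f 2 cellMeasure) :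
    eLpNorm f 2 cellMeasure ^ 2 = ∑' n, ‖cellCoeff n f‖ₑ ^ 2 := by
  have h := hasSum_norm_sq_cellCoeff hf
  rw [integral_norm_sq_eq hf, ← h.tsum_eq, ENNReal.ofReal_tsum_of_nonneg (fun n => by positivity)
    h.summable]
  congr 1
  ext1 n
  rw [ENNReal.ofReal_pow (norm_nonneg _), ofReal_norm]

lemma enorm_cellCoeff_le {f : R3 → C3} (hf : MemLp f 2 cellMeasure) (n : Fin 3 → ℤ) :
    ‖cellCoeff n f‖ₑ ^ 2 ≤ eLpNorm f 2 cellMeasure ^ 2 := by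
  rw [eLpNorm_sq_eq_tsum_cellCoeff hf]
  exact ENNReal.le_tsum n

lemma norm_cellCoeff_sq_le {f : R3 → C3} (hf : MemLp f 2 cellMeasure) (n : Fin 3 → ℤ) :
    ‖cellCoeff n f‖ ^ 2 ≤ ∫ y in unitCell, ‖f y‖ ^ 2 := by
  have h := hasSum_norm_sq_cellCoeff hf
  rw [← h.tsum_eq]
  exact h.summable.le_tsum n fun _ _ => by positivity

/-! ### The Floquet transform -/

lemma measurableSet_dualCell (ε : ℝ) : MeasurableSet (dualCell ε) := by
  have : dualCell ε = ⋂ i, (fun θ : R3 => ε * θ i) ⁻¹' Set.Ico (-Real.pi) Real.pi := by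
    ext x; simp [dualCell]
  rw [this]
  exact MeasurableSet.iInter fun i => (by fun_prop : Measurable fun x : R3 => ε * x i) measurableSet_Ico

lemma existsUnique_sub_mem_dualCell {ε : ℝ} (hε : 0 < ε) (x : R3) :
    ∃! m, x - ε⁻¹ • mode m ∈ dualCell ε := by
  -- The affine map `x ↦ (εx + π)/(2π)`, applied coordinatewise, carries the dual cell to the unit
  -- cell and the dual lattice to the integers.
  have h : ∀ m, x - ε⁻¹ • mode m ∈ dualCell ε ↔
      (WithLp.toLp 2 fun i => (ε * x i + Real.pi) / (2 * Real.pi) : R3) - ivec m ∈ unitCell := by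
    intro m
    simp only [dualCell, unitCell, Set.mem_ofPred_eq, ivec, mode, PiLp.sub_apply, PiLp.smul_apply,
      Set.mem_Ico, smul_eq_mul]
    refine forall_congr' fun i => ?_
    have h1 : ε * (x i - ε⁻¹ * (2 * Real.pi * (m i : ℝ))) = ε * x i - 2 * Real.pi * m i := by
      field_simp
    have hp := Real.pi_pos
    set t := (ε * x i + Real.pi) / (2 * Real.pi) with ht
    have h2 : ε * x i - 2 * Real.pi * m i = 2 * Real.pi * (t - m i) - Real.pi := by
      rw [ht]; field_simp; ring
    rw [h1, h2]
    constructor <;> rintro ⟨h1, h2⟩ <;> constructor <;> nlinarith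
  simp only [h]
  exact existsUnique_sub_ivec_mem_unitCell _

lemma lintegral_dualCell_tiling {ε : ℝ} (hε : 0 < ε) (F : R3 → ℝ≥0∞) (hF : AEMeasurable F) :
    ∫⁻ ξ, F ξ = ∫⁻ θ in dualCell ε, ∑' m, F (θ + ε⁻¹ • mode m) := by
  rw [lintegral_tiling (v := fun m => ε⁻¹ • mode m) (measurableSet_dualCell ε)
    (fun m => (measurePreserving_add_right volume _).map_eq) (existsUnique_sub_mem_dualCell hε),
    lintegral_tsum]
  exact fun m => (hF.comp_quasiMeasurePreserving
    (measurePreserving_add_right volume _).quasiMeasurePreserving).restrict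

lemma ae_dualCell {p : R3 → Prop} (h : ∀ᵐ ξ, p ξ) (ε : ℝ) :
    ∀ᵐ θ ∂(volume.restrict (dualCell ε)), ∀ m, p (θ + ε⁻¹ • mode m) := by
  refine ae_restrict_of_ae (ae_all_iff.2 fun m => ?_)
  exact (measurePreserving_add_right volume (ε⁻¹ • mode m)).quasiMeasurePreserving.ae h

/-- The constant in the definition of `floquetSeries`. -/
noncomputable def floquetConst (ε : ℝ) : ℝ := (ε ^ 2 / (2 * Real.pi)) ^ (3 / 2 : ℝ)

lemma floquetConst_eq {ε : ℝ} (hε : 0 < ε) : floquetConst ε = fourierConst * ε ^ 3 := by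
  rw [floquetConst, fourierConst, Real.div_rpow (by positivity) (by positivity),
    Real.rpow_neg (by positivity), ← Real.rpow_natCast ε 2, ← Real.rpow_mul hε.le, div_eq_inv_mul]
  congr 1
  norm_num

/-- One term of the Floquet series. -/
noncomputable def floquetTerm (ε : ℝ) (g : R3 → C3) (n : Fin 3 → ℤ) (θ y : R3) : C3 :=
  (starRingEnd ℂ) (planeWave θ (ε • (y + ivec n))) • g (ε • (y + ivec n))

/-- The finite set depends only on `ε` and `R`. The Floquet series of a truncated function is
therefore one fixed finite sum for all `θ` and all `y` in the cell, which gives measurability and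
interchange with integrals. -/
lemma exists_floquetTerm_eq_zero {ε : ℝ} (hε : 0 < ε) (R : ℝ) :
    ∃ S : Finset (Fin 3 → ℤ), ∀ g : R3 → C3, trunc R g = g → ∀ θ, ∀ y ∈ unitCell, ∀ n ∉ S,
      floquetTerm ε g n θ y = 0 := by
  -- A nonzero term has `|n_i| ≤ |y_i + n_i| + |y_i| < R/ε + 1`.
  obtain ⟨N, hN⟩ := exists_nat_gt (R / ε + 1)
  refine ⟨Finset.Icc (fun _ => -(N : ℤ)) (fun _ => (N : ℤ)), fun g hg θ y hy n hn => ?_⟩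
  have h0 : g (ε • (y + ivec n)) = 0 := by
    rw [← hg, trunc, Set.indicator_of_notMem]
    intro hmem
    refine hn (Finset.mem_Icc.2 ?_)
    have key : ∀ i, |(n i : ℝ)| ≤ N := fun i => by
      have h1 : |ε * (y i + n i)| < R := by
        have := (PiLp.norm_apply_le (ε • (y + ivec n)) i).trans_lt (mem_ball_zero_iff.1 hmem)
        simpa only [ivec, PiLp.smul_apply, PiLp.add_apply, smul_eq_mul, Real.norm_eq_abs] using this
      rw [abs_mul, abs_of_pos hε, ← lt_div_iff₀' hε] at h1
      have h2 := hy i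
      have h3 := abs_sub_abs_le_abs_sub (n i : ℝ) (-(y i))
      rw [abs_neg, abs_of_nonneg h2.1, sub_neg_eq_add, add_comm] at h3
      have h5 := h2.2
      have h6 := h3.trans_lt h1
      linarith
    exact ⟨fun i => by exact_mod_cast (abs_le.1 (key i)).1, fun i => by exact_mod_cast (abs_le.1 (key i)).2⟩
  rw [floquetTerm, h0, smul_zero]

lemma floquetSeries_eq (ε : ℝ) (g : R3 → C3) (θ y : R3) :
    floquetSeries ε g θ y = floquetConst ε • ∑' n, floquetTerm ε g n θ y := rfl

lemma memLp_floquetTerm {g : R3 → C3} (hg : MemLp g 2 volume) {ε : ℝ} (hε : 0 < ε)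
    (n : Fin 3 → ℤ) (θ : R3) : MemLp (floquetTerm ε g n θ) 2 volume := by
  have h1 : MemLp (fun y => (starRingEnd ℂ) (planeWave θ (ε • y)) • g (ε • y)) 2 volume :=
    memLp_comp_const_smul (F := fun y => (starRingEnd ℂ) (planeWave θ y) • g y)
      (memLp_conj_planeWave_smul hg θ) hε
  exact h1.comp_measurePreserving (measurePreserving_add_right volume (ivec n))

lemma aestronglyMeasurable_floquetTerm {g : R3 → C3} (hg : MemLp g 2 volume) {ε : ℝ} (hε : 0 < ε)
    (n : Fin 3 → ℤ) (ρ : Measure R3) [SFinite ρ] :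
    AEStronglyMeasurable (fun z : R3 × R3 => floquetTerm ε g n z.1 z.2) (ρ.prod cellMeasure) := by
  have h1 : MemLp (fun y => g (ε • (y + ivec n))) 2 volume :=
    (memLp_comp_const_smul hg hε).comp_measurePreserving (measurePreserving_add_right volume (ivec n))
  exact AEStronglyMeasurable.smul
    (f := fun z : R3 × R3 => (starRingEnd ℂ) (planeWave z.1 (ε • (z.2 + ivec n))))
    (by fun_prop : Continuous _).aestronglyMeasurable (h1.1.restrict.comp_snd)

lemma ae_cell_mem (ρ : Measure R3) [SFinite ρ] :
    ∀ᵐ z ∂(ρ.prod cellMeasure), z.2 ∈ unitCell :=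
  Measure.quasiMeasurePreserving_snd.ae (ae_restrict_mem measurableSet_unitCell)

section Bounded

variable {ε : ℝ} {R : ℝ} {g : R3 → C3}

lemma memLp_floquetSeries (hε : 0 < ε) (hg : MemLp g 2 volume) (hR : trunc R g = g) (θ : R3) :
    MemLp (floquetSeries ε g θ) 2 cellMeasure := by
  obtain ⟨S, hS⟩ := exists_floquetTerm_eq_zero hε R
  have h1 : MemLp (fun y => floquetConst ε • ∑ n ∈ S, floquetTerm ε g n θ y) 2 cellMeasure :=
    (memLp_finsetSum S fun n _ => (memLp_floquetTerm hg hε n θ).restrict unitCell).const_smul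
      (floquetConst ε)
  refine (memLp_congr_ae ?_).1 h1
  filter_upwards [ae_restrict_mem measurableSet_unitCell] with y hy
  rw [floquetSeries_eq, tsum_eq_sum fun n hn => hS g hR θ y hy n hn]

lemma aestronglyMeasurable_floquetSeries (hε : 0 < ε) (hg : MemLp g 2 volume) (hR : trunc R g = g)
    (ρ : Measure R3) [SFinite ρ] :
    AEStronglyMeasurable (fun z : R3 × R3 => floquetSeries ε g z.1 z.2) (ρ.prod cellMeasure) := by
  obtain ⟨S, hS⟩ := exists_floquetTerm_eq_zero hε R
  have h1 : AEStronglyMeasurable (fun z : R3 × R3 => floquetConst ε • ∑ n ∈ S,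
      floquetTerm ε g n z.1 z.2) (ρ.prod cellMeasure) :=
    (Finset.aestronglyMeasurable_fun_sum S
      fun n _ => aestronglyMeasurable_floquetTerm hg hε n ρ).const_smul (floquetConst ε)
  refine h1.congr ?_
  filter_upwards [ae_cell_mem ρ] with z hz
  rw [floquetSeries_eq, tsum_eq_sum fun n hn => hS g hR z.1 z.2 hz n hn]

lemma integrable_of_trunc_eq (hg : MemLp g 2 volume) (hR : trunc R g = g) : Integrable g := by
  rw [← hR]
  exact integrable_trunc hg R

/-- The Fourier coefficients of the Floquet transform are values of the Fourier transform. -/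
lemma cellCoeff_floquetSeries (hε : 0 < ε) (hg : MemLp g 2 volume) (hR : trunc R g = g) (θ : R3)
    (m : Fin 3 → ℤ) :
    cellCoeff m (floquetSeries ε g θ) = fourierIntegral volume g (θ + ε⁻¹ • mode m) := by
  obtain ⟨S, hS⟩ := exists_floquetTerm_eq_zero hε R
  set F : R3 → C3 := fun x => (starRingEnd ℂ) (planeWave (θ + ε⁻¹ • mode m) x) • g x with hF
  have hFi : Integrable F :=
    (integrable_of_trunc_eq hg hR).bdd_smul 1
      (by fun_prop : Continuous fun x => (starRingEnd ℂ) (planeWave (θ + ε⁻¹ • mode m) x)).aestronglyMeasurable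
      (Eventually.of_forall fun x => by rw [RCLike.norm_conj, norm_planeWave])
  -- The wave `e_{2πm}` ignores integer shifts and `(2πm/ε)·(εy) = 2πm·y`, so the two exponentials
  -- merge into one of frequency `θ + 2πm/ε`. Summing over the cells then unfolds the coefficient to
  -- an integral over `ℝ³`.
  have hterm : ∀ n y, F (ε • (y + ivec n)) =
      (starRingEnd ℂ) (planeWave (mode m) y) • floquetTerm ε g n θ y := fun n y => by
    rw [hF, floquetTerm, smul_smul, ← map_mul]
    simp only
    rw [planeWave_add_left, planeWave_smul_left, inv_smul_smul₀ hε.ne', planeWave_add_right (mode m),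
      planeWave_mode_ivec, mul_one, mul_comm]
  have h1 := hasSum_integral_tiling (ν := volume) (v := ivec) measurableSet_unitCell
    isPeriodicMeasure_volume.map_add_ivec existsUnique_sub_ivec_mem_unitCell
    (hFi.comp_smul hε.ne')
  simp only [hterm] at h1
  have h2 : ∀ n ∉ S, ∫ y in unitCell, (starRingEnd ℂ) (planeWave (mode m) y) • floquetTerm ε g n θ y = 0 := by
    intro n hn
    refine integral_eq_zero_of_ae ?_
    filter_upwards [ae_restrict_mem measurableSet_unitCell] with y hy
    rw [hS g hR θ y hy n hn, smul_zero]
    rfl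
  have h3 := h1.unique (hasSum_sum_of_ne_finset_zero h2)
  have h4 : cellCoeff m (floquetSeries ε g θ) = floquetConst ε • ∑ n ∈ S,
      ∫ y in unitCell, (starRingEnd ℂ) (planeWave (mode m) y) • floquetTerm ε g n θ y := by
    rw [← integral_finsetSum S fun n _ =>
      integrable_cellCoeff ((memLp_floquetTerm hg hε n θ).restrict unitCell) m, ← integral_smul]
    refine integral_congr_ae ?_
    filter_upwards [ae_restrict_mem measurableSet_unitCell] with y hy
    rw [floquetSeries_eq, tsum_eq_sum fun n hn => hS g hR θ y hy n hn, smul_comm, Finset.smul_sum]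
  rw [h4, ← h3, Measure.integral_comp_smul, smul_smul, fourierIntegral, floquetConst_eq hε]
  congr 1
  simp only [finrank_euclideanSpace, Fintype.card_fin]
  rw [abs_of_pos (by positivity)]
  field_simp

/-- The Floquet transform is an isometry on functions with bounded support. -/
lemma eLpNorm_floquetSeries (hε : 0 < ε) (hg : MemLp g 2 volume) (hR : trunc R g = g) :
    eLpNorm (fun z : R3 × R3 => floquetSeries ε g z.1 z.2) 2
      ((volume.restrict (dualCell ε)).prod cellMeasure) = eLpNorm g 2 volume := by
  refine (ENNReal.pow_right_strictMono two_ne_zero).injective ?_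
  rw [eLpNorm_two_sq, lintegral_prod _ ((aestronglyMeasurable_floquetSeries hε hg hR _).enorm.pow_const 2)]
  -- Parseval on each fibre produces the values of the transform at `θ + 2πm/ε`. The translates of
  -- the dual cell cover frequency space once, and Plancherel concludes.
  simp only [← eLpNorm_two_sq, eLpNorm_sq_eq_tsum_cellCoeff (memLp_floquetSeries hε hg hR _),
    cellCoeff_floquetSeries hε hg hR]
  have hft := ft_eq_fourierIntegral hg (integrable_of_trunc_eq hg hR)
  rw [← lintegral_dualCell_tiling hε (fun ξ => ‖fourierIntegral volume g ξ‖ₑ ^ 2)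
    (((memLp_ft hg).1.congr hft).enorm.pow_const 2), ← eLpNorm_two_sq, ← eLpNorm_congr_ae hft,
    eLpNorm_ft hg]

lemma floquetSeries_sub (hε : 0 < ε) {g' : R3 → C3} (hR : trunc R g = g) (hR' : trunc R g' = g')
    (θ : R3) {y : R3} (hy : y ∈ unitCell) :
    floquetSeries ε (fun x => g x - g' x) θ y = floquetSeries ε g θ y - floquetSeries ε g' θ y := by
  obtain ⟨S, hS⟩ := exists_floquetTerm_eq_zero hε R
  have hsub : trunc R (fun x => g x - g' x) = fun x => g x - g' x := by
    conv_rhs => rw [← hR, ← hR']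
    exact Set.indicator_sub _ _ _
  rw [floquetSeries_eq, floquetSeries_eq, floquetSeries_eq, ← smul_sub,
    tsum_eq_sum fun n hn => hS _ hR θ y hy n hn, tsum_eq_sum fun n hn => hS _ hR' θ y hy n hn,
    tsum_eq_sum fun n hn => hS _ hsub θ y hy n hn, ← Finset.sum_sub_distrib]
  congr 1
  refine Finset.sum_congr rfl fun n _ => ?_
  rw [floquetTerm, floquetTerm, floquetTerm, smul_sub]

end Bounded

lemma rmul_real_smul (M : Matrix (Fin 3) (Fin 3) ℝ) (t : ℝ) (v : C3) :
    rmul M (t • v) = t • rmul M v := by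
  rw [← Complex.coe_smul, rmul_smul, Complex.coe_smul]

lemma rmul_sum {ι : Type*} (M : Matrix (Fin 3) (Fin 3) ℝ) (s : Finset ι) (f : ι → C3) :
    rmul M (∑ n ∈ s, f n) = ∑ n ∈ s, rmul M (f n) := by
  classical
  induction s using Finset.induction_on with
  | empty => simp [rmul_zero]
  | insert a s ha ih => rw [Finset.sum_insert ha, Finset.sum_insert ha, rmul_add, ih]

lemma trunc_trunc {R R' : ℝ} (h : R ≤ R') (g : R3 → C3) : trunc R' (trunc R g) = trunc R g := by
  rw [trunc, trunc, Set.indicator_indicator, Set.inter_eq_self_of_subset_right (Metric.ball_subset_ball h)]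

/-- The product of the Lebesgue measures on the rescaled dual cell and the unit cell. -/
noncomputable abbrev floquetMeasure (ε : ℝ) : Measure (R3 × R3) :=
  (volume.restrict (dualCell ε)).prod cellMeasure

section

variable {ε : ℝ} {g : R3 → C3}

lemma memLp_floquetSeries_trunc (hε : 0 < ε) (hg : MemLp g 2 volume) (R : ℝ) :
    MemLp (fun z : R3 × R3 => floquetSeries ε (trunc R g) z.1 z.2) 2 (floquetMeasure ε) :=
  ⟨aestronglyMeasurable_floquetSeries hε (memLp_trunc hg R) (trunc_trunc le_rfl g) _, by
    rw [eLpNorm_floquetSeries hε (memLp_trunc hg R) (trunc_trunc le_rfl g)]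
    exact (memLp_trunc hg R).2⟩

lemma eLpNorm_floquetSeries_trunc_sub (hε : 0 < ε) (hg : MemLp g 2 volume) (R R' : ℝ) :
    eLpNorm (fun z : R3 × R3 => floquetSeries ε (trunc R g) z.1 z.2 -
      floquetSeries ε (trunc R' g) z.1 z.2) 2 (floquetMeasure ε) =
      eLpNorm (fun x => trunc R g x - trunc R' g x) 2 volume := by
  have h1 := trunc_trunc (le_max_left R R') g
  have h2 := trunc_trunc (le_max_right R R') g
  have hsub : trunc (max R R') (fun x => trunc R g x - trunc R' g x) =
      fun x => trunc R g x - trunc R' g x := by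
    conv_rhs => rw [← h1, ← h2]
    exact Set.indicator_sub _ _ _
  have hm : MemLp (fun x => trunc R g x - trunc R' g x) 2 volume :=
    (memLp_trunc hg R).sub (memLp_trunc hg R')
  rw [← eLpNorm_floquetSeries hε hm hsub]
  refine eLpNorm_congr_ae ?_
  filter_upwards [ae_cell_mem (volume.restrict (dualCell ε))] with z hz
  exact (floquetSeries_sub hε h1 h2 z.1 hz).symm

lemma tendsto_toLp_trunc (hg : MemLp g 2 volume) :
    Tendsto (fun R : ℝ => (memLp_trunc hg R).toLp) atTop (𝓝 hg.toLp) := by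
  rw [Lp.tendsto_Lp_iff_tendsto_eLpNorm'']
  exact tendsto_eLpNorm_trunc_sub hg

/-- The Floquet transform exists. -/
lemma exists_isFloquetTransform (hε : 0 < ε) (hg : MemLp g 2 volume) :
    ∃ G, IsFloquetTransform volume ε g G := by
  -- The truncations of `g` converge in `L²`, so by isometry their Floquet transforms form a Cauchy
  -- family.
  have hdist : ∀ R R' : ℝ, dist (memLp_floquetSeries_trunc hε hg R).toLp
      (memLp_floquetSeries_trunc hε hg R').toLp = dist (memLp_trunc hg R).toLp (memLp_trunc hg R').toLp := by
    intro R R'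
    rw [dist_eq_norm, dist_eq_norm, ← MemLp.toLp_sub, ← MemLp.toLp_sub, Lp.norm_toLp, Lp.norm_toLp]
    congr 1
    exact eLpNorm_floquetSeries_trunc_sub hε hg R R'
  have hc : CauchySeq fun R : ℝ => (memLp_floquetSeries_trunc hε hg R).toLp := by
    have := (tendsto_toLp_trunc hg).cauchySeq
    rw [Metric.cauchySeq_iff] at this ⊢
    simpa only [hdist] using this
  obtain ⟨u, hu⟩ := cauchySeq_tendsto_of_complete hc
  have hum : MemLp (fun z : R3 × R3 => u (z.1, z.2)) 2 (floquetMeasure ε) := Lp.memLp u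
  refine ⟨fun θ y => u (θ, y), hum, ?_⟩
  have h2 : hum.toLp = u := Lp.ext hum.coeFn_toLp
  rw [← h2, Lp.tendsto_Lp_iff_tendsto_eLpNorm''] at hu
  exact hu

lemma eLpNorm_prod_sq {ρ τ : Measure R3} [SFinite ρ] [SFinite τ] {E : Type*} [NormedAddCommGroup E]
    {F : R3 × R3 → E} (hF : AEStronglyMeasurable F (ρ.prod τ)) :
    eLpNorm F 2 (ρ.prod τ) ^ 2 = ∫⁻ θ, eLpNorm (fun y => F (θ, y)) 2 τ ^ 2 ∂ρ := by
  rw [eLpNorm_two_sq, lintegral_prod _ (hF.enorm.pow_const 2)]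
  simp only [eLpNorm_two_sq]

lemma ae_memLp_of_memLp_prod {ρ τ : Measure R3} [SFinite ρ] [SFinite τ] {E : Type*}
    [NormedAddCommGroup E] {F : R3 × R3 → E} (hF : MemLp F 2 (ρ.prod τ)) :
    ∀ᵐ θ ∂ρ, MemLp (fun y => F (θ, y)) 2 τ := by
  have h1 : ∫⁻ θ, eLpNorm (fun y => F (θ, y)) 2 τ ^ 2 ∂ρ ≠ ⊤ := by
    rw [← eLpNorm_prod_sq hF.1]
    exact (ENNReal.pow_lt_top hF.2).ne
  have h2 : AEMeasurable (fun θ => eLpNorm (fun y => F (θ, y)) 2 τ ^ 2) ρ := by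
    simp only [eLpNorm_two_sq]
    exact (hF.1.enorm.pow_const 2).lintegral_prod_right'
  filter_upwards [hF.1.prodMk_left, ae_lt_top' h2 h1] with θ h3 h4
  exact ⟨h3, ((ENNReal.pow_lt_top_iff (n := 2)).1 h4).resolve_right two_ne_zero⟩

/-- The Fourier coefficients of the Floquet transform of a square integrable function. -/
lemma IsFloquetTransform.ae_cellCoeff {G : R3 → R3 → C3} (hG : IsFloquetTransform volume ε g G)
    (hε : 0 < ε) (hg : MemLp g 2 volume) :
    ∀ᵐ θ ∂(volume.restrict (dualCell ε)), ∀ m, cellCoeff m (G θ) = ft g (θ + ε⁻¹ • mode m) := by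
  refine ae_all_iff.2 fun m => ?_
  have hmp := measurePreserving_add_right (volume : Measure R3) (ε⁻¹ • mode m)
  have hmeas : AEStronglyMeasurable (fun θ => cellCoeff m (G θ)) (volume.restrict (dualCell ε)) := by
    refine AEStronglyMeasurable.integral_prod_right' (f := fun z : R3 × R3 =>
      (starRingEnd ℂ) (planeWave (mode m) z.2) • G z.1 z.2) ?_
    exact AEStronglyMeasurable.smul (f := fun z : R3 × R3 => (starRingEnd ℂ) (planeWave (mode m) z.2))
      (by fun_prop : Continuous _).aestronglyMeasurable hG.mem.1
  have hft : MemLp (fun θ => ft g (θ + ε⁻¹ • mode m)) 2 (volume.restrict (dualCell ε)) :=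
    ((memLp_ft hg).comp_measurePreserving hmp).restrict _
  have hzero : eLpNorm (fun θ => cellCoeff m (G θ) - ft g (θ + ε⁻¹ • mode m)) 2
      (volume.restrict (dualCell ε)) = 0 := by
    -- Compare through the truncation, for which the identity is exact. A single coefficient is
    -- bounded by the norm on the fibre, which handles one error; Plancherel handles the other. Both
    -- tend to zero with `R → ∞`, while the left side does not depend on `R`.
    have hle : ∀ R : ℝ, eLpNorm (fun θ => cellCoeff m (G θ) - ft g (θ + ε⁻¹ • mode m)) 2
        (volume.restrict (dualCell ε)) ≤
        eLpNorm (fun z : R3 × R3 => floquetSeries ε (trunc R g) z.1 z.2 - G z.1 z.2) 2 (floquetMeasure ε)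
          + eLpNorm (fun x => trunc R g x - g x) 2 volume := by
      intro R
      have hs := memLp_floquetSeries_trunc hε hg R
      have hfi : AEStronglyMeasurable (fun θ => ft (trunc R g) (θ + ε⁻¹ • mode m))
          (volume.restrict (dualCell ε)) :=
        (((memLp_ft (memLp_trunc hg R)).comp_measurePreserving hmp).restrict _).1
      have hft' := ft_eq_fourierIntegral (memLp_trunc hg R) (integrable_trunc hg R)
      have hae := ae_restrict_of_ae (s := dualCell ε) (hmp.quasiMeasurePreserving.ae hft')
      have e1 : (fun θ => cellCoeff m (G θ) - ft g (θ + ε⁻¹ • mode m)) =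
          (fun θ => cellCoeff m (G θ) - ft (trunc R g) (θ + ε⁻¹ • mode m)) +
          fun θ => ft (trunc R g) (θ + ε⁻¹ • mode m) - ft g (θ + ε⁻¹ • mode m) := by
        ext1 θ; simp
      rw [e1]
      refine (eLpNorm_add_le (hmeas.sub hfi) (hfi.sub hft.1) one_le_two).trans ?_
      gcongr
      · refine (ENNReal.pow_right_strictMono two_ne_zero).le_iff_le.1 ?_
        have hsG : AEStronglyMeasurable (fun z : R3 × R3 =>
            floquetSeries ε (trunc R g) z.1 z.2 - G z.1 z.2) (floquetMeasure ε) := hs.1.sub hG.mem.1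
        rw [eLpNorm_prod_sq hsG, eLpNorm_two_sq]
        refine lintegral_mono_ae ?_
        filter_upwards [ae_memLp_of_memLp_prod hs, ae_memLp_of_memLp_prod hG.mem, hae] with θ h1 h2 h3
        have h3' : ft (trunc R g) (θ + ε⁻¹ • mode m) =
            fourierIntegral volume (trunc R g) (θ + ε⁻¹ • mode m) := h3
        rw [Pi.sub_apply, h3', ← cellCoeff_floquetSeries hε (memLp_trunc hg R) (trunc_trunc le_rfl g) θ m,
          ← cellCoeff_sub h2 h1,
          show eLpNorm (fun y => floquetSeries ε (trunc R g) θ y - G θ y) 2 cellMeasure =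
            eLpNorm (fun y => G θ y - floquetSeries ε (trunc R g) θ y) 2 cellMeasure from
            eLpNorm_sub_comm _ _ _ _]
        exact enorm_cellCoeff_le (h2.sub h1) m
      · refine (eLpNorm_mono_measure _ Measure.restrict_le_self).trans ?_
        have hsub : MemLp (fun x => trunc R g x - g x) 2 volume := (memLp_trunc hg R).sub hg
        rw [← eLpNorm_ft hsub, ← eLpNorm_congr_ae (ft_sub (memLp_trunc hg R) hg).symm]
        exact (eLpNorm_comp_measurePreserving ((memLp_ft (memLp_trunc hg R)).sub (memLp_ft hg)).1 hmp).le
    have hlim := hG.lim.add (tendsto_eLpNorm_trunc_sub hg)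
    rw [add_zero] at hlim
    exact le_antisymm (ge_of_tendsto' hlim hle) zero_le
  have hsub : AEStronglyMeasurable (fun θ => cellCoeff m (G θ) - ft g (θ + ε⁻¹ • mode m))
    (volume.restrict (dualCell ε)) := hmeas.sub hft.1
  rw [eLpNorm_eq_zero_iff hsub two_ne_zero] at hzero
  filter_upwards [hzero] with θ h
  exact sub_eq_zero.1 h

/-- The Floquet transform commutes with multiplication by periodic matrices. -/
lemma IsFloquetTransform.rmul {G : R3 → R3 → C3} (hG : IsFloquetTransform volume ε g G)
    (hε : 0 < ε) {M : R3 → Matrix (Fin 3) (Fin 3) ℝ} (hM : Continuous M) (hp : IsPeriodic M) {C : ℝ}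
    (hC : ∀ x v, ‖rmul (M x) v‖ ≤ C * ‖v‖) :
    IsFloquetTransform volume ε (fun x => MaxwellHom.rmul (M (ε⁻¹ • x)) (g x))
      (fun θ y => MaxwellHom.rmul (M y) (G θ y)) := by
  have hmeas : ∀ {F : R3 × R3 → C3}, AEStronglyMeasurable F (floquetMeasure ε) →
      AEStronglyMeasurable (fun z => MaxwellHom.rmul (M z.2) (F z)) (floquetMeasure ε) := fun {F} hF =>
    (continuous_rmul (hM.comp continuous_snd)).comp_aestronglyMeasurable
      (f := fun z : R3 × R3 => (z, F z)) (aestronglyMeasurable_id.prodMk hF)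
  refine ⟨MemLp.of_le_mul hG.mem (hmeas hG.mem.1) (Eventually.of_forall fun z => hC _ _), ?_⟩
  have hlim := ENNReal.Tendsto.const_mul (a := ENNReal.ofReal C) hG.lim (Or.inr ENNReal.ofReal_ne_top)
  rw [mul_zero] at hlim
  refine tendsto_of_tendsto_of_tendsto_of_le_of_le tendsto_const_nhds hlim (fun _ => zero_le)
    fun R => ?_
  refine eLpNorm_le_mul_eLpNorm_of_ae_le_mul ?_ 2
  obtain ⟨S, hS⟩ := exists_floquetTerm_eq_zero hε R
  filter_upwards [ae_cell_mem (volume.restrict (dualCell ε))] with z hz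
  have h1 : floquetSeries ε (trunc R fun x => MaxwellHom.rmul (M (ε⁻¹ • x)) (g x)) z.1 z.2 =
      MaxwellHom.rmul (M z.2) (floquetSeries ε (trunc R g) z.1 z.2) := by
    -- At the points `ε (y + n)` the oscillating matrix takes the value `M (y + n) = M y`, the same
    -- for all terms of the series.
    have hterm : ∀ n, floquetTerm ε (trunc R fun x => MaxwellHom.rmul (M (ε⁻¹ • x)) (g x)) n z.1 z.2 =
        MaxwellHom.rmul (M z.2) (floquetTerm ε (trunc R g) n z.1 z.2) := fun n => by
      rw [floquetTerm, floquetTerm, rmul_smul]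
      congr 1
      by_cases hmem : ε • (z.2 + ivec n) ∈ Metric.ball (0 : R3) R
      · rw [trunc, trunc, Set.indicator_of_mem hmem, Set.indicator_of_mem hmem,
          inv_smul_smul₀ hε.ne', hp.add_ivec]
      · rw [trunc, trunc, Set.indicator_of_notMem hmem, Set.indicator_of_notMem hmem, rmul_zero]
    rw [floquetSeries_eq, floquetSeries_eq,
      tsum_eq_sum fun n hn => hS _ (trunc_trunc le_rfl _) z.1 z.2 hz n hn,
      tsum_eq_sum fun n hn => hS _ (trunc_trunc le_rfl _) z.1 z.2 hz n hn,
      rmul_real_smul, rmul_sum, Finset.sum_congr rfl fun n _ => hterm n]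
  rw [h1, ← rmul_sub]
  exact hC _ _

end

lemma scaledMeasure_volume {ε : ℝ} (hε : 0 < ε) : scaledMeasure volume ε = volume := by
  rw [scaledMeasure, Measure.map_addHaar_smul _ hε.ne', finrank_euclideanSpace, Fintype.card_fin,
    smul_smul, ← ENNReal.ofReal_mul (by positivity), abs_of_pos (by positivity),
    mul_inv_cancel₀ (by positivity), ENNReal.ofReal_one, one_smul]

/-! ### Extending weak equations to square integrable test functions -/

lemma grad_mul {f g : R3 → ℂ} {x : R3} (hf : DifferentiableAt ℝ f x) (hg : DifferentiableAt ℝ g x) :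
    grad (fun y => f y * g y) x = f x • grad g x + g x • grad f x := by
  ext j
  simp [grad, pderiv_mul hf hg]

lemma continuous_grad {f : R3 → ℂ} (hf : ContDiff ℝ ∞ f) : Continuous (grad f) := by
  have h := hf.continuous_fderiv (by simp)
  exact (PiLp.continuous_toLp 2 _).comp (continuous_pi fun j => h.clm_apply continuous_const)

lemma grad_congr {f g : R3 → ℂ} {x : R3} (h : f =ᶠ[𝓝 x] g) : grad f x = grad g x := by
  ext j
  simp only [grad, pderiv]
  rw [h.fderiv_eq]

lemma grad_comp_smul (f : R3 → ℂ) (t : ℝ) (x : R3) :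
    grad (fun y => f (t • y)) x = t • grad f (t • x) := by
  ext j
  simp [grad, pderiv, fderiv_comp_smul]

lemma hasCompactSupport_grad {f : R3 → ℂ} (hf : HasCompactSupport f) :
    HasCompactSupport (grad f) := by
  refine (hf.fderiv (𝕜 := ℝ)).mono fun x hx => ?_
  contrapose! hx
  rw [Function.notMem_support] at hx ⊢
  ext j
  simp [grad, pderiv, hx]

/-- Smooth cutoff functions equal to one on large balls, with uniformly bounded gradients. -/
lemma exists_cutoff : ∃ (χ : ℕ → R3 → ℂ) (C : ℝ), ∀ n, ContDiff ℝ ∞ (χ n) ∧ HasCompactSupport (χ n) ∧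
    (∀ x, ‖χ n x‖ ≤ 1) ∧ (∀ x, ‖grad (χ n) x‖ ≤ C) ∧ ∀ x ∈ Metric.ball (0 : R3) (n + 1), χ n x = 1 := by
  let b : ContDiffBump (0 : R3) := ⟨1, 2, one_pos, one_lt_two⟩
  have hb : ContDiff ℝ ∞ fun x => (b x : ℂ) := Complex.ofRealCLM.contDiff.comp b.contDiff
  have hbc : HasCompactSupport fun x => (b x : ℂ) :=
    b.hasCompactSupport.comp_left (g := fun t : ℝ => (t : ℂ)) Complex.ofReal_zero
  obtain ⟨C, hC⟩ := (continuous_grad hb).bounded_above_of_compact_support (hasCompactSupport_grad hbc)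
  refine ⟨fun n x => (b (((n : ℝ) + 1)⁻¹ • x) : ℂ), C, fun n => ⟨?_, ?_, fun x => ?_, fun x => ?_,
    fun x hx => ?_⟩⟩
  · exact hb.comp (contDiff_const_smul (((n : ℝ) + 1)⁻¹))
  · exact hbc.comp_smul (by positivity)
  · rw [Complex.norm_real, Real.norm_of_nonneg b.nonneg]
    exact b.le_one
  · rw [grad_comp_smul fun x => (b x : ℂ), norm_smul, Real.norm_of_nonneg (by positivity)]
    have h1 : ((n : ℝ) + 1)⁻¹ ≤ 1 := inv_le_one_of_one_le₀ (by linarith [n.cast_nonneg (α := ℝ)])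
    calc _ ≤ 1 * C := by
          gcongr
          exact hC _
      _ = C := one_mul C
  · have : b (((n : ℝ) + 1)⁻¹ • x) = 1 := by
      refine b.one_of_mem_closedBall ?_
      rw [mem_closedBall_zero_iff, norm_smul, Real.norm_of_nonneg (by positivity),
        inv_mul_le_iff₀ (by positivity)]
      simpa [b] using (mem_ball_zero_iff.1 hx).le
    exact (congrArg _ this).trans Complex.ofReal_one

/-- Multiply by the cutoffs and pass to the limit by dominated convergence. The extension is needed
because the test functions used on the Fourier side are inverse transforms of compactly supported
functions, which need not have compact support. -/
lemma weak_of_hasCompactSupport {L : C3 →L[ℂ] C3} {b : C3} {w k : R3 → C3}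
    (hw : MemLp w 2 volume) (hk : MemLp k 2 volume)
    (h : ∀ φ : R3 → ℂ, ContDiff ℝ ∞ φ → HasCompactSupport φ →
      (∫ x, inner ℂ (L (grad φ x)) (w x)) + ∫ x, inner ℂ (φ x • b) (k x) = 0)
    {φ : R3 → ℂ} (hφ : ContDiff ℝ ∞ φ) (hφ2 : MemLp φ 2 volume) (hgφ : MemLp (grad φ) 2 volume) :
    (∫ x, inner ℂ (L (grad φ x)) (w x)) + ∫ x, inner ℂ (φ x • b) (k x) = 0 := by
  obtain ⟨χ, C, hχ⟩ := exists_cutoff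
  have hev : ∀ x : R3, ∀ᶠ n in atTop, (fun y => χ n y * φ y) =ᶠ[𝓝 x] φ := fun x => by
    filter_upwards [eventually_gt_atTop ⌈‖x‖⌉₊] with n hn
    have hx : x ∈ Metric.ball (0 : R3) (n + 1) := by
      rw [mem_ball_zero_iff]
      have := Nat.lt_of_ceil_lt hn
      linarith
    filter_upwards [Metric.isOpen_ball.mem_nhds hx] with y hy
    rw [(hχ n).2.2.2.2 y hy, one_mul]
  have hsm : ∀ n, ContDiff ℝ ∞ fun y => χ n y * φ y := fun n => (hχ n).1.mul hφ
  have hbound : ∀ n x, ‖grad (fun y => χ n y * φ y) x‖ ≤ ‖grad φ x‖ + C * ‖φ x‖ := fun n x => by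
    rw [grad_mul ((hχ n).1.differentiable (by simp) x) (hφ.differentiable (by simp) x)]
    refine (norm_add_le _ _).trans ?_
    rw [norm_smul, norm_smul, mul_comm C]
    gcongr
    · exact mul_le_of_le_one_left (norm_nonneg _) ((hχ n).2.2.1 x)
    · exact (hχ n).2.2.2.1 x
  have hlim1 : Tendsto (fun n => ∫ x, inner ℂ (L (grad (fun y => χ n y * φ y) x)) (w x)) atTop
      (𝓝 (∫ x, inner ℂ (L (grad φ x)) (w x))) := by
    refine tendsto_integral_of_dominated_convergence
      (fun x => ‖L‖ * ((‖grad φ x‖ + C * ‖φ x‖) * ‖w x‖)) (fun n => ?_) ?_ (fun n => ?_) ?_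
    · exact ((L.continuous.comp (continuous_grad (hsm n))).aestronglyMeasurable).inner hw.1
    · have hs : MemLp (fun x => ‖grad φ x‖ + C * ‖φ x‖) 2 volume := hgφ.norm.add (hφ2.norm.const_mul C)
      exact (hs.integrable_mul hw.norm).const_mul _
    · refine Eventually.of_forall fun x => (norm_inner_le_norm _ _).trans ?_
      rw [← mul_assoc]
      gcongr
      exact (L.le_opNorm _).trans (by gcongr; exact hbound n x)
    · refine Eventually.of_forall fun x => tendsto_const_nhds.congr' ?_
      filter_upwards [hev x] with n hn
      rw [grad_congr hn]
  have hlim2 : Tendsto (fun n => ∫ x, inner ℂ ((χ n x * φ x) • b) (k x)) atTop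
      (𝓝 (∫ x, inner ℂ (φ x • b) (k x))) := by
    refine tendsto_integral_of_dominated_convergence
      (fun x => ‖b‖ * (‖φ x‖ * ‖k x‖)) (fun n => ?_) ?_ (fun n => ?_) ?_
    · exact ((hsm n).continuous.smul continuous_const).aestronglyMeasurable.inner hk.1
    · exact (hφ2.norm.integrable_mul hk.norm).const_mul _
    · refine Eventually.of_forall fun x => (norm_inner_le_norm _ _).trans ?_
      rw [← mul_assoc, mul_comm ‖b‖, norm_smul, norm_mul]
      gcongr
      exact mul_le_of_le_one_left (norm_nonneg _) ((hχ n).2.2.1 x)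
    · refine Eventually.of_forall fun x => tendsto_const_nhds.congr' ?_
      filter_upwards [hev x] with n hn
      have : χ n x * φ x = φ x := hn.self_of_nhds
      rw [this]
  have hz : ∀ n, (∫ x, inner ℂ (L (grad (fun y => χ n y * φ y) x)) (w x)) +
      ∫ x, inner ℂ ((χ n x * φ x) • b) (k x) = 0 := fun n =>
    h _ (hsm n) ((hχ n).2.1.mul_right)
  exact (tendsto_nhds_unique tendsto_const_nhds ((hlim1.add hlim2).congr hz)).symm

/-! ### Weak equations on the Fourier side -/

/-- The inverse Fourier transform of a compactly supported function. -/
noncomputable def scalarIft (k : R3 → ℂ) (x : R3) : ℂ := fourierConst * ∫ θ, planeWave θ x * k θ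

lemma contDiff_scalarIft {k : R3 → ℂ} (hk : Continuous k) (hc : HasCompactSupport k) :
    ContDiff ℝ ∞ (scalarIft k) := by
  have h1 : ContDiff ℝ ∞ (FourierTransform.fourier k : R3 → ℂ) := by
    refine Real.contDiff_fourier (N := ⊤) fun n _ => ?_
    exact ((continuous_norm.pow n).mul hk.norm).integrable_of_hasCompactSupport (hc.norm.mul_left)
  have h2 : scalarIft k = fun x => (fourierConst : ℂ) *
      (FourierTransform.fourier k : R3 → ℂ) (-(2 * Real.pi)⁻¹ • x) := by
    ext1 x
    rw [scalarIft, Real.fourier_eq']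
    congr 2
    ext1 θ
    rw [planeWave, inner_smul_right, smul_eq_mul]
    congr 2
    push_cast
    field_simp
  rw [h2]
  exact contDiff_const.mul (h1.comp (contDiff_const_smul _))

lemma exists_support_subset_ball {k : R3 → ℂ} (hc : HasCompactSupport k) :
    ∃ R, ∀ θ ∉ Metric.ball (0 : R3) R, k θ = 0 := by
  obtain ⟨R, hR⟩ := hc.isCompact.isBounded.subset_ball (0 : R3)
  exact ⟨R, fun θ hθ => image_eq_zero_of_notMem_tsupport fun h => hθ (hR h)⟩

lemma pderiv_scalarIft {k : R3 → ℂ} (hk : Continuous k) (hc : HasCompactSupport k) (j : Fin 3) (x : R3) :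
    pderiv j (scalarIft k) x = fourierConst * ∫ θ : R3, planeWave θ x * (k θ * (Complex.I * θ j)) := by
  obtain ⟨R, hR⟩ := exists_support_subset_ball hc
  have h1 : scalarIft k = fun y => (fourierConst : ℂ) *
      ∫ θ in Metric.ball 0 R, planeWave θ y * k θ := by
    ext1 y
    rw [scalarIft, setIntegral_eq_integral_of_forall_compl_eq_zero fun θ hθ => by rw [hR θ hθ, mul_zero]]
  rw [h1, pderiv_const_mul_integral_planeWave (hk.integrable_of_hasCompactSupport hc).integrableOn,
    setIntegral_eq_integral_of_forall_compl_eq_zero fun θ hθ => by rw [hR θ hθ, mul_zero, mul_zero]]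
  congr 2
  ext1 θ
  ring

lemma memLp_smul_of_hasCompactSupport {k : R3 → ℂ} (hk : Continuous k) (hc : HasCompactSupport k)
    {v : R3 → C3} (hv : Continuous v) : MemLp (fun θ => k θ • v θ) 2 volume ∧
      Integrable fun θ => k θ • v θ :=
  ⟨(hk.smul hv).memLp_of_hasCompactSupport hc.smul_right,
    (hk.smul hv).integrable_of_hasCompactSupport hc.smul_right⟩

lemma continuous_cvec : Continuous cvec :=
  (PiLp.continuous_toLp 2 _).comp
    (continuous_pi fun i => Complex.continuous_ofReal.comp (PiLp.continuous_apply 2 _ i))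

lemma continuous_I_smul_cvec : Continuous fun θ : R3 => Complex.I • cvec θ :=
  (continuous_const_smul Complex.I).comp continuous_cvec

lemma integrable_inner_C3 {X : Type*} [MeasurableSpace X] {ν : Measure X} {f g : X → C3}
    (hf : MemLp f 2 ν) (hg : MemLp g 2 ν) : Integrable (fun x => inner ℂ (f x) (g x)) ν :=
  (hf.norm.integrable_mul hg.norm).mono (hf.1.inner hg.1) (Eventually.of_forall fun x => by
    rw [Pi.mul_apply, norm_mul, norm_norm, norm_norm]
    exact norm_inner_le_norm _ _)

lemma integral_inner_congr_left {f f' : R3 → C3} (h : f =ᵐ[volume] f') (g : R3 → C3) :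
    ∫ x, inner ℂ (f x) (g x) = ∫ x, inner ℂ (f' x) (g x) :=
  integral_congr_ae (h.mono fun x hx => by simp only [hx])

lemma ift_clm_ae_eq {h : R3 → C3} (h2 : MemLp h 2 volume) (hi : Integrable h) (L : C3 →L[ℂ] C3) :
    (fun x => L (ift h x)) =ᵐ[volume] ift fun θ => L (h θ) := by
  filter_upwards [ift_eq_integral h2 hi, ift_eq_integral (L.comp_memLp' h2) (L.integrable_comp hi)]
    with x h1 h3
  have hi' : Integrable fun θ => planeWave θ x • h θ :=
    hi.bdd_smul 1 (by fun_prop : Continuous fun θ => planeWave θ x).aestronglyMeasurable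
      (Eventually.of_forall fun θ => (norm_planeWave θ x).le)
  change ift (fun θ => L (h θ)) x = _ at h3
  rw [h1, h3, ← Complex.coe_smul, ← Complex.coe_smul, map_smul, ← L.integral_comp_comm hi']
  simp only [map_smul]
  rfl

lemma grad_scalarIft_ae_eq {k : R3 → ℂ} (hk : Continuous k) (hc : HasCompactSupport k) :
    grad (scalarIft k) =ᵐ[volume] ift fun θ => k θ • Complex.I • cvec θ := by
  have hv : Continuous fun θ : R3 => Complex.I • cvec θ := continuous_I_smul_cvec
  obtain ⟨h2, hi⟩ := memLp_smul_of_hasCompactSupport hk hc hv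
  refine EventuallyEq.trans (Eventually.of_forall fun x => ?_) (ift_eq_integral h2 hi).symm
  ext j
  have hi' : Integrable fun θ => planeWave θ x • (k θ • Complex.I • cvec θ) :=
    hi.bdd_smul 1 (by fun_prop : Continuous fun θ => planeWave θ x).aestronglyMeasurable
      (Eventually.of_forall fun θ => (norm_planeWave θ x).le)
  simp only [grad, PiLp.smul_apply]
  rw [pderiv_scalarIft hk hc, integral_apply_C3 hi', Complex.real_smul]
  rfl

lemma scalarIft_smul_ae_eq {k : R3 → ℂ} (hk : Continuous k) (hc : HasCompactSupport k) (b : C3) :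
    (fun x => scalarIft k x • b) =ᵐ[volume] ift fun θ => k θ • b := by
  obtain ⟨h2, hi⟩ := memLp_smul_of_hasCompactSupport hk hc (continuous_const (y := b))
  refine EventuallyEq.trans (Eventually.of_forall fun x => ?_) (ift_eq_integral h2 hi).symm
  have h3 : ∫ θ, planeWave θ x • k θ • b = (∫ θ, planeWave θ x * k θ) • b := by
    rw [← integral_smul_const]
    simp only [smul_smul]
  simp only [scalarIft]
  rw [h3, mul_smul, Complex.coe_smul]

/-- A weak first order equation in `L²` becomes a pointwise equation between Fourier transforms. -/
lemma ae_inner_ft_of_weak {L : C3 →L[ℂ] C3} {b : C3} {w k : R3 → C3}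
    (hw : MemLp w 2 volume) (hk : MemLp k 2 volume)
    (h : ∀ φ : R3 → ℂ, ContDiff ℝ ∞ φ → HasCompactSupport φ →
      (∫ x, inner ℂ (L (grad φ x)) (w x)) + ∫ x, inner ℂ (φ x • b) (k x) = 0) :
    ∀ᵐ ξ : R3, inner ℂ (L (Complex.I • cvec ξ)) (ft w ξ) + inner ℂ b (ft k ξ) = 0 := by
  have hLc : Continuous fun ξ : R3 => L (Complex.I • cvec ξ) :=
    L.continuous.comp continuous_I_smul_cvec
  refine ae_eq_zero_of_integral_contDiff_smul_eq_zero ?_ fun ψ hψ hψc => ?_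
  · refine LocallyIntegrable.add ?_ ?_
    · have hwl := (memLp_ft hw).norm.locallyIntegrable one_le_two
      refine LocallyIntegrable.mono
        (hwl.continuous_smul (g := fun ξ => ‖L (Complex.I • cvec ξ)‖) hLc.norm)
        (hLc.aestronglyMeasurable.inner (memLp_ft hw).1) (Eventually.of_forall fun ξ => ?_)
      rw [smul_eq_mul, norm_mul, norm_norm, norm_norm]
      exact norm_inner_le_norm _ _
    · have hkl := (memLp_ft hk).norm.locallyIntegrable one_le_two
      refine LocallyIntegrable.mono (hkl.smul ‖b‖)
        (aestronglyMeasurable_const.inner (memLp_ft hk).1) (Eventually.of_forall fun ξ => ?_)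
      rw [Pi.smul_apply, smul_eq_mul, norm_mul, norm_norm, norm_norm]
      exact norm_inner_le_norm _ _
  · have hkc : Continuous fun θ => (ψ θ : ℂ) := Complex.continuous_ofReal.comp hψ.continuous
    have hks : HasCompactSupport fun θ => (ψ θ : ℂ) :=
      hψc.comp_left (g := fun t : ℝ => (t : ℂ)) Complex.ofReal_zero
    obtain ⟨hb2, -⟩ := memLp_smul_of_hasCompactSupport hkc hks (continuous_const (y := b))
    obtain ⟨hv2, hvi⟩ := memLp_smul_of_hasCompactSupport hkc hks
      continuous_I_smul_cvec
    have hgr := grad_scalarIft_ae_eq hkc hks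
    have hLv : MemLp (fun θ : R3 => (ψ θ : ℂ) • L (Complex.I • cvec θ)) 2 volume :=
      (memLp_smul_of_hasCompactSupport hkc hks hLc).1
    have hφ2 : MemLp (fun x => scalarIft (fun θ => (ψ θ : ℂ)) x) 2 volume := by
      obtain ⟨hs, -⟩ := memLp_smul_of_hasCompactSupport hkc hks
        (continuous_const (y := (EuclideanSpace.single 0 1 : C3)))
      refine MemLp.ae_eq ?_ (memLp_apply_C3 (memLp_ift hs) 0)
      filter_upwards [scalarIft_smul_ae_eq hkc hks (EuclideanSpace.single 0 1)] with x hx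
      rw [← hx]
      simp
    -- Testing with the inverse transform of `ψ` and applying Plancherel turns the weak equation
    -- into the vanishing of the integral of `ψ` against the pointwise expression.
    have hweak := weak_of_hasCompactSupport hw hk h (contDiff_scalarIft hkc hks) hφ2
      ((memLp_ift hv2).ae_eq hgr.symm)
    have hLift : (fun x => L (grad (scalarIft fun θ => (ψ θ : ℂ)) x)) =ᵐ[volume]
        ift fun θ => (ψ θ : ℂ) • L (Complex.I • cvec θ) := by
      filter_upwards [hgr, ift_clm_ae_eq hv2 hvi L] with x h1 h3
      rw [h1, h3]
      simp only [map_smul]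
    rw [integral_inner_congr_left hLift w,
      integral_inner_congr_left (scalarIft_smul_ae_eq hkc hks b) k,
      ← integral_inner_ft (memLp_ift hLv) hw, ← integral_inner_ft (memLp_ift hb2) hk] at hweak
    rw [← hweak, ← integral_add]
    · refine integral_congr_ae ?_
      filter_upwards [ft_ift hLv, ft_ift hb2] with ξ h1 h2
      rw [h1, h2, inner_smul_left, inner_smul_left, Complex.conj_ofReal, ← mul_add, Complex.real_smul]
    · exact integrable_inner_C3 (memLp_ft (memLp_ift hLv)) (memLp_ft hw)
    · exact integrable_inner_C3 (memLp_ft (memLp_ift hb2)) (memLp_ft hk)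

lemma IsDivFree.ae_inner_ft {g : R3 → C3} (hd : IsDivFree volume g) (hg : MemLp g 2 volume) :
    ∀ᵐ ξ : R3, inner ℂ (cvec ξ) (ft g ξ) = 0 := by
  have h := ae_inner_ft_of_weak (L := ContinuousLinearMap.id ℂ C3) (b := 0) hg hg fun φ hφ hc => by
    have := hd φ hφ hc
    simpa using this
  filter_upwards [h] with ξ hξ
  rw [inner_zero_left, add_zero, ContinuousLinearMap.id_apply, inner_smul_left] at hξ
  exact (mul_eq_zero.1 hξ).resolve_left (by simp)

/-! ### The Fourier transform of a curl -/

lemma integral_conj_planeWave_mul_pderiv {f : R3 → ℂ} (hf : ContDiff ℝ ∞ f)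
    (hc : HasCompactSupport f) (θ : R3) (j : Fin 3) :
    ∫ x, (starRingEnd ℂ) (planeWave θ x) * pderiv j f x =
      Complex.I * θ j * ∫ x, (starRingEnd ℂ) (planeWave θ x) * f x := by
  simp only [conj_planeWave]
  have hpw : Continuous (planeWave (-θ)) := (contDiff_planeWave _).continuous
  have hfd : Continuous fun x => fderiv ℝ f x (basisVec j) :=
    (hf.continuous_fderiv (by simp)).clm_apply continuous_const
  have hfdc : HasCompactSupport fun x => fderiv ℝ f x (basisVec j) := hc.fderiv_apply ℝ _
  have hder : ∀ x, fderiv ℝ (planeWave (-θ)) x (basisVec j) = Complex.I * (-θ) j * planeWave (-θ) x :=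
    pderiv_planeWave (-θ) j
  have h := integral_mul_fderiv_eq_neg_fderiv_mul_of_integrable (μ := (volume : Measure R3))
    (f := planeWave (-θ)) (g := f) (v := basisVec j) ?_ ?_ ?_
    (fun x _ => (contDiff_planeWave (-θ)).differentiable (by simp) x)
    (fun x _ => hf.differentiable (by simp) x)
  · simp only [pderiv]
    rw [h]
    simp only [hder, mul_assoc]
    rw [integral_const_mul, integral_const_mul, PiLp.neg_apply]
    push_cast
    ring
  · simp only [hder]
    exact ((continuous_const.mul hpw).mul hf.continuous).integrable_of_hasCompactSupport hc.mul_left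
  · exact (hpw.mul hfd).integrable_of_hasCompactSupport hfdc.mul_left
  · exact (hpw.mul hf.continuous).integrable_of_hasCompactSupport hc.mul_left

lemma contDiff_apply_C3 {η : R3 → C3} (hη : ContDiff ℝ ∞ η) (i : Fin 3) :
    ContDiff ℝ ∞ fun x => η x i := (contDiff_piLp 2).1 hη i

lemma continuous_pderiv {f : R3 → ℂ} (hf : ContDiff ℝ ∞ f) (j : Fin 3) : Continuous (pderiv j f) :=
  (hf.continuous_fderiv (by simp)).clm_apply continuous_const

lemma hasCompactSupport_apply_C3 {η : R3 → C3} (hc : HasCompactSupport η) (i : Fin 3) :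
    HasCompactSupport fun x => η x i := hc.comp_left (g := fun v : C3 => v i) rfl

lemma continuous_curl {η : R3 → C3} (hη : ContDiff ℝ ∞ η) : Continuous (curl η) := by
  have h := fun i j => continuous_pderiv (contDiff_apply_C3 hη i) j
  refine (PiLp.continuous_toLp 2 _).comp (continuous_pi fun i => ?_)
  fin_cases i
  · exact (h 2 1).sub (h 1 2)
  · exact (h 0 2).sub (h 2 0)
  · exact (h 1 0).sub (h 0 1)

lemma hasCompactSupport_curl {η : R3 → C3} (hc : HasCompactSupport η) :
    HasCompactSupport (curl η) := by
  refine hc.mono' fun x hx => ?_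
  contrapose! hx
  have h0 := notMem_tsupport_iff_eventuallyEq.1 hx
  have hp : ∀ j i, pderiv j (fun y => η y i) x = 0 := fun j i => by
    have : (fun y => η y i) =ᶠ[𝓝 x] fun _ => 0 := h0.mono fun y hy => by simp only [hy]; rfl
    rw [pderiv, this.fderiv_eq, fderiv_const_apply, zero_apply]
  rw [Function.notMem_support]
  simp only [curl, hp, sub_zero]
  ext i
  fin_cases i <;> rfl

lemma fourierIntegral_apply {f : R3 → C3} (hf : Integrable f) (θ : R3) (i : Fin 3) :
    fourierIntegral volume f θ i = fourierConst * ∫ x, (starRingEnd ℂ) (planeWave θ x) * f x i := by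
  have hi : Integrable fun x => (starRingEnd ℂ) (planeWave θ x) • f x := by
    simp only [conj_planeWave]
    exact hf.bdd_smul 1 (by fun_prop : Continuous fun x => planeWave (-θ) x).aestronglyMeasurable
      (Eventually.of_forall fun x => (norm_planeWave (-θ) x).le)
  rw [fourierIntegral, PiLp.smul_apply, integral_apply_C3 hi, Complex.real_smul]
  rfl

lemma fourierIntegral_curl {η : R3 → C3} (hη : ContDiff ℝ ∞ η) (hc : HasCompactSupport η) (θ : R3) :
    fourierIntegral volume (curl η) θ = cmul (crossMatrix θ) (fourierIntegral volume η θ) := by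
  have hi := hη.continuous.integrable_of_hasCompactSupport hc (μ := (volume : Measure R3))
  have hci := (continuous_curl hη).integrable_of_hasCompactSupport (hasCompactSupport_curl hc)
    (μ := (volume : Measure R3))
  have hd : ∀ j i, Integrable fun x => (starRingEnd ℂ) (planeWave θ x) * pderiv j (fun y => η y i) x :=
    fun j i => by
      refine Continuous.integrable_of_hasCompactSupport ?_ ?_
      · exact Continuous.mul (by simp only [conj_planeWave]; fun_prop)
          (continuous_pderiv (contDiff_apply_C3 hη i) j)
      · exact HasCompactSupport.mul_left ((hasCompactSupport_apply_C3 hc i).fderiv_apply ℝ _)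
  have hval := fun j i => integral_conj_planeWave_mul_pderiv (contDiff_apply_C3 hη i)
    (hasCompactSupport_apply_C3 hc i) θ j
  have hsub : ∀ j i j' i', ∫ x, (starRingEnd ℂ) (planeWave θ x) *
      (pderiv j (fun y => η y i) x - pderiv j' (fun y => η y i') x) =
      Complex.I * θ j * (∫ x, (starRingEnd ℂ) (planeWave θ x) * η x i) -
      Complex.I * θ j' * ∫ x, (starRingEnd ℂ) (planeWave θ x) * η x i' := fun j i j' i' => by
    simp only [mul_sub]
    rw [integral_sub (hd j i) (hd j' i'), hval, hval]
  rw [cmul_cross]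
  ext i
  rw [fourierIntegral_apply hci]
  fin_cases i
  · simp only [curl, fourierIntegral_apply hi]
    simp only [Fin.zero_eta, Matrix.cons_val]
    rw [hsub]; ring
  · simp only [curl, fourierIntegral_apply hi]
    simp only [Fin.mk_one, Matrix.cons_val]
    rw [hsub]; ring
  · simp only [curl, fourierIntegral_apply hi]
    simp only [Fin.reduceFinMk, Matrix.cons_val]
    rw [hsub]; ring

lemma continuous_rmul_apply {X : Type*} [TopologicalSpace X] {M : X → Matrix (Fin 3) (Fin 3) ℝ}
    (hM : Continuous M) {f : X → C3} (hf : Continuous f) : Continuous fun x => rmul (M x) (f x) :=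
  (continuous_rmul hM).comp (f := fun x => (x, f x)) (continuous_id.prodMk hf)

lemma hasCompactSupport_rmul (M : R3 → Matrix (Fin 3) (Fin 3) ℝ) {f : R3 → C3}
    (hf : HasCompactSupport f) : HasCompactSupport fun x => rmul (M x) (f x) :=
  hf.mono fun x hx => by
    contrapose! hx
    rw [Function.notMem_support] at hx ⊢
    rw [hx, rmul_zero]

lemma memLp_rmul {M : R3 → Matrix (Fin 3) (Fin 3) ℝ} (hM : Continuous M) {β : ℝ}
    (hβ : ∀ x v, ‖rmul (M x) v‖ ≤ β * ‖v‖) {ν : Measure R3} {f : R3 → C3} (hf : MemLp f 2 ν) :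
    MemLp (fun x => rmul (M x) (f x)) 2 ν :=
  MemLp.of_le_mul hf ((continuous_rmul hM).comp_aestronglyMeasurable
    (f := fun x => (x, f x)) (aestronglyMeasurable_id.prodMk hf.1))
    (Eventually.of_forall fun x => hβ x _)

lemma continuous_cross : Continuous fun z : R3 × C3 => cmul (crossMatrix z.1) z.2 := by
  simp only [cmul_cross]
  refine (PiLp.continuous_toLp 2 _).comp (continuous_pi fun i => ?_)
  fin_cases i <;> simp <;> fun_prop

lemma aestronglyMeasurable_cross {f : R3 → C3} {ν : Measure R3} (hf : AEStronglyMeasurable f ν) :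
    AEStronglyMeasurable (fun ξ => cmul (crossMatrix ξ) (f ξ)) ν :=
  continuous_cross.comp_aestronglyMeasurable (f := fun x => (x, f x))
    (aestronglyMeasurable_id.prodMk hf)

/-- The relation holds for the approximating smooth fields. Multiplication by `iξ×` is unbounded,
but on a ball of radius `r` its norm is at most `r`, so the `L²` limit can be taken there; balls of
integer radius exhaust the space. -/
lemma MemHcurl.ft_eq {S : R3 → Matrix (Fin 3) (Fin 3) ℝ} {β : ℝ} (hS : Continuous S)
    (hβ : ∀ x v, ‖rmul (S x) v‖ ≤ β * ‖v‖) {u w : R3 → C3} (h : MemHcurl S volume u w) :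
    ft w =ᵐ[volume] fun ξ => cmul (crossMatrix ξ) (ft (fun x => rmul (S x) (u x)) ξ) := by
  have hE : MemLp (fun x => rmul (S x) (u x)) 2 volume := memLp_rmul hS hβ h.left_mem
  have key : ∀ r : ℕ, ∀ᵐ ξ ∂(volume.restrict (Metric.ball (0 : R3) r)),
      ft w ξ = cmul (crossMatrix ξ) (ft (fun x => rmul (S x) (u x)) ξ) := fun r => by
    have hle : ∀ δ : ℝ≥0∞, 0 < δ → eLpNorm (fun ξ => ft w ξ - cmul (crossMatrix ξ)
        (ft (fun x => rmul (S x) (u x)) ξ)) 2 (volume.restrict (Metric.ball (0 : R3) r)) ≤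
        (1 + ENNReal.ofReal (r * β)) * δ := fun δ hδ => by
      obtain ⟨φ, hφ, hc, h1, h2⟩ := h.closure δ hδ
      set η : R3 → C3 := fun x => rmul (S x) (φ x)
      have hη2 : MemLp η 2 volume := hφ.continuous.memLp_of_hasCompactSupport hc
      have hcη2 : MemLp (curl η) 2 volume :=
        (continuous_curl hφ).memLp_of_hasCompactSupport (hasCompactSupport_curl hc)
      have hft : ft (curl η) =ᵐ[volume] fun ξ => cmul (crossMatrix ξ) (ft η ξ) := by
        filter_upwards [ft_eq_fourierIntegral hη2 (hφ.continuous.integrable_of_hasCompactSupport hc),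
          ft_eq_fourierIntegral hcη2 ((continuous_curl hφ).integrable_of_hasCompactSupport
            (hasCompactSupport_curl hc))] with ξ h3 h4
        rw [h3, h4, fourierIntegral_curl hφ hc]
      have hd1 : MemLp (fun x => w x - curl η x) 2 volume := h.right_mem.sub hcη2
      have hd2 : MemLp (fun x => rmul (S x) (u x) - η x) 2 volume := hE.sub hη2
      have hae : (fun ξ => ft w ξ - cmul (crossMatrix ξ) (ft (fun x => rmul (S x) (u x)) ξ)) =ᵐ[volume]
          (ft (fun x => w x - curl η x) -
            fun ξ => cmul (crossMatrix ξ) (ft (fun x => rmul (S x) (u x) - η x) ξ)) := by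
        filter_upwards [hft, ft_sub h.right_mem hcη2, ft_sub hE hη2] with ξ h3 h4 h5
        rw [Pi.sub_apply, h4, h5, cmul_sub, h3]
        abel
      rw [eLpNorm_congr_ae (ae_restrict_of_ae hae)]
      refine (eLpNorm_sub_le (memLp_ft hd1).1.restrict (aestronglyMeasurable_cross (memLp_ft hd2).1).restrict one_le_two).trans ?_
      rw [add_mul, one_mul]
      refine add_le_add ?_ ?_
      · refine (eLpNorm_mono_measure _ Measure.restrict_le_self).trans ?_
        rw [eLpNorm_ft hd1]
        exact h2.le
      · have hb : eLpNorm (fun x => rmul (S x) (u x) - η x) 2 volume ≤ ENNReal.ofReal β * δ := by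
          refine (eLpNorm_le_mul_eLpNorm_of_ae_le_mul (g := fun x => u x - φ x)
            (Eventually.of_forall fun x => ?_) 2).trans (by gcongr)
          simp only [η]
          rw [← rmul_sub]
          exact hβ x _
        refine (eLpNorm_le_mul_eLpNorm_of_ae_le_mul
          (g := ft (fun x => rmul (S x) (u x) - η x)) (c := r) ?_ 2).trans ?_
        · filter_upwards [ae_restrict_mem measurableSet_ball] with ξ hξ
          refine (norm_cross_le _ _).trans ?_
          gcongr
          exact (mem_ball_zero_iff.1 hξ).le
        · rw [ENNReal.ofReal_mul (Nat.cast_nonneg r), mul_assoc]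
          gcongr
          refine (eLpNorm_mono_measure _ Measure.restrict_le_self).trans ?_
          rwa [eLpNorm_ft hd2]
    have hz : eLpNorm (fun ξ => ft w ξ - cmul (crossMatrix ξ)
        (ft (fun x => rmul (S x) (u x)) ξ)) 2 (volume.restrict (Metric.ball (0 : R3) r)) = 0 := by
      have hlim := ENNReal.Tendsto.const_mul (a := 1 + ENNReal.ofReal (r * β))
        ENNReal.tendsto_inv_nat_nhds_zero (Or.inr (by finiteness))
      rw [mul_zero] at hlim
      exact le_antisymm (ge_of_tendsto' hlim fun n => hle _ (by simp)) zero_le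
    have hm : AEStronglyMeasurable (fun ξ => ft w ξ - cmul (crossMatrix ξ)
        (ft (fun x => rmul (S x) (u x)) ξ)) (volume.restrict (Metric.ball (0 : R3) r)) :=
      ((memLp_ft h.right_mem).1.sub (aestronglyMeasurable_cross (memLp_ft hE).1)).restrict
    rw [eLpNorm_eq_zero_iff hm two_ne_zero] at hz
    exact hz.mono fun ξ hξ => sub_eq_zero.1 hξ
  have h1 := ae_all_iff.2 fun r : ℕ => (ae_restrict_iff' measurableSet_ball).1 (key r)
  filter_upwards [h1] with ξ hξ
  obtain ⟨r, hr⟩ := exists_nat_gt ‖ξ‖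
  exact hξ r (mem_ball_zero_iff.2 hr)

/-! ### The Maxwell system on the Fourier side -/

/-- The map `v ↦ v × e`. -/
noncomputable def crossRight (e : C3) : C3 →L[ℂ] C3 :=
  LinearMap.toContinuousLinearMap
    { toFun := fun v => WithLp.toLp 2 (crossProduct v.ofLp e.ofLp)
      map_add' := fun u v => by simp
      map_smul' := fun t v => by simp }

lemma curl_smul_const {f : R3 → ℂ} {x : R3} (hf : DifferentiableAt ℝ f x) (e : C3) :
    curl (fun y => f y • e) x = crossRight e (grad f x) := by
  have hp : ∀ j i, pderiv j (fun y => (f y • e) i) x = pderiv j f x * e i := fun j i => by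
    simp only [pderiv, PiLp.smul_apply, smul_eq_mul]
    rw [fderiv_mul_const hf, smul_apply, smul_eq_mul, mul_comm]
  simp only [curl, hp]
  ext i
  fin_cases i <;> simp [crossRight, cross_apply, grad]

lemma crossRight_I_cvec (e : C3) (ξ : R3) :
    crossRight e (Complex.I • cvec ξ) = cmul (crossMatrix ξ) e := by
  rw [cmul_cross]
  ext i
  fin_cases i <;> simp [crossRight, cross_apply, cvec]

/-- Testing with `S⁻¹ (φ e)`, for constant `e` and scalar `φ`, removes the weights: the weak form
becomes `curl w + S⁻¹ D + g = 0`, tested against `φ e`. -/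
lemma IsWeakSolution.ft_eq {S : R3 → Matrix (Fin 3) (Fin 3) ℝ} {β : ℝ}
    (hS : Continuous fun x => (S x)⁻¹) (hSh : ∀ x, (S x).IsHermitian) (hSd : ∀ x, IsUnit (S x).det)
    (hβ : ∀ x v, ‖rmul (S x)⁻¹ v‖ ≤ β * ‖v‖) {g D w : R3 → C3} (hg : MemLp g 2 volume)
    (h : IsWeakSolution S volume g D w) :
    ∀ᵐ ξ, cmul (crossMatrix ξ) (ft w ξ) + (ft (fun x => rmul (S x)⁻¹ (D x)) ξ + ft g ξ) = 0 := by
  have hk : MemLp (fun x => rmul (S x)⁻¹ (D x)) 2 volume :=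
    memLp_rmul hS hβ h.mem.left_mem
  have hkg : MemLp (fun x => rmul (S x)⁻¹ (D x) + g x) 2 volume := hk.add hg
  have key : ∀ e : C3, ∀ᵐ ξ, inner ℂ (crossRight e (Complex.I • cvec ξ)) (ft w ξ) +
      inner ℂ e (ft (fun x => rmul (S x)⁻¹ (D x) + g x) ξ) = 0 := fun e => by
    refine ae_inner_ft_of_weak h.mem.right_mem hkg fun φ hφ hc => ?_
    have hη : ContDiff ℝ ∞ fun x => φ x • e := hφ.smul contDiff_const
    have hηc : HasCompactSupport fun x => φ x • e := hc.smul_right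
    have hcancel : (fun x => rmul (S x) (rmul (S x)⁻¹ (φ x • e))) = fun x => φ x • e :=
      funext fun x => rmul_mul_inv_cancel (hSd x) _
    have hcont := continuous_rmul_apply hS hη.continuous
    have hcs := hasCompactSupport_rmul (fun x => (S x)⁻¹) hηc
    -- Only `S` times the field has to be smooth, so this field belongs to the space without
    -- approximation, although `S⁻¹` is merely continuous.
    have hmem : MemHcurl S volume (fun x => rmul (S x)⁻¹ (φ x • e)) (curl fun x => φ x • e) := by
      refine ⟨hcont.memLp_of_hasCompactSupport hcs,
        (continuous_curl hη).memLp_of_hasCompactSupport (hasCompactSupport_curl hηc), fun δ hδ =>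
        ⟨fun x => rmul (S x)⁻¹ (φ x • e), ?_, ?_, ?_, ?_⟩⟩
      · rwa [hcancel]
      · rwa [hcancel]
      · simpa using hδ
      · rw [hcancel]
        simpa using hδ
    have hη2 : MemLp (fun x => φ x • e) 2 volume := hη.continuous.memLp_of_hasCompactSupport hηc
    have hw := h.weak _ _ hmem
    have e1 : ∀ x v, inner ℂ (rmul (S x)⁻¹ (φ x • e)) v = inner ℂ (φ x • e) (rmul (S x)⁻¹ v) :=
      fun x v => inner_rmul_left (hSh x).inv _ _
    have e2 : ∀ x, curl (fun y => φ y • e) x = crossRight e (grad φ x) := fun x =>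
      curl_smul_const (hφ.differentiable (by simp) x) e
    have e3 : ∀ x, rmul (S x)⁻¹ (rmul (S x) (g x)) = g x := fun x => rmul_inv_mul_cancel (hSd x) _
    simp only [e1, e2, e3] at hw
    simp only [inner_add_right]
    rw [integral_add (integrable_inner_C3 hη2 hk) (integrable_inner_C3 hη2 hg), ← add_assoc, hw,
      neg_add_cancel]
  filter_upwards [ae_all_iff.2 fun i : Fin 3 => key (EuclideanSpace.single i 1), ft_add hk hg] with ξ hξ hadd
  ext i
  have := hξ i
  rw [crossRight_I_cvec, inner_cross_left, ← inner_add_right, hadd, EuclideanSpace.inner_single_left] at this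
  simpa using this

/-! ### Periodic test functions -/

/-- The twisted gradient `conj(e_κ) ∇(e_κ φ)`. -/
noncomputable def twistedGrad (κ : R3) (φ : R3 → ℂ) (y : R3) : C3 :=
  grad φ y + φ y • Complex.I • cvec κ

lemma grad_planeWave (κ y : R3) : grad (planeWave κ) y = planeWave κ y • Complex.I • cvec κ := by
  ext j
  simp only [grad, pderiv_planeWave, cvec, PiLp.smul_apply, smul_eq_mul]
  ring

lemma grad_planeWave_mul {φ : R3 → ℂ} (hφ : ContDiff ℝ ∞ φ) (κ y : R3) :
    grad (fun z => planeWave κ z * φ z) y = planeWave κ y • twistedGrad κ φ y := by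
  rw [grad_mul ((contDiff_planeWave κ).differentiable (by simp) y) (hφ.differentiable (by simp) y),
    grad_planeWave, twistedGrad, smul_add, smul_comm (φ y)]

lemma planeWave_smul_conj_smul (κ y : R3) (v : C3) :
    planeWave κ y • (starRingEnd ℂ) (planeWave κ y) • v = v := by
  rw [smul_smul, mul_comm, conj_planeWave_mul, one_smul]

lemma continuous_twistedGrad {φ : R3 → ℂ} (hφ : ContDiff ℝ ∞ φ) (κ : R3) :
    Continuous (twistedGrad κ φ) :=
  (continuous_grad hφ).add (hφ.continuous.smul continuous_const)

lemma memLp_cell_of_isPeriodic {E : Type*} [NormedAddCommGroup E]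
    [SecondCountableTopologyEither R3 E] {f : R3 → E} (hf : Continuous f) (hp : IsPeriodic f) :
    MemLp f 2 cellMeasure := by
  obtain ⟨C, hC⟩ := IsPeriodic.bddAbove (f := fun x => ‖f x‖) (fun j x => by simp only [hp j x]) hf.norm
  exact MemLp.of_bound hf.aestronglyMeasurable C (Eventually.of_forall hC)

lemma isPeriodic_grad {φ : R3 → ℂ} (hp : IsPeriodic φ) : IsPeriodic (grad φ) := fun j x => by
  ext i
  have : (fun y => φ (y + basisVec j)) = φ := funext fun y => hp j y
  simp only [grad, pderiv]
  rw [← fderiv_comp_add_right, this]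

lemma isPeriodic_twistedGrad {φ : R3 → ℂ} (hp : IsPeriodic φ) (κ : R3) :
    IsPeriodic (twistedGrad κ φ) := fun j x => by
  rw [twistedGrad, twistedGrad, hp j x, isPeriodic_grad hp j x]

namespace IsPeriodicTest

variable {φ φ' : R3 → ℂ}

lemma memLp (hφ : IsPeriodicTest volume φ) : MemLp φ 2 cellMeasure :=
  memLp_cell_of_isPeriodic hφ.smooth.continuous hφ.periodic

lemma memLp_twistedGrad (hφ : IsPeriodicTest volume φ) (κ : R3) :
    MemLp (twistedGrad κ φ) 2 cellMeasure :=
  memLp_cell_of_isPeriodic (continuous_twistedGrad hφ.smooth κ) (isPeriodic_twistedGrad hφ.periodic κ)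

lemma add (hφ : IsPeriodicTest volume φ) (hφ' : IsPeriodicTest volume φ') :
    IsPeriodicTest volume fun y => φ y + φ' y :=
  ⟨hφ.smooth.add hφ'.smooth, fun j x => by simp only [hφ.periodic j x, hφ'.periodic j x], by
    rw [integral_add (hφ.memLp.integrable one_le_two) (hφ'.memLp.integrable one_le_two),
      hφ.mean_zero, hφ'.mean_zero, add_zero]⟩

lemma const_mul (hφ : IsPeriodicTest volume φ) (t : ℂ) : IsPeriodicTest volume fun y => t * φ y :=
  ⟨contDiff_const.mul hφ.smooth, fun j x => by simp only [hφ.periodic j x], by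
    rw [integral_const_mul, hφ.mean_zero, mul_zero]⟩

lemma planeWave_mode {m : Fin 3 → ℤ} (hm : m ≠ 0) : IsPeriodicTest volume (planeWave (mode m)) :=
  ⟨contDiff_planeWave _, isPeriodic_planeWave_mode m, by rw [integral_planeWave_mode, if_neg hm]⟩

end IsPeriodicTest

lemma twistedGrad_add {φ φ' : R3 → ℂ} (hφ : ContDiff ℝ ∞ φ) (hφ' : ContDiff ℝ ∞ φ') (κ y : R3) :
    twistedGrad κ (fun z => φ z + φ' z) y = twistedGrad κ φ y + twistedGrad κ φ' y := by
  have h : grad (fun z => φ z + φ' z) y = grad φ y + grad φ' y := by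
    ext j
    simp only [grad, pderiv, PiLp.add_apply]
    rw [fderiv_fun_add (hφ.differentiable (by simp) y) (hφ'.differentiable (by simp) y), add_apply]
  rw [twistedGrad, twistedGrad, twistedGrad, h, add_smul]
  abel

lemma twistedGrad_const_mul {φ : R3 → ℂ} (hφ : ContDiff ℝ ∞ φ) (t : ℂ) (κ y : R3) :
    twistedGrad κ (fun z => t * φ z) y = t • twistedGrad κ φ y := by
  have h : grad (fun z => t * φ z) y = t • grad φ y := by
    ext j
    simp only [grad, pderiv, PiLp.smul_apply]
    rw [fderiv_const_mul (hφ.differentiable (by simp) y), smul_apply]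
  rw [twistedGrad, twistedGrad, h, smul_add, mul_smul]

lemma twistedGrad_planeWave (κ κ' y : R3) :
    twistedGrad κ (planeWave κ') y = planeWave κ' y • Complex.I • cvec (κ + κ') := by
  rw [twistedGrad, grad_planeWave, ← smul_add, ← smul_add]
  congr 2
  ext i
  simp [cvec, add_comm]

/-- The Fourier coefficients of a twisted gradient. -/
lemma cellCoeff_twistedGrad
    (hgrad : ∀ (j : Fin 3) (φ : R3 → ℂ), ContDiff ℝ ∞ φ → IsPeriodic φ →
      ∫ y in unitCell, pderiv j φ y = 0) {φ : R3 → ℂ} (hφ : IsPeriodicTest volume φ) (κ : R3)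
    (m : Fin 3 → ℤ) :
    cellCoeff m (twistedGrad κ φ) = cellCoeff m φ • Complex.I • cvec (κ + mode m) := by
  have hpd : ∀ j, MemLp (pderiv j φ) 2 cellMeasure := fun j => by
    have := memLp_cell_of_isPeriodic (continuous_grad hφ.smooth) (isPeriodic_grad hφ.periodic)
    exact memLp_apply_C3 this j
  have hgr : ∀ j, cellCoeff m (pderiv j φ) = Complex.I * mode m j * cellCoeff m φ := fun j => by
    have hper : IsPeriodic fun y => planeWave (-mode m) y * φ y := fun i x => by
      simp only
      rw [← mode_neg, isPeriodic_planeWave_mode (-m) i x, hφ.periodic i x]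
    -- The hypothesis on gradients, applied to this product, is integration by parts on the cell.
    have h := hgrad j (fun y => planeWave (-mode m) y * φ y) ((contDiff_planeWave _).mul hφ.smooth) hper
    have hpt : ∀ y, pderiv j (fun z => planeWave (-mode m) z * φ z) y =
        (starRingEnd ℂ) (planeWave (mode m) y) • pderiv j φ y -
          Complex.I * mode m j * ((starRingEnd ℂ) (planeWave (mode m) y) • φ y) := fun y => by
      rw [pderiv_mul ((contDiff_planeWave _).differentiable (by simp) y)
        (hφ.smooth.differentiable (by simp) y), pderiv_planeWave, conj_planeWave, smul_eq_mul,
        smul_eq_mul, PiLp.neg_apply]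
      push_cast
      ring
    simp only [hpt] at h
    rw [integral_sub (integrable_cellCoeff (hpd j) m)
      ((integrable_cellCoeff hφ.memLp m).const_mul _), integral_const_mul] at h
    exact sub_eq_zero.1 h
  ext j
  rw [cellCoeff_apply (hφ.memLp_twistedGrad κ)]
  have h1 : (fun y => twistedGrad κ φ y j) = fun y => pderiv j φ y + (Complex.I * κ j) • φ y := by
    ext1 y
    simp only [twistedGrad, grad, cvec, PiLp.add_apply, PiLp.smul_apply, smul_eq_mul]
    ring
  have h2 : cellCoeff m (fun y => (Complex.I * κ j) • φ y) = Complex.I * κ j * cellCoeff m φ := by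
    simp only [cellCoeff, smul_eq_mul]
    rw [← integral_const_mul]
    congr 1
    ext1 y
    ring
  have h3 : MemLp (fun y => (Complex.I * κ j) • φ y) 2 cellMeasure :=
    hφ.memLp.const_smul (Complex.I * κ j : ℂ)
  rw [h1, cellCoeff_add (hpd j) h3, h2, hgr]
  simp only [cvec, PiLp.smul_apply, smul_eq_mul, PiLp.add_apply]
  push_cast
  ring

/-! ### The Poincaré inequality -/

/-- The gap is the distance from `r` to the integers, or `1` if `r` is an integer. -/
lemma exists_le_abs_add_int (r : ℝ) : ∃ δ > 0, ∀ n : ℤ, r + n = 0 ∨ δ ≤ |r + n| := by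
  by_cases h0 : r - round r = 0
  · refine ⟨1, one_pos, fun n => ?_⟩
    have : r + n = ((round r + n : ℤ) : ℝ) := by push_cast; linarith
    rw [this]
    rcases eq_or_ne (round r + n) 0 with h | h
    · left; exact_mod_cast h
    · right; exact_mod_cast Int.one_le_abs h
  · refine ⟨|r - round r|, abs_pos.2 h0, fun n => Or.inr ?_⟩
    have := round_le r (-n)
    push_cast at this
    rwa [sub_neg_eq_add] at this

/-- The shifted lattice is discrete. The gap depends on `κ` without any uniformity, which is
harmless because it serves only for the existence of `ψ` at fixed `κ`. -/
lemma exists_le_norm_add_mode (κ : R3) : ∃ δ > 0, ∀ m, κ + mode m = 0 ∨ δ ≤ ‖κ + mode m‖ := by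
  choose δ hδ h using fun i => exists_le_abs_add_int (κ i / (2 * Real.pi))
  have hpi := Real.two_pi_pos
  obtain ⟨i₀, -, hmin⟩ := Finset.exists_min_image Finset.univ δ ⟨0, Finset.mem_univ _⟩
  refine ⟨2 * Real.pi * δ i₀, mul_pos hpi (hδ i₀), fun m => ?_⟩
  have hc : ∀ i, (κ + mode m) i = 2 * Real.pi * (κ i / (2 * Real.pi) + m i) := fun i => by
    simp only [mode, ivec, PiLp.add_apply, PiLp.smul_apply, smul_eq_mul]
    field_simp
  by_cases hz : ∀ i, κ i / (2 * Real.pi) + m i = 0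
  · left
    ext i
    rw [hc, hz, mul_zero]
    rfl
  · right
    push Not at hz
    obtain ⟨i, hi⟩ := hz
    refine le_trans ?_ (PiLp.norm_apply_le (κ + mode m) i)
    rw [hc, Real.norm_eq_abs, abs_mul, abs_of_pos hpi]
    gcongr
    exact (hmin i (Finset.mem_univ i)).trans ((h i (m i)).resolve_left hi)

lemma norm_cvec (θ : R3) : ‖cvec θ‖ = ‖θ‖ := by
  rw [EuclideanSpace.norm_eq, EuclideanSpace.norm_eq]
  simp [cvec]

/-- The Poincaré inequality for twisted gradients, away from their kernel. -/
lemma eLpNorm_le_eLpNorm_twistedGrad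
    (hgrad : ∀ (j : Fin 3) (φ : R3 → ℂ), ContDiff ℝ ∞ φ → IsPeriodic φ →
      ∫ y in unitCell, pderiv j φ y = 0) {κ : R3} {δ : ℝ} (hδ : 0 ≤ δ)
    (h : ∀ m, κ + mode m = 0 ∨ δ ≤ ‖κ + mode m‖) {φ : R3 → ℂ} (hφ : IsPeriodicTest volume φ)
    (h0 : ∀ m, κ + mode m = 0 → cellCoeff m φ = 0) :
    ENNReal.ofReal δ * eLpNorm φ 2 cellMeasure ≤ eLpNorm (twistedGrad κ φ) 2 cellMeasure := by
  set e : C3 := EuclideanSpace.single 0 1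
  have he : ‖e‖ = 1 := by simp [e]
  have hF : MemLp (fun y => φ y • e) 2 cellMeasure :=
    hφ.memLp.of_le (hφ.memLp.1.smul_const e) (Eventually.of_forall fun y => by
      rw [norm_smul, he, mul_one])
  have hn : eLpNorm φ 2 cellMeasure = eLpNorm (fun y => φ y • e) 2 cellMeasure :=
    eLpNorm_congr_norm_ae (Eventually.of_forall fun y => by rw [norm_smul, he, mul_one])
  have hcF : ∀ m, cellCoeff m (fun y => φ y • e) = cellCoeff m φ • e := fun m => by
    simp only [cellCoeff]
    rw [← integral_smul_const]
    simp only [smul_assoc]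
  refine (ENNReal.pow_right_strictMono two_ne_zero).le_iff_le.1 ?_
  rw [mul_pow, hn, eLpNorm_sq_eq_tsum_cellCoeff hF, eLpNorm_sq_eq_tsum_cellCoeff
    (hφ.memLp_twistedGrad κ), ← ENNReal.tsum_mul_left]
  -- By Parseval it suffices to compare modes: the coefficient of the twisted gradient is that of
  -- `φ` times a vector of length `‖κ + mode m‖`.
  refine ENNReal.tsum_le_tsum fun m => ?_
  rw [hcF, cellCoeff_twistedGrad hgrad hφ, ← mul_pow]
  gcongr
  rw [← ofReal_norm, ← ofReal_norm, ← ENNReal.ofReal_mul hδ]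
  refine ENNReal.ofReal_le_ofReal ?_
  rw [norm_smul, norm_smul, norm_smul, he, mul_one, Complex.norm_I, one_mul, norm_cvec, mul_comm]
  rcases h m with h1 | h1
  · rw [h0 m h1]; simp
  · gcongr

lemma rmul_neg (M : Matrix (Fin 3) (Fin 3) ℝ) (v : C3) : rmul M (-v) = -rmul M v := cmul_neg _ _

lemma mode_injective : Function.Injective mode := fun m n h => by
  ext i
  have := congrArg (fun v : R3 => v i) h
  simpa [mode, ivec, Real.pi_ne_zero] using this

/-! ### Correctors -/

/-- The function `q = conj(e_κ) ∇(e_κ ψ)` solves the cell problem for `c`. -/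
structure IsCorrector (A : R3 → Matrix (Fin 3) (Fin 3) ℝ) (κ : R3) (c : C3) (q : R3 → C3) :
    Prop where
  mem : MemLp q 2 cellMeasure
  closure : ∀ δ : ℝ≥0∞, 0 < δ → ∃ φ, IsPeriodicTest volume φ ∧
    eLpNorm (fun y => q y - twistedGrad κ φ y) 2 cellMeasure < δ
  weak : ∀ φ, IsPeriodicTest volume φ →
    ∫ y in unitCell, inner ℂ (twistedGrad κ φ y) (rmul (A y)⁻¹ (q y + c)) = 0

section

variable {A : R3 → Matrix (Fin 3) (Fin 3) ℝ} {κ : R3} {c : C3}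

lemma inner_planeWave_smul_smul (κ y : R3) (u v : C3) :
    inner ℂ (planeWave κ y • u) (planeWave κ y • v) = inner ℂ u v := by
  rw [inner_smul_left, inner_smul_right, ← mul_assoc, conj_planeWave_mul, one_mul]

lemma IsCellSolution.isCorrector {ψ : R3 → ℂ} {p : R3 → C3}
    (h : IsCellSolution A volume κ c ψ p) :
    IsCorrector A κ c fun y => (starRingEnd ℂ) (planeWave κ y) • p y := by
  refine ⟨memLp_conj_planeWave_smul h.right_mem κ, fun δ hδ => ?_, fun φ hφ => ?_⟩
  · obtain ⟨φ, hφ, -, h2⟩ := h.closure δ hδ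
    refine ⟨φ, hφ, lt_of_le_of_lt (le_of_eq ?_) h2⟩
    refine eLpNorm_congr_norm_ae (Eventually.of_forall fun y => ?_)
    rw [grad_planeWave_mul hφ.smooth]
    conv_rhs => rw [← planeWave_smul_conj_smul κ y (p y), ← smul_sub, norm_smul, norm_planeWave,
      one_mul]
  · rw [← h.weak φ hφ]
    congr 1
    ext1 y
    rw [grad_planeWave_mul hφ.smooth]
    conv_rhs => rw [← planeWave_smul_conj_smul κ y (p y), ← smul_add, rmul_smul,
      inner_planeWave_smul_smul]

/-- A corrector is the twisted gradient of a periodic function. -/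
lemma IsCorrector.exists_isCellSolution
    (hgrad : ∀ (j : Fin 3) (φ : R3 → ℂ), ContDiff ℝ ∞ φ → IsPeriodic φ →
      ∫ y in unitCell, pderiv j φ y = 0) {q : R3 → C3} (h : IsCorrector A κ c q) :
    ∃ ψ, IsCellSolution A volume κ c ψ fun y => planeWave κ y • q y := by
  obtain ⟨δ, hδ, hgap⟩ := exists_le_norm_add_mode κ
  have happrox : ∀ n : ℕ, ∃ φ, IsPeriodicTest volume φ ∧
      (∀ m, κ + mode m = 0 → cellCoeff m φ = 0) ∧
      eLpNorm (fun y => q y - twistedGrad κ φ y) 2 cellMeasure < ((n : ℝ≥0∞) + 1)⁻¹ := fun n => by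
    obtain ⟨φ, hφ, hlt⟩ := h.closure ((n : ℝ≥0∞) + 1)⁻¹ (by simp)
    -- If `κ = -mode m₀`, the wave of mode `m₀` has zero twisted gradient and the Poincaré
    -- inequality fails on it. For `m₀ = 0` the zero mean already excludes it; otherwise its
    -- component is subtracted from `φ` without changing the twisted gradient.
    by_cases hres : ∃ m, κ + mode m = 0
    · obtain ⟨m₀, hm₀⟩ := hres
      rcases eq_or_ne m₀ 0 with rfl | hne
      · refine ⟨φ, hφ, fun m hm => ?_, hlt⟩
        have : m = 0 := mode_injective (add_left_cancel (hm.trans hm₀.symm))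
        rw [this]
        simpa [cellCoeff, mode_zero, planeWave_zero_left] using hφ.mean_zero
      · have hpw := (IsPeriodicTest.planeWave_mode hne).const_mul (-cellCoeff m₀ φ)
        refine ⟨_, hφ.add hpw, fun m hm => ?_, ?_⟩
        · have : m = m₀ := mode_injective (add_left_cancel (hm.trans hm₀.symm))
          subst this
          rw [cellCoeff_add hφ.memLp hpw.memLp]
          have : ∀ y, (starRingEnd ℂ) (planeWave (mode m) y) • (-cellCoeff m φ * planeWave (mode m) y) =
              -cellCoeff m φ := fun y => by
            rw [smul_eq_mul, mul_left_comm, conj_planeWave_mul, mul_one]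
          rw [cellCoeff.eq_1 m fun y => -cellCoeff m φ * planeWave (mode m) y]
          simp only [this]
          simp
        · have : ∀ y, twistedGrad κ (fun y => φ y + -cellCoeff m₀ φ * planeWave (mode m₀) y) y =
              twistedGrad κ φ y := fun y => by
            rw [twistedGrad_add hφ.smooth hpw.smooth,
              twistedGrad_const_mul (contDiff_planeWave _), twistedGrad_planeWave, hm₀]
            have : cvec 0 = 0 := by ext i; simp [cvec]
            rw [this, smul_zero, smul_zero, smul_zero, add_zero]
          simp only [this]
          exact hlt
    · push Not at hres
      exact ⟨φ, hφ, fun m hm => absurd hm (hres m), hlt⟩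
  choose φ hφ h0 hlt using happrox
  have hinv : Tendsto (fun n : ℕ => ((n : ℝ≥0∞) + 1)⁻¹) atTop (𝓝 0) := by
    have := (ENNReal.tendsto_inv_nat_nhds_zero).comp (tendsto_add_atTop_nat 1)
    simpa [Function.comp_def] using this
  have hT : Tendsto (fun n => ((hφ n).memLp_twistedGrad κ).toLp) atTop (𝓝 h.mem.toLp) := by
    rw [Lp.tendsto_Lp_iff_tendsto_eLpNorm'']
    refine tendsto_of_tendsto_of_tendsto_of_le_of_le tendsto_const_nhds hinv (fun _ => zero_le)
      fun n => ?_
    simp only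
    rw [eLpNorm_sub_comm]
    exact (hlt n).le
  -- The Poincaré inequality for differences: convergence of the twisted gradients forces the
  -- potentials to be Cauchy, and their limit is `ψ`.
  have hle : ∀ n n', dist (hφ n).memLp.toLp (hφ n').memLp.toLp ≤ δ⁻¹ *
      dist ((hφ n).memLp_twistedGrad κ).toLp ((hφ n').memLp_twistedGrad κ).toLp := fun n n' => by
    have hd := (hφ n).add ((hφ n').const_mul (-1))
    have h1 := eLpNorm_le_eLpNorm_twistedGrad hgrad hδ.le hgap hd fun m hm => by
      have e1 : cellCoeff m (fun y => -1 * φ n' y) = -1 * cellCoeff m (φ n') := by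
        simp only [cellCoeff]
        rw [← integral_const_mul]
        congr 1
        ext1 y
        simp only [smul_eq_mul]
        ring
      rw [cellCoeff_add (hφ n).memLp ((hφ n').const_mul (-1)).memLp, e1, h0 n m hm, h0 n' m hm]
      simp
    have e2 : (fun y => φ n y + -1 * φ n' y) = φ n - φ n' := by
      ext1 y; simp only [Pi.sub_apply]; ring
    have e3 : twistedGrad κ (fun y => φ n y + -1 * φ n' y) =
        twistedGrad κ (φ n) - twistedGrad κ (φ n') := by
      ext1 y
      rw [twistedGrad_add (hφ n).smooth ((hφ n').const_mul (-1)).smooth,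
        twistedGrad_const_mul (hφ n').smooth, Pi.sub_apply, neg_one_smul, sub_eq_add_neg]
    rw [e3, e2] at h1
    rw [dist_eq_norm, dist_eq_norm, ← MemLp.toLp_sub, ← MemLp.toLp_sub, Lp.norm_toLp, Lp.norm_toLp,
      le_inv_mul_iff₀ hδ, ← ENNReal.toReal_ofReal hδ.le, ← ENNReal.toReal_mul]
    exact ENNReal.toReal_mono (((hφ n).memLp_twistedGrad κ).sub ((hφ n').memLp_twistedGrad κ)).2.ne h1
  have hc : CauchySeq fun n => (hφ n).memLp.toLp := by
    have := hT.cauchySeq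
    rw [Metric.cauchySeq_iff] at this ⊢
    intro r hr
    obtain ⟨N, hN⟩ := this (δ * r) (mul_pos hδ hr)
    refine ⟨N, fun n hn n' hn' => (hle n n').trans_lt ?_⟩
    rw [inv_mul_lt_iff₀ hδ]
    exact hN n hn n' hn'
  obtain ⟨ψ, hψ⟩ := cauchySeq_tendsto_of_complete hc
  have hψ2 : (Lp.memLp ψ).toLp = ψ := Lp.toLp_coeFn ψ (Lp.memLp ψ)
  rw [← hψ2, Lp.tendsto_Lp_iff_tendsto_eLpNorm''] at hψ
  refine ⟨ψ, Lp.memLp ψ, memLp_planeWave_smul h.mem κ, fun r hr => ?_, fun φ hφ => ?_⟩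
  · obtain ⟨n, hn1, hn2⟩ := ((hψ.eventually_lt_const hr).and (hinv.eventually_lt_const hr)).exists
    refine ⟨φ n, hφ n, ?_, ?_⟩
    · refine lt_of_le_of_lt (le_of_eq ?_) hn1
      exact eLpNorm_sub_comm _ _ _ _
    · refine lt_of_le_of_lt (le_of_eq ?_) ((hlt n).trans hn2)
      refine eLpNorm_congr_norm_ae (Eventually.of_forall fun y => ?_)
      rw [grad_planeWave_mul (hφ n).smooth, ← smul_sub, norm_smul, norm_planeWave, one_mul]
  · rw [← h.weak φ hφ]
    congr 1
    ext1 y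
    rw [grad_planeWave_mul hφ.smooth, ← smul_add, rmul_smul, inner_planeWave_smul_smul]

/-- The weighted twisted gradients. -/
noncomputable def weightedGradients (A : R3 → Matrix (Fin 3) (Fin 3) ℝ) (κ : R3) :
    Submodule ℂ (Lp C3 2 cellMeasure) where
  carrier := {f | ∃ φ, IsPeriodicTest volume φ ∧
    f =ᵐ[cellMeasure] fun y => rmul (msqrt (A y))⁻¹ (twistedGrad κ φ y)}
  add_mem' := by
    rintro f f' ⟨φ, hφ, hf⟩ ⟨φ', hφ', hf'⟩
    refine ⟨_, hφ.add hφ', ?_⟩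
    filter_upwards [hf, hf', Lp.coeFn_add f f'] with y h1 h2 h3
    rw [h3, Pi.add_apply, h1, h2, twistedGrad_add hφ.smooth hφ'.smooth, rmul_add]
  zero_mem' := by
    refine ⟨fun _ => 0, ⟨contDiff_const, fun _ _ => rfl, by simp⟩, ?_⟩
    filter_upwards [Lp.coeFn_zero C3 2 cellMeasure] with y hy
    rw [hy]
    have : twistedGrad κ (fun _ => 0) y = 0 := by
      have h := twistedGrad_const_mul (φ := fun _ => 0) contDiff_const 0 κ y
      simpa using h
    rw [this, rmul_zero]
    rfl
  smul_mem' := by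
    rintro t f ⟨φ, hφ, hf⟩
    refine ⟨_, hφ.const_mul t, ?_⟩
    filter_upwards [hf, Lp.coeFn_smul t f] with y h1 h2
    rw [h2, Pi.smul_apply, h1, twistedGrad_const_mul hφ.smooth, rmul_smul]

/-- Correctors exist. -/
lemma exists_isCorrector (hA : IsCoefficient A) (κ : R3) (c : C3) : ∃ q, IsCorrector A κ c q := by
  obtain ⟨α, β, hb⟩ := hA.exists_bounds
  have hSc := continuous_msqrt hA.continuous hA.posDef
  have hS : ∀ y, IsUnit (msqrt (A y)).det := fun y => isUnit_det_msqrt (hA.posDef y)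
  have hc2 : MemLp (fun y => rmul (msqrt (A y))⁻¹ c) 2 cellMeasure :=
    memLp_rmul hA.continuous_msqrt_inv hb.sqrt_inv_le (memLp_const c)
  set K := (weightedGradients A κ).topologicalClosure
  -- With the weight `A^{-1/2}` the cell problem is an orthogonal projection: `P` is the projection
  -- of `-A^{-1/2} c` onto the closed span of weighted twisted gradients, `q = A^{1/2} P`, and the
  -- weak equation is the orthogonality of the residual.
  set P := K.starProjection (-hc2.toLp)
  have hPm : MemLp P 2 cellMeasure := Lp.memLp P
  have hqm : MemLp (fun y => rmul (msqrt (A y)) (P y)) 2 cellMeasure :=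
    memLp_rmul hSc hb.sqrt_le hPm
  refine ⟨_, hqm, fun δ hδ => ?_, fun φ hφ => ?_⟩
  · have hPK : P ∈ closure (weightedGradients A κ : Set (Lp C3 2 cellMeasure)) :=
      K.starProjection_apply_mem _
    obtain ⟨f, ⟨φ, hφ, hf⟩, hlt⟩ := EMetric.mem_closure_iff.1 hPK (δ / ENNReal.ofReal β)
      (ENNReal.div_pos hδ.ne' ENNReal.ofReal_ne_top)
    refine ⟨φ, hφ, lt_of_le_of_lt ?_ (ENNReal.mul_lt_of_lt_div' hlt)⟩
    rw [Lp.edist_def]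
    refine eLpNorm_le_mul_eLpNorm_of_ae_le_mul ?_ 2
    filter_upwards [hf] with y hy
    rw [Pi.sub_apply, hy]
    conv_lhs => rw [← rmul_mul_inv_cancel (hS y) (twistedGrad κ φ y), ← rmul_sub]
    exact hb.sqrt_le y _
  · have hTm : MemLp (fun y => rmul (msqrt (A y))⁻¹ (twistedGrad κ φ y)) 2 cellMeasure :=
      memLp_rmul hA.continuous_msqrt_inv hb.sqrt_inv_le (hφ.memLp_twistedGrad κ)
    have hTK : hTm.toLp ∈ K :=
      (weightedGradients A κ).le_topologicalClosure ⟨φ, hφ, hTm.coeFn_toLp⟩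
    have h0 := K.sub_starProjection_mem_orthogonal (-hc2.toLp) _ hTK
    rw [L2.inner_def, ← neg_eq_zero, ← integral_neg] at h0
    rw [← h0]
    refine integral_congr_ae ?_
    filter_upwards [hTm.coeFn_toLp, hc2.coeFn_toLp, Lp.coeFn_sub (-hc2.toLp) P,
      Lp.coeFn_neg hc2.toLp] with y h1 h2 h3 h4
    rw [h1, h3, Pi.sub_apply, h4, Pi.neg_apply, h2, inner_rmul_left (msqrt_isHermitian _).inv,
      ← inner_neg_right, ← rmul_inv_msqrt (hA.posDef y), ← rmul_neg,
      ← rmul_neg, neg_sub, sub_neg_eq_add, rmul_add (msqrt (A y)),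
      rmul_mul_inv_cancel (hS y)]

end

/-! ### Properties of correctors -/

lemma inner_cellCoeff_left {f : R3 → C3} (hf : MemLp f 2 cellMeasure) (m : Fin 3 → ℤ) (v : C3) :
    inner ℂ (cellCoeff m f) v = ∫ y in unitCell, inner ℂ (f y) (planeWave (mode m) y • v) := by
  rw [← inner_conj_symm, cellCoeff, ← integral_inner (integrable_cellCoeff hf m), ← integral_conj]
  congr 1
  ext1 y
  rw [inner_conj_symm, inner_smul_left, inner_smul_right, RingHomCompTriple.comp_apply]
  simp

lemma inner_cellCoeff_right {f : R3 → C3} (hf : MemLp f 2 cellMeasure) (m : Fin 3 → ℤ) (v : C3) :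
    inner ℂ v (cellCoeff m f) = ∫ y in unitCell, inner ℂ (planeWave (mode m) y • v) (f y) := by
  rw [cellCoeff, ← integral_inner (integrable_cellCoeff hf m)]
  congr 1
  ext1 y
  rw [inner_smul_left, inner_smul_right]

namespace IsCorrector

variable {A : R3 → Matrix (Fin 3) (Fin 3) ℝ} {κ : R3} {c c' : C3} {q q' : R3 → C3} {α β : ℝ}

lemma add (hA : IsCoefficient A) (h : IsCorrector A κ c q) (h' : IsCorrector A κ c' q') :
    IsCorrector A κ (c + c') fun y => q y + q' y := by
  obtain ⟨α, β, hb⟩ := hA.exists_bounds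
  refine ⟨h.mem.add h'.mem, fun δ hδ => ?_, fun φ hφ => ?_⟩
  · obtain ⟨φ, hφ, h1⟩ := h.closure (δ / 2) (ENNReal.half_pos hδ.ne')
    obtain ⟨φ', hφ', h2⟩ := h'.closure (δ / 2) (ENNReal.half_pos hδ.ne')
    refine ⟨_, hφ.add hφ', ?_⟩
    have e : (fun y => q y + q' y - twistedGrad κ (fun y => φ y + φ' y) y) =
        (fun y => q y - twistedGrad κ φ y) + fun y => q' y - twistedGrad κ φ' y := by
      ext1 y
      rw [twistedGrad_add hφ.smooth hφ'.smooth, Pi.add_apply]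
      abel
    rw [e, ← ENNReal.add_halves δ]
    exact (eLpNorm_add_le (h.mem.sub (hφ.memLp_twistedGrad κ)).1
      (h'.mem.sub (hφ'.memLp_twistedGrad κ)).1 one_le_two).trans_lt (ENNReal.add_lt_add h1 h2)
  · have hm : ∀ {c : C3} {q : R3 → C3}, MemLp q 2 cellMeasure →
        MemLp (fun y => rmul (A y)⁻¹ (q y + c)) 2 cellMeasure := fun {c q} hq =>
      memLp_rmul hA.continuous_inv hb.inv_le (hq.add (memLp_const c))
    have e : ∀ y, q y + q' y + (c + c') = (q y + c) + (q' y + c') := fun y => by abel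
    simp only [e, rmul_add _ (q _ + c), inner_add_right]
    rw [integral_add (integrable_inner_C3 (hφ.memLp_twistedGrad κ) (hm h.mem))
      (integrable_inner_C3 (hφ.memLp_twistedGrad κ) (hm h'.mem)), h.weak φ hφ, h'.weak φ hφ, add_zero]

lemma smul (h : IsCorrector A κ c q) (t : ℂ) : IsCorrector A κ (t • c) fun y => t • q y := by
  refine ⟨h.mem.const_smul t, fun δ hδ => ?_, fun φ hφ => ?_⟩
  · obtain ⟨φ, hφ, h1⟩ := h.closure (δ / (‖t‖ₑ + 1)) (ENNReal.div_pos hδ.ne' (by finiteness))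
    refine ⟨_, hφ.const_mul t, ?_⟩
    have e : (fun y => t • q y - twistedGrad κ (fun y => t * φ y) y) =
        t • fun y => q y - twistedGrad κ φ y := by
      ext1 y
      rw [twistedGrad_const_mul hφ.smooth, Pi.smul_apply, smul_sub]
    rw [e, eLpNorm_const_smul]
    refine lt_of_le_of_lt ?_ (ENNReal.mul_lt_of_lt_div' h1)
    gcongr
    exact le_self_add
  · have := h.weak φ hφ
    simp only [← smul_add, rmul_smul, inner_smul_right]
    rw [integral_const_mul, this, mul_zero]

/-- Functions orthogonal to all twisted gradients are orthogonal to correctors. -/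
lemma integral_inner_eq_zero (h : IsCorrector A κ c q) {s : R3 → C3} (hs : MemLp s 2 cellMeasure)
    (h0 : ∀ φ, IsPeriodicTest volume φ → ∫ y in unitCell, inner ℂ (twistedGrad κ φ y) (s y) = 0) :
    ∫ y in unitCell, inner ℂ (q y) (s y) = 0 := by
  have key : ∀ {f : R3 → C3} (hf : MemLp f 2 cellMeasure),
      inner ℂ hf.toLp hs.toLp = ∫ y in unitCell, inner ℂ (f y) (s y) := fun {f} hf => by
    rw [L2.inner_def]
    refine integral_congr_ae ?_
    filter_upwards [hf.coeFn_toLp, hs.coeFn_toLp] with y h1 h2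
    rw [h1, h2]
  have hcl : IsClosed {f : Lp C3 2 cellMeasure | inner ℂ f hs.toLp = 0} :=
    isClosed_eq (continuous_id.inner continuous_const) continuous_const
  have hmem : h.mem.toLp ∈ _root_.closure {f : Lp C3 2 cellMeasure | inner ℂ f hs.toLp = 0} := by
    refine EMetric.mem_closure_iff.2 fun δ hδ => ?_
    obtain ⟨φ, hφ, hlt⟩ := h.closure δ hδ
    refine ⟨(hφ.memLp_twistedGrad κ).toLp, (key _).trans (h0 φ hφ), ?_⟩
    rw [Lp.edist_toLp_toLp]
    exact hlt
  rw [hcl.closure_eq] at hmem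
  exact (key h.mem).symm.trans hmem

lemma memLp_add_const (h : IsCorrector A κ c q) : MemLp (fun y => q y + c) 2 cellMeasure :=
  h.mem.add (memLp_const c)

lemma memLp_flux (h : IsCorrector A κ c q) (hA : IsCoefficient A) :
    MemLp (fun y => rmul (A y)⁻¹ (q y + c)) 2 cellMeasure := by
  obtain ⟨α, β, hb⟩ := hA.exists_bounds
  exact memLp_rmul hA.continuous_inv hb.inv_le h.memLp_add_const

/-- The zeroth coefficient of a twisted gradient is the mean of the test function times `iκ`, hence
zero, and this passes to the closure. -/
lemma cellCoeff_zero (h : IsCorrector A κ c q)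
    (hgrad : ∀ (j : Fin 3) (φ : R3 → ℂ), ContDiff ℝ ∞ φ → IsPeriodic φ →
      ∫ y in unitCell, pderiv j φ y = 0) : cellCoeff 0 q = 0 := by
  refine ext_inner_right ℂ fun v => ?_
  rw [inner_cellCoeff_left h.mem, inner_zero_left]
  refine h.integral_inner_eq_zero (memLp_planeWave_smul (memLp_const v) _) fun φ hφ => ?_
  have h0 : cellCoeff 0 φ = 0 := by
    simpa [cellCoeff, mode_zero, planeWave_zero_left] using hφ.mean_zero
  rw [← inner_cellCoeff_left (hφ.memLp_twistedGrad κ), cellCoeff_twistedGrad hgrad hφ, h0, zero_smul,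
    inner_zero_left]

/-- The `m`-th coefficient of a twisted gradient is parallel to `κ + mode m`, a property stable
under limits. This is the reason why correctors are invisible to the curl. -/
lemma cross_cellCoeff (h : IsCorrector A κ c q)
    (hgrad : ∀ (j : Fin 3) (φ : R3 → ℂ), ContDiff ℝ ∞ φ → IsPeriodic φ →
      ∫ y in unitCell, pderiv j φ y = 0) (m : Fin 3 → ℤ) :
    cmul (crossMatrix (κ + mode m)) (cellCoeff m q) = 0 := by
  refine ext_inner_right ℂ fun v => ?_
  rw [inner_cross_left, inner_cellCoeff_left h.mem, inner_zero_left]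
  refine h.integral_inner_eq_zero (memLp_planeWave_smul (memLp_const _) _) fun φ hφ => ?_
  rw [← inner_cellCoeff_left (hφ.memLp_twistedGrad κ), cellCoeff_twistedGrad hgrad hφ, smul_smul,
    ← inner_cross_left, cross_cvec, inner_zero_left]

/-- Test the cell problem with the plane wave of mode `m`; it has zero mean exactly when `m ≠ 0`. -/
lemma inner_cellCoeff_flux (h : IsCorrector A κ c q) (hA : IsCoefficient A) {m : Fin 3 → ℤ}
    (hm : m ≠ 0) :
    inner ℂ (cvec (κ + mode m)) (cellCoeff m fun y => rmul (A y)⁻¹ (q y + c)) = 0 := by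
  have h1 := h.weak _ (IsPeriodicTest.planeWave_mode hm)
  simp only [twistedGrad_planeWave] at h1
  rw [← inner_cellCoeff_right (h.memLp_flux hA), inner_smul_left] at h1
  exact (mul_eq_zero.1 h1).resolve_left (by simp)

lemma integral_inner_flux (h : IsCorrector A κ c q) (hA : IsCoefficient A) :
    ∫ y in unitCell, inner ℂ (q y) (rmul (A y)⁻¹ (q y + c)) = 0 :=
  h.integral_inner_eq_zero (h.memLp_flux hA) h.weak

/-- The flux is orthogonal to `q`. The quadratic form of the homogenised matrix is therefore the
energy of `q + c`, which makes it real and coercive. -/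
lemma integral_inner_add_flux (h : IsCorrector A κ c q) (hA : IsCoefficient A) :
    ∫ y in unitCell, inner ℂ (q y + c) (rmul (A y)⁻¹ (q y + c)) =
      inner ℂ c (cellCoeff 0 fun y => rmul (A y)⁻¹ (q y + c)) := by
  simp only [inner_add_left]
  rw [integral_add (integrable_inner_C3 h.mem (h.memLp_flux hA))
    (integrable_inner_C3 (memLp_const c) (h.memLp_flux hA)), h.integral_inner_flux hA, zero_add,
    inner_cellCoeff_right (h.memLp_flux hA)]
  simp only [mode_zero, planeWave_zero_left, one_smul]

lemma cellCoeff_zero_add_const (h : IsCorrector A κ c q)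
    (hgrad : ∀ (j : Fin 3) (φ : R3 → ℂ), ContDiff ℝ ∞ φ → IsPeriodic φ →
      ∫ y in unitCell, pderiv j φ y = 0) : cellCoeff 0 (fun y => q y + c) = c := by
  rw [cellCoeff_add h.mem (memLp_const c), h.cellCoeff_zero hgrad, cellCoeff_const, if_pos rfl, zero_add]

lemma norm_sq_le (h : IsCorrector A κ c q)
    (hgrad : ∀ (j : Fin 3) (φ : R3 → ℂ), ContDiff ℝ ∞ φ → IsPeriodic φ →
      ∫ y in unitCell, pderiv j φ y = 0) : ‖c‖ ^ 2 ≤ ∫ y in unitCell, ‖q y + c‖ ^ 2 := by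
  have := norm_cellCoeff_sq_le h.memLp_add_const 0
  rwa [h.cellCoeff_zero_add_const hgrad] at this

lemma integral_norm_flux_sq_le (h : IsCorrector A κ c q) (hA : IsCoefficient A)
    (hb : CoeffBounds A α β) :
    ∫ y in unitCell, ‖rmul (A y)⁻¹ (q y + c)‖ ^ 2 ≤ β ^ 2 * ∫ y in unitCell, ‖q y + c‖ ^ 2 := by
  rw [← integral_const_mul]
  refine integral_mono ((h.memLp_flux hA).integrable_norm_pow two_ne_zero)
    ((h.memLp_add_const.integrable_norm_pow two_ne_zero).const_mul _) fun y => ?_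
  simp only [← mul_pow]
  gcongr
  exact hb.inv_le y _

lemma mul_integral_norm_sq_le (h : IsCorrector A κ c q) (hA : IsCoefficient A)
    (hb : CoeffBounds A α β) :
    α * ∫ y in unitCell, ‖q y + c‖ ^ 2 ≤
      (inner ℂ c (cellCoeff 0 fun y => rmul (A y)⁻¹ (q y + c))).re := by
  rw [← h.integral_inner_add_flux hA, ← integral_const_mul]
  have hi := integrable_inner_C3 h.memLp_add_const (h.memLp_flux hA)
  have hre := integral_re hi
  simp only [RCLike.re_to_complex] at hre
  rw [← hre]
  exact integral_mono ((h.memLp_add_const.integrable_norm_pow two_ne_zero).const_mul _) hi.re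
    fun y => hb.lower y _

/-- Write `N` for the integral. Energy and Cauchy–Schwarz give `α N ≤ ‖c‖ β √N`; square and divide
by `N` when it is nonzero. The constant does not depend on `κ`. -/
lemma integral_norm_sq_le (h : IsCorrector A κ c q) (hA : IsCoefficient A)
    (hb : CoeffBounds A α β) : ∫ y in unitCell, ‖q y + c‖ ^ 2 ≤ (β / α) ^ 2 * ‖c‖ ^ 2 := by
  have h1 := h.mul_integral_norm_sq_le hA hb
  have h2 := (norm_cellCoeff_sq_le (h.memLp_flux hA) 0).trans (h.integral_norm_flux_sq_le hA hb)
  have hα := hb.pos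
  have h3 := (h1.trans (Complex.re_le_norm _)).trans (norm_inner_le_norm _ _)
  set N := ∫ y in unitCell, ‖q y + c‖ ^ 2
  set s := ‖cellCoeff 0 fun y => rmul (A y)⁻¹ (q y + c)‖
  have hN : 0 ≤ N := integral_nonneg fun y => by positivity
  rw [div_pow, div_mul_eq_mul_div, le_div_iff₀ (by positivity)]
  rcases hN.eq_or_lt with h0 | h0
  · rw [← h0, zero_mul]; positivity
  have h4 : (α * N) ^ 2 ≤ ‖c‖ ^ 2 * (β ^ 2 * N) := by
    refine (pow_le_pow_left₀ (mul_nonneg hα.le hN) h3 2).trans ?_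
    rw [mul_pow]
    gcongr
  refine le_of_mul_le_mul_right ?_ h0
  linarith

/-- The energy of a test function in the cell problem. -/
lemma integral_re_inner_twistedGrad (h : IsCorrector A κ c q) (hA : IsCoefficient A) {φ : R3 → ℂ}
    (hφ : IsPeriodicTest volume φ) :
    ∫ y in unitCell, (inner ℂ (twistedGrad κ φ y + c) (rmul (A y)⁻¹ (twistedGrad κ φ y + c))).re =
      (inner ℂ c (cellCoeff 0 fun y => rmul (A y)⁻¹ (q y + c))).re +
      ∫ y in unitCell, (inner ℂ (q y - twistedGrad κ φ y)
        (rmul (A y)⁻¹ (q y - twistedGrad κ φ y))).re := by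
  obtain ⟨α, β, hb⟩ := hA.exists_bounds
  have hT := hφ.memLp_twistedGrad κ
  have hd : MemLp (fun y => q y - twistedGrad κ φ y) 2 cellMeasure := h.mem.sub hT
  have hσ := h.memLp_flux hA
  have i1 := (integrable_inner_C3 h.memLp_add_const hσ).re
  have i2 := (integrable_inner_C3 hd (memLp_rmul hA.continuous_inv hb.inv_le hd)).re
  have i3 := (integrable_inner_C3 hd hσ).re
  -- The flux is orthogonal to every twisted gradient and to `q`, so the cross term vanishes and
  -- Pythagoras holds in the energy.
  have h3 : ∫ y in unitCell, (inner ℂ (q y - twistedGrad κ φ y) (rmul (A y)⁻¹ (q y + c))).re = 0 := by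
    have hre := integral_re (integrable_inner_C3 hd hσ)
    simp only [RCLike.re_to_complex] at hre
    rw [hre]
    simp only [inner_sub_left]
    rw [integral_sub (integrable_inner_C3 h.mem hσ) (integrable_inner_C3 hT hσ),
      h.integral_inner_flux hA, h.weak φ hφ, sub_zero, Complex.zero_re]
  have h1 := integral_re (integrable_inner_C3 h.memLp_add_const hσ)
  simp only [RCLike.re_to_complex] at h1 i1 i2 i3
  have pt : ∀ y, (inner ℂ (twistedGrad κ φ y + c) (rmul (A y)⁻¹ (twistedGrad κ φ y + c))).re =
      (inner ℂ (q y + c) (rmul (A y)⁻¹ (q y + c))).re + (inner ℂ (q y - twistedGrad κ φ y)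
        (rmul (A y)⁻¹ (q y - twistedGrad κ φ y))).re -
        2 * (inner ℂ (q y - twistedGrad κ φ y) (rmul (A y)⁻¹ (q y + c))).re := fun y => by
    set r := q y - twistedGrad κ φ y
    set s := q y + c
    have e : twistedGrad κ φ y + c = s - r := by simp only [r, s]; abel
    have hsymm : (inner ℂ s (rmul (A y)⁻¹ r)).re = (inner ℂ r (rmul (A y)⁻¹ s)).re := by
      rw [← inner_rmul_left (posDef_inv_isHermitian (hA.posDef y)), ← inner_conj_symm, Complex.conj_re]
    rw [e, rmul_sub, inner_sub_left, inner_sub_right, inner_sub_right]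
    simp only [Complex.sub_re, hsymm]
    ring
  simp only [pt]
  have i4 : Integrable (fun y => (inner ℂ (q y + c) (rmul (A y)⁻¹ (q y + c))).re +
      (inner ℂ (q y - twistedGrad κ φ y) (rmul (A y)⁻¹ (q y - twistedGrad κ φ y))).re) cellMeasure :=
    i1.add i2
  rw [integral_sub i4 (i3.const_mul 2), integral_const_mul, h3, mul_zero, sub_zero,
    ← h.integral_inner_add_flux hA, ← h1]
  exact integral_add i1 i2

/-- The energy of a corrector is the infimum of the energies of the test functions. -/
lemma re_inner_lt_iff (h : IsCorrector A κ c q) (hA : IsCoefficient A) (t : ℝ) :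
    (inner ℂ c (cellCoeff 0 fun y => rmul (A y)⁻¹ (q y + c))).re < t ↔
      ∃ φ, IsPeriodicTest volume φ ∧ ∫ y in unitCell,
        (inner ℂ (twistedGrad κ φ y + c) (rmul (A y)⁻¹ (twistedGrad κ φ y + c))).re < t := by
  obtain ⟨α, β, hb⟩ := hA.exists_bounds
  constructor
  · intro ht
    set e := t - (inner ℂ c (cellCoeff 0 fun y => rmul (A y)⁻¹ (q y + c))).re with he
    have hepos : 0 < e := sub_pos.2 ht
    have hβ := hb.pos'
    -- The energy of the difference is at most `β` times its squared norm, so this tolerance keeps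
    -- the excess energy below `e`.
    obtain ⟨φ, hφ, hlt⟩ := h.closure (ENNReal.ofReal (√(e / β))) (by positivity)
    refine ⟨φ, hφ, ?_⟩
    have hd : MemLp (fun y => q y - twistedGrad κ φ y) 2 cellMeasure :=
      h.mem.sub (hφ.memLp_twistedGrad κ)
    have h2 : ∫ y in unitCell, ‖q y - twistedGrad κ φ y‖ ^ 2 < e / β := by
      have := ENNReal.pow_right_strictMono two_ne_zero hlt
      simp only at this
      rw [integral_norm_sq_eq hd, ← ENNReal.ofReal_pow (by positivity), Real.sq_sqrt (by positivity),
        ENNReal.ofReal_lt_ofReal_iff (by positivity)] at this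
      exact this
    have h3 : ∫ y in unitCell, (inner ℂ (q y - twistedGrad κ φ y)
        (rmul (A y)⁻¹ (q y - twistedGrad κ φ y))).re ≤
        β * ∫ y in unitCell, ‖q y - twistedGrad κ φ y‖ ^ 2 := by
      rw [← integral_const_mul]
      refine integral_mono (integrable_inner_C3 hd (memLp_rmul hA.continuous_inv hb.inv_le hd)).re
        ((hd.integrable_norm_pow two_ne_zero).const_mul _) fun y => ?_
      refine ((Complex.re_le_norm _).trans (norm_inner_le_norm _ _)).trans ?_
      have := hb.inv_le y (q y - twistedGrad κ φ y)
      nlinarith [norm_nonneg (q y - twistedGrad κ φ y)]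
    rw [h.integral_re_inner_twistedGrad hA hφ]
    rw [lt_div_iff₀ hβ] at h2
    linarith
  · rintro ⟨φ, hφ, hlt⟩
    rw [h.integral_re_inner_twistedGrad hA hφ] at hlt
    have : 0 ≤ ∫ y in unitCell, (inner ℂ (q y - twistedGrad κ φ y)
        (rmul (A y)⁻¹ (q y - twistedGrad κ φ y))).re := by
      refine integral_nonneg fun y => le_trans ?_ (hb.lower y _)
      have := hb.pos
      positivity
    linarith

lemma im_inner_eq_zero (h : IsCorrector A κ c q) (hA : IsCoefficient A) :
    (inner ℂ c (cellCoeff 0 fun y => rmul (A y)⁻¹ (q y + c))).im = 0 := by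
  rw [← h.integral_inner_add_flux hA, ← Complex.conj_eq_iff_im, ← integral_conj]
  congr 1
  ext1 y
  rw [inner_conj_symm, inner_rmul_left (posDef_inv_isHermitian (hA.posDef y))]

end IsCorrector

/-- For a fixed test function, `κ` enters the twisted gradient only through `φ iκ`, so the integrand
is dominated uniformly for `κ` in a unit ball around `κ₀`. -/
lemma continuous_integral_re_inner_twistedGrad {A : R3 → Matrix (Fin 3) (Fin 3) ℝ}
    (hA : IsCoefficient A) {φ : R3 → ℂ} (hφ : IsPeriodicTest volume φ) (c : C3) :
    Continuous fun κ : R3 => ∫ y in unitCell,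
      (inner ℂ (twistedGrad κ φ y + c) (rmul (A y)⁻¹ (twistedGrad κ φ y + c))).re := by
  obtain ⟨α, β, hb⟩ := hA.exists_bounds
  have hβ := hb.pos'
  have hjc : Continuous fun z : R3 × R3 => twistedGrad z.1 φ z.2 + c :=
    (((continuous_grad hφ.smooth).comp continuous_snd).add ((hφ.smooth.continuous.comp
      continuous_snd).smul (continuous_I_smul_cvec.comp continuous_fst))).add continuous_const
  have hja : Continuous fun z : R3 × R3 => rmul (A z.2)⁻¹ (twistedGrad z.1 φ z.2 + c) :=
    continuous_rmul_apply (hA.continuous_inv.comp continuous_snd) hjc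
  have hj : Continuous fun z : R3 × R3 => (inner ℂ (twistedGrad z.1 φ z.2 + c)
      (rmul (A z.2)⁻¹ (twistedGrad z.1 φ z.2 + c))).re := Complex.continuous_re.comp (hjc.inner hja)
  refine continuous_iff_continuousAt.2 fun κ₀ => ?_
  have hgm := memLp_cell_of_isPeriodic (continuous_grad hφ.smooth) (isPeriodic_grad hφ.periodic)
  have hbound : MemLp (fun y => ‖grad φ y‖ + ‖φ y‖ * (‖κ₀‖ + 1) + ‖c‖) 2 cellMeasure :=
    (hgm.norm.add (hφ.memLp.norm.mul_const _)).add (memLp_const _)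
  refine continuousAt_of_dominated
    (bound := fun y => β * ‖‖grad φ y‖ + ‖φ y‖ * (‖κ₀‖ + 1) + ‖c‖‖ ^ 2)
    (Eventually.of_forall fun κ => (hj.comp (f := fun y => (κ, y)) (by fun_prop)).aestronglyMeasurable)
    ?_ ((hbound.integrable_norm_pow two_ne_zero).const_mul β)
    (Eventually.of_forall fun y => (hj.comp (f := fun κ => (κ, y)) (by fun_prop)).continuousAt)
  filter_upwards [Metric.ball_mem_nhds κ₀ one_pos] with κ hκ
  refine Eventually.of_forall fun y => ?_
  have h1 : ‖twistedGrad κ φ y + c‖ ≤ ‖‖grad φ y‖ + ‖φ y‖ * (‖κ₀‖ + 1) + ‖c‖‖ := by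
    rw [Real.norm_of_nonneg (by positivity)]
    refine (norm_add_le _ _).trans ?_
    gcongr
    refine (norm_add_le _ _).trans ?_
    rw [norm_smul, norm_smul, Complex.norm_I, one_mul, norm_cvec]
    gcongr
    have h2 : ‖κ - κ₀‖ < 1 := mem_ball_iff_norm.1 hκ
    have h3 := norm_add_le κ₀ (κ - κ₀)
    rw [add_sub_cancel] at h3
    linarith
  refine (Complex.abs_re_le_norm _).trans ((norm_inner_le_norm _ _).trans ?_)
  have h4 := hb.inv_le y (twistedGrad κ φ y + c)
  calc _ ≤ ‖twistedGrad κ φ y + c‖ * (β * ‖twistedGrad κ φ y + c‖) := by gcongr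
    _ = β * ‖twistedGrad κ φ y + c‖ ^ 2 := by ring
    _ ≤ _ := by gcongr

/-! ### The homogenised matrix -/

section

variable {A : R3 → Matrix (Fin 3) (Fin 3) ℝ} {Ψ : R3 → Fin 3 → R3 → ℂ} {P : R3 → Fin 3 → R3 → C3}
  {α β : ℝ}

/-- The corrector for an arbitrary vector, and its mean flux. -/
lemma IsCellFamily.exists_isCorrector (hA : IsCoefficient A) (hP : IsCellFamily A volume Ψ P) (κ : R3)
    (c : C3) : ∃ q, IsCorrector A κ c q ∧
      cmul (homMatrix A volume κ (P κ)) c = cellCoeff 0 fun y => rmul (A y)⁻¹ (q y + c) := by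
  have hj := fun j => (hP κ j).isCorrector
  set Q : Fin 3 → R3 → C3 := fun j y => (starRingEnd ℂ) (planeWave κ y) • P κ j y with hQ
  have hc : c 0 • EuclideanSpace.single 0 1 + c 1 • EuclideanSpace.single 1 1 +
      c 2 • EuclideanSpace.single 2 1 = c := by
    ext i
    fin_cases i <;> simp
  have hq := (((hj 0).smul (c 0)).add hA ((hj 1).smul (c 1))).add hA ((hj 2).smul (c 2))
  rw [hc] at hq
  refine ⟨_, hq, ?_⟩
  have hσ := hq.memLp_flux hA
  ext i
  rw [cellCoeff_apply hσ]
  simp only [cellCoeff, mode_zero, planeWave_zero_left, map_one, one_smul]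
  have hi : ∀ j, Integrable (fun y => c j * rmul (A y)⁻¹ (Q j y + EuclideanSpace.single j 1) i)
      cellMeasure := fun j =>
    ((memLp_apply_C3 ((hj j).memLp_flux hA) i).integrable one_le_two).const_mul (c j)
  have hpt : ∀ y, rmul (A y)⁻¹ (c 0 • Q 0 y + c 1 • Q 1 y + c 2 • Q 2 y + c) i =
      c 0 * rmul (A y)⁻¹ (Q 0 y + EuclideanSpace.single 0 1) i +
      c 1 * rmul (A y)⁻¹ (Q 1 y + EuclideanSpace.single 1 1) i +
      c 2 * rmul (A y)⁻¹ (Q 2 y + EuclideanSpace.single 2 1) i := fun y => by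
    have e : c 0 • Q 0 y + c 1 • Q 1 y + c 2 • Q 2 y + c =
        c 0 • (Q 0 y + EuclideanSpace.single 0 1) + c 1 • (Q 1 y + EuclideanSpace.single 1 1) +
          c 2 • (Q 2 y + EuclideanSpace.single 2 1) := by
      simp only [smul_add]
      conv_lhs => rhs; rw [← hc]
      abel
    rw [e]
    simp only [rmul_add, rmul_smul, PiLp.add_apply, PiLp.smul_apply, smul_eq_mul]
  refine Eq.trans ?_ (integral_congr_ae (Eventually.of_forall fun y => (hpt y).symm))
  have hi01 : Integrable (fun y => c 0 * rmul (A y)⁻¹ (Q 0 y + EuclideanSpace.single 0 1) i +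
      c 1 * rmul (A y)⁻¹ (Q 1 y + EuclideanSpace.single 1 1) i) cellMeasure := (hi 0).add (hi 1)
  rw [integral_add hi01 (hi 2), integral_add (hi 0) (hi 1), integral_const_mul, integral_const_mul,
    integral_const_mul]
  simp only [cmul, Matrix.mulVec, dotProduct, Fin.sum_univ_three, homMatrix, Matrix.of_apply]
  ring

/-- The energy is at least `α ∫ ‖q + c‖²`, and `q + c` has mean `c`. The constant is independent of
`κ`. -/
lemma IsCellFamily.coercive (hA : IsCoefficient A) (hb : CoeffBounds A α β)
    (hgrad : ∀ (j : Fin 3) (φ : R3 → ℂ), ContDiff ℝ ∞ φ → IsPeriodic φ →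
      ∫ y in unitCell, pderiv j φ y = 0) (hP : IsCellFamily A volume Ψ P) (κ : R3) (c : C3) :
    α * ‖c‖ ^ 2 ≤ (inner ℂ c (cmul (homMatrix A volume κ (P κ)) c)).re := by
  obtain ⟨q, hq, hH⟩ := hP.exists_isCorrector hA κ c
  rw [hH]
  refine le_trans ?_ (hq.mul_integral_norm_sq_le hA hb)
  have := hb.pos
  gcongr
  exact hq.norm_sq_le hgrad

/-- The cell solutions are chosen separately for each `κ`, with no measurability in `κ`. The
quadratic form, however, is the infimum over a `κ`-independent set of test functions of energies
continuous in `κ`, so its sublevel sets are open even though the family is uncountable. -/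
lemma IsCellFamily.measurable_inner_self (hA : IsCoefficient A) (hP : IsCellFamily A volume Ψ P)
    (c : C3) : Measurable fun κ => inner ℂ c (cmul (homMatrix A volume κ (P κ)) c) := by
  have hre : Measurable fun κ => (inner ℂ c (cmul (homMatrix A volume κ (P κ)) c)).re := by
    refine measurable_of_Iio fun t => ?_
    have : (fun κ => (inner ℂ c (cmul (homMatrix A volume κ (P κ)) c)).re) ⁻¹' Set.Iio t =
        ⋃ (φ : R3 → ℂ) (_ : IsPeriodicTest volume φ), (fun κ => ∫ y in unitCell,
          (inner ℂ (twistedGrad κ φ y + c) (rmul (A y)⁻¹ (twistedGrad κ φ y + c))).re) ⁻¹'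
            Set.Iio t := by
      ext κ
      obtain ⟨q, hq, hH⟩ := hP.exists_isCorrector hA κ c
      simp only [Set.mem_preimage, Set.mem_Iio, Set.mem_iUnion, exists_prop, hH]
      exact hq.re_inner_lt_iff hA t
    rw [this]
    exact (isOpen_iUnion fun φ => isOpen_iUnion fun hφ =>
      isOpen_Iio.preimage (continuous_integral_re_inner_twistedGrad hA hφ c)).measurableSet
  have him : ∀ κ, inner ℂ c (cmul (homMatrix A volume κ (P κ)) c) =
      ((inner ℂ c (cmul (homMatrix A volume κ (P κ)) c)).re : ℂ) := fun κ => by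
    obtain ⟨q, hq, hH⟩ := hP.exists_isCorrector hA κ c
    refine Complex.ext (Complex.ofReal_re _).symm ?_
    rw [Complex.ofReal_im, hH, hq.im_inner_eq_zero hA]
  rw [funext him]
  exact Complex.measurable_ofReal.comp hre

lemma IsCellFamily.stronglyMeasurable_homMatrix (hA : IsCoefficient A)
    (hP : IsCellFamily A volume Ψ P) : StronglyMeasurable fun κ => homMatrix A volume κ (P κ) := by
  have hent : ∀ i j, Measurable fun κ => homMatrix A volume κ (P κ) i j := fun i j => by
    set x : C3 := EuclideanSpace.single i 1
    set y : C3 := EuclideanSpace.single j 1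
    have hm := hP.measurable_inner_self hA
    -- Polarisation recovers the entries from the quadratic form; the inner product is antilinear in
    -- its first argument, which fixes the signs of the terms with `I`.
    have hpol : ∀ κ, homMatrix A volume κ (P κ) i j =
        (inner ℂ (x + y) (cmul (homMatrix A volume κ (P κ)) (x + y)) -
          inner ℂ (x - y) (cmul (homMatrix A volume κ (P κ)) (x - y)) -
          Complex.I * inner ℂ (x + Complex.I • y) (cmul (homMatrix A volume κ (P κ)) (x + Complex.I • y)) +
          Complex.I * inner ℂ (x - Complex.I • y) (cmul (homMatrix A volume κ (P κ)) (x - Complex.I • y))) / 4 :=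
      fun κ => by
        set H := homMatrix A volume κ (P κ)
        have e : H i j = inner ℂ x (cmul H y) := by
          simp [x, y, cmul, EuclideanSpace.inner_single_left]
        rw [e]
        simp only [cmul_add, cmul_sub, cmul_smul, inner_add_left, inner_add_right, inner_sub_left,
          inner_sub_right, inner_smul_left, inner_smul_right, Complex.conj_I]
        ring_nf
        simp only [Complex.I_sq]
        ring
    rw [funext hpol]
    exact ((((hm _).sub (hm _)).sub ((hm _).const_mul _)).add ((hm _).const_mul _)).div_const 4
  have : Measurable fun (κ : R3) (i j : Fin 3) => homMatrix A volume κ (P κ) i j :=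
    measurable_pi_lambda _ fun i => measurable_pi_lambda _ fun j => hent i j
  exact this.stronglyMeasurable

instance : TopologicalSpace.PseudoMetrizableSpace (Matrix (Fin 3) (Fin 3) ℂ) :=
  inferInstanceAs (TopologicalSpace.PseudoMetrizableSpace (Fin 3 → Fin 3 → ℂ))

lemma stronglyMeasurable_matrix_inv {X : Type*} [MeasurableSpace X]
    {M : X → Matrix (Fin 3) (Fin 3) ℂ} (hM : StronglyMeasurable M) :
    StronglyMeasurable fun x => (M x)⁻¹ := by
  have : (fun x => (M x)⁻¹) = fun x => (M x).det⁻¹ • (M x).adjugate := by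
    ext1 x
    rw [Matrix.inv_def, Ring.inverse_eq_inv']
  rw [this]
  have hdet : StronglyMeasurable fun x => (M x).det :=
    (continuous_id.matrix_det).comp_stronglyMeasurable hM
  exact (hdet.measurable.inv.stronglyMeasurable).smul
    ((continuous_id.matrix_adjugate).comp_stronglyMeasurable hM)

lemma continuous_crossMatrix : Continuous crossMatrix := by
  refine continuous_matrix fun i j => ?_
  fin_cases i <;> fin_cases j <;>
    simp [crossMatrix, LinearMap.toMatrix'_apply, cross_apply] <;> fun_prop

lemma continuous_cmul : Continuous fun z : Matrix (Fin 3) (Fin 3) ℂ × C3 => cmul z.1 z.2 := by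
  unfold cmul
  fun_prop

lemma stronglyMeasurable_homSymbol {H : R3 → Matrix (Fin 3) (Fin 3) ℂ} (hH : StronglyMeasurable H) :
    StronglyMeasurable fun θ => homSymbol (H θ) θ := by
  have hHi := stronglyMeasurable_matrix_inv hH
  have hX : StronglyMeasurable crossMatrix := continuous_crossMatrix.stronglyMeasurable
  have hXX : StronglyMeasurable fun θ => crossMatrix θ * crossMatrix θ * (H θ)⁻¹ := (hX.mul hX).mul hHi
  have h1 : StronglyMeasurable fun θ => crossMatrix θ * crossMatrix θ * (H θ)⁻¹ + 1 :=
    hXX.add stronglyMeasurable_const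
  exact hHi.mul (stronglyMeasurable_matrix_inv h1)

lemma aestronglyMeasurable_cmul {M : R3 → Matrix (Fin 3) (Fin 3) ℂ} (hM : StronglyMeasurable M)
    {f : R3 → C3} (hf : AEStronglyMeasurable f volume) :
    AEStronglyMeasurable (fun θ => cmul (M θ) (f θ)) volume :=
  continuous_cmul.comp_aestronglyMeasurable (f := fun θ => (M θ, f θ))
    (hM.aestronglyMeasurable.prodMk hf)

lemma IsCellFamily.aestronglyMeasurable_homSymbol (hA : IsCoefficient A)
    (hP : IsCellFamily A volume Ψ P) (ε : ℝ) {f : R3 → C3} (hf : AEStronglyMeasurable f volume) :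
    AEStronglyMeasurable (fun θ => cmul (homSymbol (homMatrix A volume (ε • θ) (P (ε • θ))) θ) (f θ))
      volume := by
  have hH := (hP.stronglyMeasurable_homMatrix hA).comp_measurable (measurable_const_smul ε)
  exact aestronglyMeasurable_cmul (M := fun θ =>
    homSymbol (homMatrix A volume (ε • θ) (P (ε • θ))) θ) (stronglyMeasurable_homSymbol hH) hf

end

/-! ### The estimate on a fibre -/

lemma crossMatrix_smul (t : ℝ) (θ : R3) (v : C3) :
    cmul (crossMatrix (t • θ)) v = (t : ℂ) • cmul (crossMatrix θ) v := by
  rw [cmul_cross, cmul_cross]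
  ext i
  fin_cases i <;> simp <;> ring

lemma cvec_smul (t : ℝ) (θ : R3) : cvec (t • θ) = (t : ℂ) • cvec θ := by
  ext i
  simp [cvec]

/-- In a coordinate with `m i ≠ 0` the shift has size at least `2π`, while `|ε θ i| ≤ π`. -/
lemma pi_le_mul_norm_of_mem_dualCell {ε : ℝ} (hε : 0 < ε) {θ : R3} (hθ : θ ∈ dualCell ε)
    {m : Fin 3 → ℤ} (hm : m ≠ 0) : Real.pi ≤ ε * ‖θ + ε⁻¹ • mode m‖ := by
  obtain ⟨i, hi⟩ := Function.ne_iff.1 hm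
  have h1 := hθ i
  have hpi := Real.pi_pos
  have h2 : Real.pi ≤ |ε * θ i + 2 * Real.pi * m i| := by
    rcases lt_or_gt_of_ne hi with h | h
    · have : (m i : ℝ) ≤ -1 := by exact_mod_cast Int.le_sub_one_of_lt h
      rw [abs_of_nonpos] <;> nlinarith [h1.1, h1.2]
    · have : (1 : ℝ) ≤ m i := by exact_mod_cast h
      refine le_trans ?_ (le_abs_self _)
      nlinarith [h1.1, h1.2]
  have h3 : ε * (θ + ε⁻¹ • mode m) i = ε * θ i + 2 * Real.pi * m i := by
    simp only [mode, ivec, PiLp.add_apply, PiLp.smul_apply, smul_eq_mul]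
    field_simp
  rw [← h3, abs_mul, abs_of_pos hε] at h2
  refine h2.trans ?_
  gcongr
  exact PiLp.norm_apply_le (θ + ε⁻¹ • mode m) i

lemma smul_add_inv_smul {ε : ℝ} (hε : 0 < ε) (θ κ : R3) : ε • θ + κ = ε • (θ + ε⁻¹ • κ) := by
  rw [smul_add, smul_inv_smul₀ hε.ne']

section

variable {A : R3 → Matrix (Fin 3) (Fin 3) ℝ} {α β ε : ℝ} {θ : R3} {F G q : R3 → C3} {c : C3}

/-- The Fourier coefficients of the error on a fibre. -/
lemma norm_cross_sub_sq_le (hA : IsCoefficient A) (hb : CoeffBounds A α β)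
    (hgrad : ∀ (j : Fin 3) (φ : R3 → ℂ), ContDiff ℝ ∞ φ → IsPeriodic φ →
      ∫ y in unitCell, pderiv j φ y = 0) (hε : 0 < ε) (hθ : θ ∈ dualCell ε)
    (hF : MemLp F 2 cellMeasure) (hG : MemLp G 2 cellMeasure)
    (heq : ∀ m, cmul (crossMatrix (θ + ε⁻¹ • mode m)) (cmul (crossMatrix (θ + ε⁻¹ • mode m))
      (cellCoeff m F)) + (cellCoeff m (fun y => rmul (A y)⁻¹ (F y)) + cellCoeff m G) = 0)
    (hdiv : ∀ m, inner ℂ (cvec (θ + ε⁻¹ • mode m)) (cellCoeff m G) = 0)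
    (hq : IsCorrector A (ε • θ) c q)
    (hc : cmul (crossMatrix θ) (cmul (crossMatrix θ) c) +
      cellCoeff 0 (fun y => rmul (A y)⁻¹ (q y + c)) = -cellCoeff 0 G) (m : Fin 3 → ℤ) :
    ‖cmul (crossMatrix (θ + ε⁻¹ • mode m)) (cellCoeff m F - if m = 0 then c else 0)‖ ^ 2 ≤
      -2 * (inner ℂ (cellCoeff m fun y => F y - (q y + c))
        (cellCoeff m fun y => rmul (A y)⁻¹ (F y - (q y + c)))).re +
      (ε / Real.pi) ^ 2 * ‖cellCoeff m fun y => G y + rmul (A y)⁻¹ (q y + c)‖ ^ 2 := by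
  have hσ := hq.memLp_flux hA
  have haF : MemLp (fun y => rmul (A y)⁻¹ (F y)) 2 cellMeasure :=
    memLp_rmul hA.continuous_inv hb.inv_le hF
  set ξ := θ + ε⁻¹ • mode m with hξ
  have hκ : ε • θ + mode m = ε • ξ := smul_add_inv_smul hε θ (mode m)
  -- The corrector is taken at `κ = εθ`, so `κ + mode m` is `ε ξ`, parallel to the frequency of this
  -- mode.
  have hXq : cmul (crossMatrix ξ) (cellCoeff m q) = 0 := by
    have h1 := hq.cross_cellCoeff hgrad m
    rw [hκ, crossMatrix_smul] at h1
    exact (smul_eq_zero.1 h1).resolve_left (by exact_mod_cast hε.ne')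
  have hz : cellCoeff m (fun y => F y - (q y + c)) =
      cellCoeff m F - (cellCoeff m q + if m = 0 then c else 0) := by
    rw [cellCoeff_sub hF hq.memLp_add_const, cellCoeff_add hq.mem (memLp_const c), cellCoeff_const]
  have haz : cellCoeff m (fun y => rmul (A y)⁻¹ (F y - (q y + c))) =
      cellCoeff m (fun y => rmul (A y)⁻¹ (F y)) - cellCoeff m fun y => rmul (A y)⁻¹ (q y + c) := by
    simp only [rmul_sub]
    exact cellCoeff_sub haF hσ m
  have hX : cmul (crossMatrix ξ) (cellCoeff m F - if m = 0 then c else 0) =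
      cmul (crossMatrix ξ) (cellCoeff m fun y => F y - (q y + c)) := by
    rw [hz, cmul_sub, cmul_sub, cmul_add, hXq, zero_add]
  rw [hX, cellCoeff_add hG hσ]
  -- The equation for the error: `X X F_m` is replaced using `heq`, `q` drops out, and the constant
  -- `c` contributes only at `m = 0`.
  have hXX : cmul (crossMatrix ξ) (cmul (crossMatrix ξ) (cellCoeff m fun y => F y - (q y + c))) =
      -cellCoeff m (fun y => rmul (A y)⁻¹ (F y)) - cellCoeff m G -
        if m = 0 then cmul (crossMatrix ξ) (cmul (crossMatrix ξ) c) else 0 := by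
    rw [← hX, cmul_sub, cmul_sub, eq_neg_of_add_eq_zero_left (heq m)]
    split_ifs
    · abel
    · rw [cmul_zero, cmul_zero]; abel
  have hnorm := re_inner_cross_cross ξ (cellCoeff m fun y => F y - (q y + c))
  rw [hXX] at hnorm
  set z := cellCoeff m fun y => F y - (q y + c)
  rw [haz]
  set a := cellCoeff m fun y => rmul (A y)⁻¹ (F y)
  set s := cellCoeff m fun y => rmul (A y)⁻¹ (q y + c) with hs
  -- At `m = 0` the frequency may be arbitrarily small and no gain is available, but the choice of
  -- `c` cancels the source exactly.
  by_cases hm : m = 0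
  · have hξθ : ξ = θ := by rw [hξ, hm, mode_zero, smul_zero, add_zero]
    subst hm
    rw [if_pos rfl, hξθ] at hnorm
    have e : -a - cellCoeff 0 G - cmul (crossMatrix θ) (cmul (crossMatrix θ) c) = -(a - s) := by
      rw [eq_sub_of_add_eq hc]
      abel
    rw [e, inner_neg_right, Complex.neg_re] at hnorm
    rw [hξθ]
    have := sq_nonneg ‖cmul (crossMatrix θ) z‖
    have h2 : 0 ≤ (ε / Real.pi) ^ 2 * ‖cellCoeff 0 G + s‖ ^ 2 := by positivity
    linarith
  · rw [if_neg hm, sub_zero] at hnorm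
    -- For `m ≠ 0` both parts of the source are divergence free: `G` by hypothesis, the flux by the
    -- cell problem.
    have hr : inner ℂ (cvec ξ) (cellCoeff m G + s) = 0 := by
      have h1 := hq.inner_cellCoeff_flux hA hm
      rw [hκ, cvec_smul, inner_smul_left] at h1
      have h2 := (mul_eq_zero.1 h1).resolve_left (by simpa using hε.ne')
      rw [inner_add_right, hdiv m, h2, add_zero]
    have h1 := norm_mul_inner_le_of_inner_eq_zero ξ z _ hr
    set r := cellCoeff m G + s
    have e : -a - cellCoeff m G = -(a - s) - r := by simp only [r]; abel
    rw [e, inner_sub_right, inner_neg_right, Complex.sub_re, Complex.neg_re] at hnorm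
    have h2 := pi_le_mul_norm_of_mem_dualCell hε hθ hm
    have hpi := Real.pi_pos
    have h3 : ‖inner ℂ z r‖ ≤ (ε / Real.pi) * (‖cmul (crossMatrix ξ) z‖ * ‖r‖) := by
      rw [div_mul_eq_mul_div, le_div_iff₀ hpi]
      calc ‖inner ℂ z r‖ * Real.pi ≤ ‖inner ℂ z r‖ * (ε * ‖ξ‖) := by gcongr
        _ = ε * (‖ξ‖ * ‖inner ℂ z r‖) := by ring
        _ ≤ _ := by gcongr
    have h4 := (abs_le.1 ((Complex.abs_re_le_norm (inner ℂ z r)).trans h3)).1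
    -- Young's inequality absorbs half of the squared curl into the left side; hence the factor `2`
    -- in front of the energy term.
    nlinarith [sq_nonneg (‖cmul (crossMatrix ξ) z‖ - ε / Real.pi * ‖r‖)]

end

section

variable {A : R3 → Matrix (Fin 3) (Fin 3) ℝ} {Ψ : R3 → Fin 3 → R3 → ℂ} {P : R3 → Fin 3 → R3 → C3}
  {α β ε : ℝ} {θ : R3} {F G q : R3 → C3} {c : C3}

/-- The constant in the estimate of the error on a fibre. -/
noncomputable def fibreConst (α β : ℝ) : ℝ := 6 + 4 * (β ^ 2 * ((β / α) ^ 2 * α⁻¹ ^ 2))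

lemma fibreConst_pos (α β : ℝ) : 0 < fibreConst α β := by
  unfold fibreConst
  positivity

/-- This is where `fibreConst` comes from: `2 ‖G + σ‖² ≤ 4 ‖G‖² + 4 ‖σ‖²`, and `σ` is bounded
through `c` by `β (β/α) α⁻¹` times the norm of `G`. -/
lemma integral_norm_add_flux_sq_le (hA : IsCoefficient A) (hb : CoeffBounds A α β)
    (hG : MemLp G 2 cellMeasure) {κ : R3} (hq : IsCorrector A κ c q)
    (hc : ‖c‖ ≤ α⁻¹ * ‖cellCoeff 0 G‖) :
    2 * (∫ y in unitCell, ‖G y + rmul (A y)⁻¹ (q y + c)‖ ^ 2) + 2 * ∫ y in unitCell, ‖G y‖ ^ 2 ≤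
      fibreConst α β * ∫ y in unitCell, ‖G y‖ ^ 2 := by
  have hα := hb.pos
  have hσ := hq.memLp_flux hA
  have h1 : ∫ y in unitCell, ‖G y + rmul (A y)⁻¹ (q y + c)‖ ^ 2 ≤
      2 * (∫ y in unitCell, ‖G y‖ ^ 2) + 2 * ∫ y in unitCell, ‖rmul (A y)⁻¹ (q y + c)‖ ^ 2 := by
    rw [← integral_const_mul, ← integral_const_mul, ← integral_add
      ((hG.integrable_norm_pow two_ne_zero).const_mul 2)
      ((hσ.integrable_norm_pow two_ne_zero).const_mul 2)]
    have hsum : MemLp (fun y => G y + rmul (A y)⁻¹ (q y + c)) 2 cellMeasure := hG.add hσ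
    refine integral_mono (hsum.integrable_norm_pow two_ne_zero)
      (((hG.integrable_norm_pow two_ne_zero).const_mul 2).add
      ((hσ.integrable_norm_pow two_ne_zero).const_mul 2)) fun y => ?_
    have := norm_add_le (G y) (rmul (A y)⁻¹ (q y + c))
    simp only
    nlinarith [norm_nonneg (G y + rmul (A y)⁻¹ (q y + c)),
      sq_nonneg (‖G y‖ - ‖rmul (A y)⁻¹ (q y + c)‖)]
  have h2 := hq.integral_norm_flux_sq_le hA hb
  have h3 := hq.integral_norm_sq_le hA hb
  have h4 := norm_cellCoeff_sq_le hG 0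
  have h5 : ‖c‖ ^ 2 ≤ α⁻¹ ^ 2 * ∫ y in unitCell, ‖G y‖ ^ 2 := by
    refine (pow_le_pow_left₀ (norm_nonneg _) hc 2).trans ?_
    rw [mul_pow]
    gcongr
  have h6 : ∫ y in unitCell, ‖rmul (A y)⁻¹ (q y + c)‖ ^ 2 ≤
      β ^ 2 * ((β / α) ^ 2 * (α⁻¹ ^ 2 * ∫ y in unitCell, ‖G y‖ ^ 2)) := by
    refine h2.trans ?_
    gcongr
    exact h3.trans (by gcongr)
  unfold fibreConst
  linarith

/-- The estimate of the error on a fibre. -/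
lemma tsum_fibre_le (hA : IsCoefficient A) (hb : CoeffBounds A α β)
    (hgrad : ∀ (j : Fin 3) (φ : R3 → ℂ), ContDiff ℝ ∞ φ → IsPeriodic φ →
      ∫ y in unitCell, pderiv j φ y = 0) (hP : IsCellFamily A volume Ψ P) (hε : 0 < ε)
    (hθ : θ ∈ dualCell ε) (hF : MemLp F 2 cellMeasure) (hG : MemLp G 2 cellMeasure)
    (heq : ∀ m, cmul (crossMatrix (θ + ε⁻¹ • mode m)) (cmul (crossMatrix (θ + ε⁻¹ • mode m))
      (cellCoeff m F)) + (cellCoeff m (fun y => rmul (A y)⁻¹ (F y)) + cellCoeff m G) = 0)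
    (hdiv : ∀ m, inner ℂ (cvec (θ + ε⁻¹ • mode m)) (cellCoeff m G) = 0) :
    ∑' m, ‖cmul (crossMatrix (θ + ε⁻¹ • mode m)) (cellCoeff m F) +
      cmul (crossMatrix (θ + ε⁻¹ • mode m)) (cmul (homSymbol (homMatrix A volume
        (ε • (θ + ε⁻¹ • mode m)) (P (ε • (θ + ε⁻¹ • mode m)))) (θ + ε⁻¹ • mode m))
        (cellCoeff m G))‖ₑ ^ 2 ≤
      ENNReal.ofReal (fibreConst α β * (ε / Real.pi) ^ 2) * ∑' m, ‖cellCoeff m G‖ₑ ^ 2 := by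
  have hcoer := fun κ => hP.coercive hA hb hgrad κ
  set H := fun κ => homMatrix A volume κ (P κ) with hH
  -- The homogenised solution at frequency `θ`. With it the mean flux of the corrector satisfies the
  -- cell average of the equation exactly.
  set c : C3 := -cmul (homSymbol (H (ε • θ)) θ) (cellCoeff 0 G) with hcdef
  obtain ⟨q, hq, hHc⟩ := hP.exists_isCorrector hA (ε • θ) c
  have hspec : cmul (crossMatrix θ) (cmul (crossMatrix θ) c) +
      cellCoeff 0 (fun y => rmul (A y)⁻¹ (q y + c)) = -cellCoeff 0 G := by
    rw [← hHc, hcdef, cmul_neg, cmul_neg, cmul_neg, ← neg_add, homSymbol_spec hb.pos (hcoer _)]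
  have hcn : ‖c‖ ≤ α⁻¹ * ‖cellCoeff 0 G‖ := by
    rw [hcdef, norm_neg]
    exact norm_homSymbol_le hb.pos (hcoer _) θ _
  have hσ := hq.memLp_flux hA
  have hz : MemLp (fun y => F y - (q y + c)) 2 cellMeasure := hF.sub hq.memLp_add_const
  have haz : MemLp (fun y => rmul (A y)⁻¹ (F y - (q y + c))) 2 cellMeasure :=
    memLp_rmul hA.continuous_inv hb.inv_le hz
  have hs : MemLp (fun y => G y + rmul (A y)⁻¹ (q y + c)) 2 cellMeasure := hG.add hσ
  have hpi := Real.pi_pos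
  set s : (Fin 3 → ℤ) → ℝ := fun m => ‖cmul (crossMatrix (θ + ε⁻¹ • mode m)) (cellCoeff m F) +
      cmul (crossMatrix (θ + ε⁻¹ • mode m)) (cmul (homSymbol (H (ε • (θ + ε⁻¹ • mode m)))
        (θ + ε⁻¹ • mode m)) (cellCoeff m G))‖ ^ 2 with hsdef
  -- The bound for the error, doubled by `(a + b)² ≤ 2a² + 2b²`, together with the homogenised field
  -- at modes `m ≠ 0`. The energy terms have no sign mode by mode, so they are kept until the sum.
  have hle : ∀ m, s m ≤ -4 * (inner ℂ (cellCoeff m fun y => F y - (q y + c))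
        (cellCoeff m fun y => rmul (A y)⁻¹ (F y - (q y + c)))).re +
      (ε / Real.pi) ^ 2 * (2 * ‖cellCoeff m fun y => G y + rmul (A y)⁻¹ (q y + c)‖ ^ 2 +
        2 * ‖cellCoeff m G‖ ^ 2) := fun m => by
    have h1 := norm_cross_sub_sq_le hA hb hgrad hε hθ hF hG heq hdiv hq hspec m
    set ξ := θ + ε⁻¹ • mode m with hξ
    set W := cmul (crossMatrix ξ) (cmul (homSymbol (H (ε • ξ)) ξ) (cellCoeff m G)) with hW
    have h2 : ‖cmul (crossMatrix ξ) (cellCoeff m F) + W‖ ≤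
        ‖cmul (crossMatrix ξ) (cellCoeff m F - if m = 0 then c else 0)‖ +
          ε / Real.pi * ‖cellCoeff m G‖ := by
      by_cases hm : m = 0
      · have hξθ : ξ = θ := by rw [hξ, hm, mode_zero, smul_zero, add_zero]
        rw [if_pos hm, cmul_sub, hcdef, cmul_neg, sub_neg_eq_add, hW, hξθ, hm]
        exact le_add_of_nonneg_right (by positivity)
      · rw [if_neg hm, sub_zero]
        refine (norm_add_le _ _).trans ?_
        gcongr
        have h3 := norm_mul_norm_cross_homSymbol_le hb.pos (hcoer (ε • ξ)) ξ _ (hdiv m)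
        have h4 := pi_le_mul_norm_of_mem_dualCell hε hθ hm
        rw [div_mul_eq_mul_div, le_div_iff₀ hpi]
        calc ‖W‖ * Real.pi ≤ ‖W‖ * (ε * ‖ξ‖) := by gcongr
          _ = ε * (‖ξ‖ * ‖W‖) := by ring
          _ ≤ _ := by gcongr
    have h5 := pow_le_pow_left₀ (norm_nonneg _) h2 2
    have h6 := sq_nonneg (‖cmul (crossMatrix ξ) (cellCoeff m F - if m = 0 then c else 0)‖ -
      ε / Real.pi * ‖cellCoeff m G‖)
    simp only [hsdef]
    nlinarith
  have hsum := (((hasSum_inner_cellCoeff hz haz).mapL Complex.reCLM).mul_left (-4)).add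
    ((((hasSum_norm_sq_cellCoeff hs).mul_left 2).add
      ((hasSum_norm_sq_cellCoeff hG).mul_left 2)).mul_left ((ε / Real.pi) ^ 2))
  have hs0 : ∀ m, 0 ≤ s m := fun m => by positivity
  have hsS : Summable s := hsum.summable.of_nonneg_of_le hs0 hle
  -- After summation Parseval turns the energy terms into this integral, and positivity of `A⁻¹`
  -- allows them to be dropped.
  have hpos : 0 ≤ (∫ y in unitCell, inner ℂ (F y - (q y + c)) (rmul (A y)⁻¹ (F y - (q y + c)))).re := by
    have hre := integral_re (integrable_inner_C3 hz haz)
    simp only [RCLike.re_to_complex] at hre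
    rw [← hre]
    refine integral_nonneg fun y => le_trans ?_ (hb.lower y _)
    have := hb.pos
    positivity
  have htot : ∑' m, s m ≤ fibreConst α β * (ε / Real.pi) ^ 2 * ∫ y in unitCell, ‖G y‖ ^ 2 := by
    have h1 := hasSum_le hle hsS.hasSum hsum
    have h2 := integral_norm_add_flux_sq_le hA hb hG hq hcn
    have h3 := mul_le_mul_of_nonneg_left h2 (sq_nonneg (ε / Real.pi))
    simp only [Complex.reCLM_apply] at h1
    linarith
  have hterm : ∀ m, ‖cmul (crossMatrix (θ + ε⁻¹ • mode m)) (cellCoeff m F) +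
      cmul (crossMatrix (θ + ε⁻¹ • mode m)) (cmul (homSymbol (H (ε • (θ + ε⁻¹ • mode m)))
        (θ + ε⁻¹ • mode m)) (cellCoeff m G))‖ₑ ^ 2 = ENNReal.ofReal (s m) := fun m => by
    rw [hsdef, ENNReal.ofReal_pow (norm_nonneg _), ofReal_norm]
  change ∑' m, ‖cmul (crossMatrix (θ + ε⁻¹ • mode m)) (cellCoeff m F) +
      cmul (crossMatrix (θ + ε⁻¹ • mode m)) (cmul (homSymbol (H (ε • (θ + ε⁻¹ • mode m)))
        (θ + ε⁻¹ • mode m)) (cellCoeff m G))‖ₑ ^ 2 ≤ _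
  simp only [hterm]
  rw [← ENNReal.ofReal_tsum_of_nonneg hs0 hsS, ← eLpNorm_sq_eq_tsum_cellCoeff hG,
    integral_norm_sq_eq hG, ← ENNReal.ofReal_mul (by have := fibreConst_pos α β; positivity)]
  exact ENNReal.ofReal_le_ofReal htot

end

/-! ### The estimate in the whole space -/

section

variable {A : R3 → Matrix (Fin 3) (Fin 3) ℝ} {Ψ : R3 → Fin 3 → R3 → ℂ} {P : R3 → Fin 3 → R3 → C3}
  {α β ε : ℝ} {g : R3 → C3}

/-- The Fourier transform of the homogenised field and of its curl are square integrable. -/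
lemma memLp_homSymbol_ft (hA : IsCoefficient A) (hb : CoeffBounds A α β)
    (hgrad : ∀ (j : Fin 3) (φ : R3 → ℂ), ContDiff ℝ ∞ φ → IsPeriodic φ →
      ∫ y in unitCell, pderiv j φ y = 0) (hP : IsCellFamily A volume Ψ P) (hg : MemLp g 2 volume) :
    MemLp (fun θ => cmul (homSymbol (homMatrix A volume (ε • θ) (P (ε • θ))) θ) (ft g θ)) 2 volume ∧
    MemLp (fun θ => cmul (crossMatrix θ)
      (cmul (homSymbol (homMatrix A volume (ε • θ) (P (ε • θ))) θ) (ft g θ))) 2 volume := by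
  have hm := hP.aestronglyMeasurable_homSymbol hA ε (memLp_ft hg).1
  have hcoer := fun κ => hP.coercive hA hb hgrad κ
  exact ⟨(memLp_ft hg).of_le_mul hm
      (Eventually.of_forall fun θ => norm_homSymbol_le hb.pos (hcoer _) θ _),
    (memLp_ft hg).of_le_mul (aestronglyMeasurable_cross hm)
      (Eventually.of_forall fun θ => norm_cross_homSymbol_le hb.pos (hcoer _) θ _)⟩

/-- By Plancherel the error is an integral over all frequencies. Folding it onto the dual cell turns
the integrand into the sum over modes bounded on each fibre; unfolding the bound gives back the norm
of `g`. -/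
lemma eLpNorm_sub_ift_le (hA : IsCoefficient A) (hb : CoeffBounds A α β)
    (hgrad : ∀ (j : Fin 3) (φ : R3 → ℂ), ContDiff ℝ ∞ φ → IsPeriodic φ →
      ∫ y in unitCell, pderiv j φ y = 0) (hP : IsCellFamily A volume Ψ P) (hε : 0 < ε)
    (hg : MemLp g 2 volume) (hd : IsDivFree volume g) {𝓓 𝓑 : R3 → C3}
    (hs : IsMaxwellSolution A volume ε g 𝓓 𝓑) :
    eLpNorm (fun x => 𝓑 x - ift (fun θ => cmul (crossMatrix θ)
      (cmul (homSymbol (homMatrix A volume (ε • θ) (P (ε • θ))) θ) (ft g θ))) x) 2 volume ≤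
    ENNReal.ofReal (√(fibreConst α β) / Real.pi * ε) * eLpNorm g 2 volume := by
  rw [IsMaxwellSolution, scaledMeasure_volume hε] at hs
  set S := sqrtCoeff A ε with hS
  set D : R3 → C3 := fun x => rmul (S x) (𝓓 x) with hD
  set w : R3 → C3 := fun x => -𝓑 x with hw
  set E : R3 → C3 := fun x => rmul (S x) (D x) with hE
  obtain ⟨-, hX2⟩ := memLp_homSymbol_ft (ε := ε) hA hb hgrad hP hg
  set W : R3 → C3 := fun θ => cmul (crossMatrix θ)
      (cmul (homSymbol (homMatrix A volume (ε • θ) (P (ε • θ))) θ) (ft g θ)) with hWdef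
  have hSle : ∀ x v, ‖rmul (S x) v‖ ≤ β * ‖v‖ := fun x v => hb.sqrt_le _ v
  have hE2 : MemLp E 2 volume := memLp_rmul (hA.continuous_sqrtCoeff ε) hSle hs.mem.left_mem
  have hw2 : MemLp w 2 volume := hs.mem.right_mem
  have hB2 : MemLp 𝓑 2 volume := hw2.neg.ae_eq (Eventually.of_forall fun x => by simp [hw])
  have haE : (fun x => rmul (msqrt (A (ε⁻¹ • x)))⁻¹ (D x)) = fun x => rmul (A (ε⁻¹ • x))⁻¹ (E x) := funext fun x =>
    (rmul_inv_msqrt (hA.posDef _) _).symm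
  have hft1 : ft w =ᵐ[volume] fun ξ => cmul (crossMatrix ξ) (ft E ξ) := hs.mem.ft_eq (hA.continuous_sqrtCoeff ε) hSle
  have hft2 := hs.ft_eq (β := β) (hA.continuous_msqrt_inv.comp (continuous_const_smul ε⁻¹))
    (fun x => msqrt_isHermitian _) (fun x => isUnit_det_msqrt (hA.posDef _))
    (fun x v => hb.sqrt_inv_le _ v) hg
  rw [haE] at hft2
  have hdiv := hd.ae_inner_ft hg
  obtain ⟨F, hF⟩ := exists_isFloquetTransform hε hE2
  obtain ⟨G, hG⟩ := exists_isFloquetTransform hε hg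
  have haF := hF.rmul hε hA.continuous_inv (fun j x => by simp only [hA.periodic j x]) hb.inv_le
  have haE2 : MemLp (fun x => rmul (A (ε⁻¹ • x))⁻¹ (E x)) 2 volume :=
    memLp_rmul (hA.continuous_inv.comp (continuous_const_smul ε⁻¹)) (fun x => hb.inv_le _) hE2
  have hsub : MemLp (fun x => 𝓑 x - ift W x) 2 volume := hB2.sub (memLp_ift hX2)
  refine (ENNReal.pow_right_strictMono two_ne_zero).le_iff_le.1 ?_
  have hae : (ft fun x => 𝓑 x - ift W x) =ᵐ[volume] fun ξ =>
      -(cmul (crossMatrix ξ) (ft E ξ) + W ξ) := by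
    have hBw : 𝓑 = fun x => (-1 : ℂ) • w x := funext fun x => by simp [hw]
    filter_upwards [ft_sub hB2 (memLp_ift hX2), ft_ift hX2, hft1, ft_const_smul hw2 (-1)]
      with ξ h1 h2 h3 h4
    rw [← hBw] at h4
    rw [h1, h2, h4, h3, neg_one_smul]
    abel
  have hmeas : AEMeasurable (fun ξ => ‖cmul (crossMatrix ξ) (ft E ξ) + W ξ‖ₑ ^ 2) volume :=
    ((aestronglyMeasurable_cross (memLp_ft hE2).1).add hX2.1).enorm.pow_const 2
  have hfib : ∀ᵐ θ ∂(volume.restrict (dualCell ε)),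
      ∑' m, ‖cmul (crossMatrix (θ + ε⁻¹ • mode m)) (ft E (θ + ε⁻¹ • mode m)) +
        W (θ + ε⁻¹ • mode m)‖ₑ ^ 2 ≤
      ENNReal.ofReal (fibreConst α β * (ε / Real.pi) ^ 2) *
        ∑' m, ‖ft g (θ + ε⁻¹ • mode m)‖ₑ ^ 2 := by
    filter_upwards [hF.ae_cellCoeff hε hE2, hG.ae_cellCoeff hε hg, haF.ae_cellCoeff hε haE2,
      ae_memLp_of_memLp_prod hF.mem, ae_memLp_of_memLp_prod hG.mem, ae_dualCell hft1 ε,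
      ae_dualCell hft2 ε, ae_dualCell hdiv ε, ae_restrict_mem (measurableSet_dualCell ε)]
      with θ h1 h2 h3 h4 h5 h6 h7 h8 h9
    have key := tsum_fibre_le hA hb hgrad hP hε h9 h4 h5 (fun m => ?_) fun m => ?_
    · simp only [h1, h2] at key
      exact key
    · have := h7 m
      rw [h6 m, ← h1 m, ← h2 m, ← h3 m] at this
      exact this
    · rw [h2 m]
      exact h8 m
  calc eLpNorm (fun x => 𝓑 x - ift W x) 2 volume ^ 2
      = ∫⁻ ξ, ‖cmul (crossMatrix ξ) (ft E ξ) + W ξ‖ₑ ^ 2 := by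
        rw [← eLpNorm_ft hsub, eLpNorm_congr_ae hae, eLpNorm_two_sq]
        simp only [enorm_neg]
    _ = ∫⁻ θ in dualCell ε, ∑' m, ‖cmul (crossMatrix (θ + ε⁻¹ • mode m))
          (ft E (θ + ε⁻¹ • mode m)) + W (θ + ε⁻¹ • mode m)‖ₑ ^ 2 :=
        lintegral_dualCell_tiling hε _ hmeas
    _ ≤ ∫⁻ θ in dualCell ε, ENNReal.ofReal (fibreConst α β * (ε / Real.pi) ^ 2) *
          ∑' m, ‖ft g (θ + ε⁻¹ • mode m)‖ₑ ^ 2 := lintegral_mono_ae hfib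
    _ = ENNReal.ofReal (fibreConst α β * (ε / Real.pi) ^ 2) * eLpNorm g 2 volume ^ 2 := by
        rw [lintegral_const_mul' _ _ ENNReal.ofReal_ne_top,
          ← lintegral_dualCell_tiling hε (fun ξ => ‖ft g ξ‖ₑ ^ 2) ((memLp_ft hg).1.enorm.pow_const 2),
          ← eLpNorm_two_sq, eLpNorm_ft hg]
    _ = (ENNReal.ofReal (√(fibreConst α β) / Real.pi * ε) * eLpNorm g 2 volume) ^ 2 := by
        have := Real.pi_pos
        rw [mul_pow, ← ENNReal.ofReal_pow (by positivity), mul_pow, div_pow, div_pow,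
          Real.sq_sqrt (fibreConst_pos α β).le]
        congr 2
        ring

end

end MaxwellHom

theorem mainTheorem8 (μ : MeasureTheory.Measure MaxwellHom.R3)
    (hper : MaxwellHom.IsPeriodicMeasure μ) (hmass : μ MaxwellHom.unitCell = 1)
    (hgrad : ∀ (j : Fin 3) (φ : MaxwellHom.R3 → ℂ), ContDiff ℝ ∞ φ → MaxwellHom.IsPeriodic φ →
      ∫ y in MaxwellHom.unitCell, MaxwellHom.pderiv j φ y ∂μ = 0)
    (A : MaxwellHom.R3 → Matrix (Fin 3) (Fin 3) ℝ) (hA : MaxwellHom.IsCoefficient A) :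
    (∀ (κ : MaxwellHom.R3) (c : MaxwellHom.C3), ∃ ψ p, MaxwellHom.IsCellSolution A μ κ c ψ p) ∧
    ∃ C : ℝ, 0 < C ∧
      ∀ (Ψ : MaxwellHom.R3 → Fin 3 → MaxwellHom.R3 → ℂ)
        (P : MaxwellHom.R3 → Fin 3 → MaxwellHom.R3 → MaxwellHom.C3),
        MaxwellHom.IsCellFamily A μ Ψ P →
      ∀ ε : ℝ, 0 < ε →
      ∀ g : MaxwellHom.R3 → MaxwellHom.C3,
        MeasureTheory.MemLp g 2 (MaxwellHom.scaledMeasure μ ε) →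
        MaxwellHom.IsDivFree (MaxwellHom.scaledMeasure μ ε) g →
        ∃ ghat : MaxwellHom.R3 → MaxwellHom.C3,
          MaxwellHom.IsFourierTransform (MaxwellHom.scaledMeasure μ ε) g ghat ∧
          (∃ G : MaxwellHom.R3 → MaxwellHom.R3 → MaxwellHom.C3,
            MaxwellHom.IsFloquetTransform μ ε g G ∧
            ∀ᵐ θ ∂(MeasureTheory.volume.restrict (MaxwellHom.dualCell ε)),
              ∫ y in MaxwellHom.unitCell, G θ y ∂μ = ghat θ) ∧
          ∃ U W : MaxwellHom.R3 → MaxwellHom.C3,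
            MaxwellHom.IsInverseWithCurl (MaxwellHom.scaledMeasure μ ε)
              (fun θ => MaxwellHom.cmul (MaxwellHom.homSymbol
                (MaxwellHom.homMatrix A μ (ε • θ) (P (ε • θ))) θ) (ghat θ)) U W ∧
            ∀ 𝓓 𝓑 : MaxwellHom.R3 → MaxwellHom.C3,
              MaxwellHom.IsMaxwellSolution A μ ε g 𝓓 𝓑 →
              MeasureTheory.eLpNorm (fun x => 𝓑 x - W x) 2 (MaxwellHom.scaledMeasure μ ε) ≤
                ENNReal.ofReal (C * ε) *
                  MeasureTheory.eLpNorm g 2 (MaxwellHom.scaledMeasure μ ε) := by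
  have hμ := MaxwellHom.eq_volume_of_integral_pderiv_eq_zero hper hmass hgrad
  -- From here `hgrad` speaks of Lebesgue measure and serves as integration by parts on the cell.
  subst hμ
  obtain ⟨α, β, hb⟩ := hA.exists_bounds
  -- The constant depends only on the bounds of `A`. The factor `π` comes from `‖θ + 2πm/ε‖ ≥ π/ε`
  -- for `θ` in the dual cell and `m ≠ 0`.
  refine ⟨fun κ c => ?_, √(MaxwellHom.fibreConst α β) / Real.pi, ?_, fun Ψ P hP ε hε g hg hd => ?_⟩
  · obtain ⟨q, hq⟩ := MaxwellHom.exists_isCorrector hA κ c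
    obtain ⟨ψ, hψ⟩ := hq.exists_isCellSolution hgrad
    exact ⟨ψ, _, hψ⟩
  · exact div_pos (Real.sqrt_pos.2 (MaxwellHom.fibreConst_pos α β)) Real.pi_pos
  · rw [MaxwellHom.scaledMeasure_volume hε] at hg hd ⊢
    obtain ⟨G, hG⟩ := MaxwellHom.exists_isFloquetTransform hε hg
    obtain ⟨h1, h2⟩ := MaxwellHom.memLp_homSymbol_ft (ε := ε) hA hb hgrad hP hg
    refine ⟨MaxwellHom.ft g, MaxwellHom.isFourierTransform_ft hg, ⟨G, hG, ?_⟩, _, _,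
      MaxwellHom.isInverseWithCurl_ift h1 h2, fun 𝓓 𝓑 hs =>
        MaxwellHom.eLpNorm_sub_ift_le hA hb hgrad hP hε hg hd hs⟩
    -- The cell mean is the coefficient of mode zero, which is the Fourier transform at `θ` itself.
    filter_upwards [hG.ae_cellCoeff hε hg] with θ hθ
    have h0 := hθ 0
    rwa [MaxwellHom.cellCoeff_zero, MaxwellHom.mode_zero, smul_zero, add_zero] at h0
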